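/- Let $A\in\mathbb R^{n\times n}$, $\omega>0$, and let $P:\mathbb R\to\mathbb R^{n\times n}$ be $2\pi/\omega$-periodic and square-integrable over a period. Put $M(t):=e^{-At}P(t)e^{At}$ and let $\|\cdot\|$ be the Euclidean norm on $\mathbb R^n$. Expansions and the growth component. An expansion of $M$ is a series $$M(t)=\sum_{(a,b,k)\in\Sigma}\bigl(C_{abk}\,t^ke^{at}\cos(bt)+D_{abk}\,t^ke^{at}\sin(bt)\bigr)$$ with real constant matrices $C_{abk},D_{abk}$, converging unconditionally in $L^2$ on every bounded interval, where $a$ takes finitely many real values, $k\in\{0,1,\dots,2n-2\}$ (only $k=0$ if $n=0$), and $b\ge 0$ lies in a finite union of translates of $\omega\mathbb Z$. We write $\mathcal G[M]=G$ if $M$ has an expansion and in every expansion of $M$ the partial sum over the indices with $a>0$, or $a=0$ and $k\neq0$, or $a=k=b=0$, equals $G$. (i) Suppose that $M$ is uniformly bounded, i.e. essentially bounded on $t\ge 0$. Then there is a constant matrix $B$ (depending only on $A$ and $P$) such that the following holds. For every $\hat C>0$ there is a constant $C>0$ such that for every $\epsilon>0$, every $f$ such that $e^{-At}f(t)$ is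 integrable on $[0,\hat C\epsilon^{-1}]$, and every solution $x$ (in the integral, i.e. Carathéodory, sense) of $$\dot x=Ax+\epsilon P(t)x+f(t)\quad\text{on }[0,\hat C\epsilon^{-1}],$$ the cell problem $$\dot\Omega=\epsilon B\Omega+\epsilon F(t),\qquad F(t):=M(t)\int_0^te^{-A\tau}f(\tau)\,d\tau,\qquad \Omega(0)=x(0),$$ has a solution on $[0,\hat C\epsilon^{-1}]$, and for every such $\Omega$ one has, for $0\le t\le\hat C\epsilon^{-1}$, $$x(t)=e^{At}\Bigl(\Omega(t)+\int_0^te^{-A\tau}f(\tau)\,d\tau+E(t,\epsilon)\Bigr),$$ $$\|E(t,\epsilon)\|\le C\epsilon\, e^{\epsilon^2Ct}\Bigl(\max_{\tau\in[0,t]}\|\Omega(\tau)\|+\max_{\tau\in[0,t]}\Bigl\|\int_0^\tau e^{-As}f(s)\,ds\Bigr\|\Bigr).$$ Thus $C$ does not depend on $t$, $\epsilon$, $f$ or $x$. Moreover $$B=\mathcal G[M]=\lim_{T\to\infty}\frac1T\int_0^TM(\tau)\,d\tau .$$ (ii) The limit $\lim_{T\to\infty}\frac1T\int_0^TM(\tau)\,d\tau$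 exists if and only if $M$ is uniformly bounded in the $L^2$ sense, i.e. each entry of $M$ satisfies $\sup_{s\ge0}\int_s^{s+2\pi/\omega}|M_{ij}(\tau)|^2\,d\tau<\infty$. If $P$ is essentially bounded, the limit exists if and only if $M$ is uniformly bounded, i.e. essentially bounded on $t\ge0$. -/

import Mathlib

open Real Set Filter Topology MeasureTheory

noncomputable section

namespace TemporalHomogenization

/-- Real `n × n` matrices. -/
abbrev Mat (n : ℕ) : Type := Matrix (Fin n) (Fin n) ℝ

/-- `ℝⁿ` with the Euclidean norm. -/
abbrev Vec (n : ℕ) : Type := EuclideanSpace ℝ (Fin n)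

/-- The matrix-vector product on `ℝⁿ`. -/
def act {n : ℕ} (N : Mat n) (v : Vec n) : Vec n := WithLp.toLp 2 (N.mulVec v.ofLp)

/-- `exp(A t)`. -/
def flow {n : ℕ} (A : Mat n) (t : ℝ) : Mat n := NormedSpace.exp (t • A)

/-- `exp(-A t) P(t) exp(A t)`. -/
def conj {n : ℕ} (A : Mat n) (P : ℝ → Mat n) (t : ℝ) : Mat n :=
  flow A (-t) * P t * flow A t

/-- `M` is uniformly (essentially) bounded on `t ≥ 0`; entrywise, which is the same as
boundedness in any matrix norm. -/
def UniformlyBounded {n : ℕ} (M : ℝ → Mat n) : Prop :=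
  ∃ K : ℝ, ∀ᵐ t : ℝ, 0 ≤ t → ∀ i j, |M t i j| ≤ K

/-- `M` is bounded in `L²` uniformly over all windows of length `p` in `[0, ∞)`. -/
def L2UniformlyBounded {n : ℕ} (p : ℝ) (M : ℝ → Mat n) : Prop :=
  ∃ K : ℝ, ∀ s : ℝ, 0 ≤ s → ∀ i j, ∫ τ in s..(s + p), (M τ i j) ^ 2 ≤ K

/-- The time average `(1 / T) ∫₀ᵀ M(τ) dτ`. -/
def timeAverage {n : ℕ} (M : ℝ → Mat n) (T : ℝ) : Mat n :=
  Matrix.of fun i j => (1 / T) * ∫ τ in (0 : ℝ)..T, M τ i j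

/-- The term `C t^k e^{at} cos(bt) + D t^k e^{at} sin(bt)` with index `σ = (a, b, k)`. -/
def modeTerm {n : ℕ} (C D : ℝ × ℝ × ℕ → Mat n) (σ : ℝ × ℝ × ℕ) (t : ℝ) : Mat n :=
  (t ^ σ.2.2 * Real.exp (σ.1 * t)) •
    (Real.cos (σ.2.1 * t) • C σ + Real.sin (σ.2.1 * t) • D σ)

/-- The series of the terms with index in `S` converges (unconditionally) to `M`
in `L²` on every bounded interval. -/
def HasL2Sum {n : ℕ} (S : Set (ℝ × ℝ × ℕ)) (C D : ℝ × ℝ × ℕ → Mat n) (M : ℝ → Mat n) : Prop :=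
  ∀ R : ℝ, 0 < R → ∀ i j,
    Tendsto (fun s : Finset S =>
      eLpNorm (fun t => M t i j - ∑ σ ∈ s, modeTerm C D σ.1 t i j) 2
        (volume.restrict (Icc (-R) R))) atTop (𝓝 0)

/-- `M` is expanded as a linear combination of `t^k e^{at} cos(bt)` and `t^k e^{at} sin(bt)`:
the `a` range over a finite set, `k ≤ 2n - 2`, and the `b ≥ 0` over the countable set of
frequencies that a `2π/ω`-periodic function multiplied by finitely many trigonometric
functions can have, i.e. finitely many translates of `ω ℤ`. -/
structure IsExpansion {n : ℕ} (ω : ℝ) (M : ℝ → Mat n) (S : Set (ℝ × ℝ × ℕ))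
    (C D : ℝ × ℝ × ℕ → Mat n) : Prop where
  exponent_finite : (Prod.fst '' S).Finite
  frequency_nonneg : ∀ σ ∈ S, 0 ≤ σ.2.1
  frequency_mem : ∃ Θ : Finset ℝ, ∀ σ ∈ S, ∃ θ ∈ Θ, ∃ l : ℤ, σ.2.1 = θ + l * ω
  degree_le : ∀ σ ∈ S, σ.2.2 ≤ 2 * n - 2
  hasSum : HasL2Sum S C D M

/-- The indices `(a, b, k)` with `a > 0`, or `a = 0` and `k ≠ 0`, or `a = k = b = 0`. -/
def growthIndices : Set (ℝ × ℝ × ℕ) :=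
  {σ | 0 < σ.1 ∨ (σ.1 = 0 ∧ σ.2.2 ≠ 0) ∨ (σ.1 = 0 ∧ σ.2.2 = 0 ∧ σ.2.1 = 0)}

/-- `𝒢[M] = G`: an expansion of `M` exists, and in every expansion of `M` the terms
with index in `growthIndices` sum up to `G`. -/
def IsGrowthComponent {n : ℕ} (ω : ℝ) (M G : ℝ → Mat n) : Prop :=
  (∃ S C D, IsExpansion ω M S C D) ∧
    ∀ S C D, IsExpansion ω M S C D → HasL2Sum (S ∩ growthIndices) C D G

/-- `x` is a (Carathéodory) solution of `ẋ = N(t) x + h(t)` on `[0, S]`. -/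
def IsSolution {n : ℕ} (S : ℝ) (N : ℝ → Mat n) (h : ℝ → Vec n) (x : ℝ → Vec n) : Prop :=
  ContinuousOn x (Icc 0 S) ∧
  IntegrableOn (fun τ => act (N τ) (x τ) + h τ) (Icc 0 S) ∧
  ∀ t ∈ Icc 0 S, x t = x 0 + ∫ τ in (0 : ℝ)..t, (act (N τ) (x τ) + h τ)

/-- `∫₀ᵗ exp(-A τ) f(τ) dτ`. -/
def forcing {n : ℕ} (A : Mat n) (f : ℝ → Vec n) (t : ℝ) : Vec n :=
  ∫ τ in (0 : ℝ)..t, act (flow A (-τ)) (f τ)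

/-- `max_{τ ∈ [0,t]} ‖y(τ)‖`, for `y` continuous on `[0,t]`. -/
def maxNorm {n : ℕ} (y : ℝ → Vec n) (t : ℝ) : ℝ :=
  sSup ((fun τ => ‖y τ‖) '' Icc 0 t)

end TemporalHomogenization

end

open TemporalHomogenization

/-! Write T = 2π/ω and L X = e^{-AT} X e^{AT}. Since P is periodic, M(t + T) = L M(t), so the
long-time behaviour of M is that of the powers of one linear map on a finite-dimensional space.

Means. Let V be the space of matrices with bounded forward L-orbit. On V the eigenvalue 1 is
semisimple, so V = ker (L - 1) ⊕ im (L - 1). If M is bounded in L² over windows, then X = ∫₀ᵀ M lies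
in V and X = y + (Lz - z) with Ly = y. The integrals over successive windows telescope, and M - B
has a bounded primitive for B = y / T (`exists_mean_bounded_primitive`). Conversely, if the mean
exists, then L^N ∫₀ˢ M = o(N). Jordan theory over ℂ turns sublinear orbits into bounded ones,
Lebesgue differentiation puts M(s) in V for almost every s, and Banach–Steinhaus gives ‖M(s + NT)‖ ≤
K ‖M(s)‖ with K independent of N (`exists_ae_norm_conjEntries_le`).

Averaging. With w = e^{-At} x and φ the integral of e^{-At} f, the error E = w - Ω - φ satisfies E'
= εME + ε(M - B)Ω. The last term is integrated by parts against the bounded primitive of M - B. As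
Ω' = O(ε) and the time interval has length Ĉ/ε, it contributes O(ε), and Gronwall finishes
(`norm_sub_cell_le`).

Growth component. An expansion exists because the entries of e^{±At} are exponential polynomials of
degree < n and P has an L² Fourier series. For an arbitrary expansion, the integrals of M(t + NT)
e^{-w₀t} over [0, T], as sequences in N, are sums of terms z^N q(N) with q polynomial. Only finitely
many multipliers z = e^{(a ± ib)T} occur, because ωT = 2π. Hence a polynomial in the shift N ↦ N + 1
isolates a single mode (`exists_extraction`). Boundedness of M kills the growing modes, and the
bounded primitive of M - B identifies the constant mode with B. -/

namespace TemporalHomogenization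

/-! ### Bounded and sublinear orbits of a linear map -/

section BoundedOrbits

variable {𝕜 V : Type*} [RCLike 𝕜] [NormedAddCommGroup V] [NormedSpace 𝕜 V]

/-- The vectors with a bounded forward orbit under `f`. -/
def boundedOrbits (f : Module.End 𝕜 V) : Submodule 𝕜 V where
  carrier := {x | ∃ K : ℝ, ∀ N : ℕ, ‖(f ^ N) x‖ ≤ K}
  zero_mem' := ⟨0, fun N => by simp⟩
  add_mem' := by
    rintro x y ⟨K, hK⟩ ⟨L, hL⟩
    refine ⟨K + L, fun N => ?_⟩
    rw [map_add]
    exact (norm_add_le _ _).trans (add_le_add (hK N) (hL N))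
  smul_mem' := by
    rintro c x ⟨K, hK⟩
    refine ⟨‖c‖ * K, fun N => ?_⟩
    rw [map_smul, norm_smul]
    exact mul_le_mul_of_nonneg_left (hK N) (norm_nonneg _)

theorem map_mem_boundedOrbits {f : Module.End 𝕜 V} {x : V} (hx : x ∈ boundedOrbits f) :
    f x ∈ boundedOrbits f := by
  obtain ⟨K, hK⟩ := hx
  refine ⟨K, fun N => ?_⟩
  have := hK (N + 1)
  rwa [pow_succ, Module.End.mul_apply] at this

/-- The vectors whose orbit grows sublinearly. -/
def sublinearOrbits (f : Module.End 𝕜 V) : Submodule 𝕜 V where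
  carrier := {x | Tendsto (fun N : ℕ => ‖(f ^ N) x‖ / N) atTop (𝓝 0)}
  zero_mem' := by simp
  add_mem' := by
    intro x y hx hy
    refine squeeze_zero (fun N => by positivity) (fun N => ?_) (by simpa using hx.add hy)
    rw [map_add, ← add_div]
    gcongr
    exact norm_add_le _ _
  smul_mem' := by
    intro c x hx
    have := hx.const_mul ‖c‖
    simp only [mem_ofPred_eq, map_smul, norm_smul, mul_div_assoc]
    simpa using this

theorem map_mem_sublinearOrbits {f : Module.End 𝕜 V} {x : V} (hx : x ∈ sublinearOrbits f) :
    f x ∈ sublinearOrbits f := by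
  have h1 : Tendsto (fun N : ℕ => ‖(f ^ (N + 1)) x‖ / ((N + 1 : ℕ) : ℝ)) atTop (𝓝 0) :=
    (tendsto_add_atTop_iff_nat (f := fun N : ℕ => ‖(f ^ N) x‖ / (N : ℝ)) 1).2 hx
  -- The factor 2 absorbs (N + 1) / N for N ≥ 1.
  have h2 := h1.const_mul 2
  rw [mul_zero] at h2
  refine squeeze_zero' (Eventually.of_forall fun N => by positivity) ?_ h2
  filter_upwards [eventually_ge_atTop 1] with N hN
  have hN' : (1 : ℝ) ≤ N := by exact_mod_cast hN
  rw [pow_succ, Module.End.mul_apply, mul_div_assoc', div_le_div_iff₀ (by linarith) (by positivity)]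
  push_cast
  nlinarith [norm_nonneg ((f ^ N) (f x))]

/-- A Jordan chain of length two. The factor N + 1 in front of z is what contradicts sublinear
growth when ‖c‖ ≥ 1. -/
theorem pow_apply_of_sub_smul_eq {f : Module.End 𝕜 V} {c : 𝕜} {y z : V} (hy : f y = c • y + z)
    (hz : f z = c • z) (N : ℕ) : (f ^ (N + 1)) y = c ^ (N + 1) • y + ((N + 1 : ℕ) * c ^ N) • z := by
  have hzN : ∀ N : ℕ, (f ^ N) z = c ^ N • z := by
    intro N
    induction N with
    | zero => simp
    | succ N ih => rw [pow_succ', Module.End.mul_apply, ih, map_smul, hz, smul_smul, pow_succ]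
  induction N with
  | zero => simp [hy]
  | succ N ih =>
    rw [pow_succ', Module.End.mul_apply, ih, map_add, map_smul, map_smul, hy, hz]
    push_cast
    module

/-- Induction on the length of the Jordan chain. If ‖c‖ < 1, the orbit is driven by the bounded
orbit of `g x` through a contraction. If ‖c‖ ≥ 1, sublinear growth leaves only eigenvectors with ‖c‖
= 1, or zero. -/
theorem mem_boundedOrbits_of_pow_sub_smul {f : Module.End 𝕜 V} (c : 𝕜) (m : ℕ) :
    ∀ x ∈ sublinearOrbits f, ((f - algebraMap 𝕜 _ c) ^ m) x = 0 → x ∈ boundedOrbits f := by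
  induction m with
  | zero =>
    intro x _ h
    have : x = 0 := by simpa using h
    rw [this]; exact zero_mem _
  | succ m ih =>
    intro x hx h
    set g := f - algebraMap 𝕜 _ c with hg
    have hfg : ∀ v, f v = c • v + g v := fun v => by simp [hg]
    have hgs : ∀ v ∈ sublinearOrbits f, g v ∈ sublinearOrbits f := fun v hv => by
      have : g v = f v - c • v := by rw [hfg]; simp
      rw [this]
      exact sub_mem (map_mem_sublinearOrbits hv) (Submodule.smul_mem _ _ hv)
    have hgx : g x ∈ boundedOrbits f := ih (g x) (hgs x hx) (by
      rw [← Module.End.mul_apply, ← pow_succ]; exact h)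
    by_cases hc : ‖c‖ < 1
    · obtain ⟨K, hK⟩ := hgx
      have hK0 : 0 ≤ K := (norm_nonneg _).trans (hK 0)
      -- K / (1 - ‖c‖) is the fixed point of u ↦ ‖c‖ u + K, so this bound is preserved at each step.
      refine ⟨‖x‖ + K / (1 - ‖c‖), fun N => ?_⟩
      have h1 : 0 < 1 - ‖c‖ := by linarith
      induction N with
      | zero => simp; positivity
      | succ N ihN =>
        have e : (f ^ (N + 1)) x = c • (f ^ N) x + (f ^ N) (g x) := by
          rw [pow_succ, Module.End.mul_apply, hfg, map_add, map_smul]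
        rw [e]
        calc ‖c • (f ^ N) x + (f ^ N) (g x)‖ ≤ ‖c‖ * ‖(f ^ N) x‖ + K := by
              refine (norm_add_le _ _).trans ?_
              rw [norm_smul]; exact add_le_add le_rfl (hK N)
          _ ≤ ‖c‖ * (‖x‖ + K / (1 - ‖c‖)) + K := by gcongr
          _ ≤ ‖x‖ + K / (1 - ‖c‖) := by
              have h2 : K / (1 - ‖c‖) * (1 - ‖c‖) = K := div_mul_cancel₀ _ h1.ne'
              nlinarith [norm_nonneg x]
    · push Not at hc
      -- A chain of length two grows at least like N ‖c‖ ^ N, so a generalised eigenvector with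
      -- sublinear orbit is annihilated by g itself.
      have key : ∀ m : ℕ, ∀ y ∈ sublinearOrbits f, (g ^ (m + 1)) y = 0 → g y = 0 := by
        intro m
        induction m with
        | zero => intro y _ hy; simpa using hy
        | succ m ihm =>
          intro y hy h0
          have h1 : g (g y) = 0 := ihm (g y) (hgs y hy) (by
            rw [← Module.End.mul_apply, ← pow_succ]; exact h0)
          have hz : f (g y) = c • g y := by rw [hfg (g y), h1, add_zero]
          have hN := pow_apply_of_sub_smul_eq (hfg y) hz
          have hlim : Tendsto (fun N : ℕ => ‖(f ^ (N + 1)) y‖ / ((N + 1 : ℕ) : ℝ) +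
              ‖c‖ * ‖y‖ / ((N + 1 : ℕ) : ℝ)) atTop (𝓝 0) := by
            have a1 : Tendsto (fun N : ℕ => ‖(f ^ (N + 1)) y‖ / ((N + 1 : ℕ) : ℝ)) atTop (𝓝 0) :=
              (tendsto_add_atTop_iff_nat (f := fun N : ℕ => ‖(f ^ N) y‖ / (N : ℝ)) 1).2 hy
            have a2 : Tendsto (fun N : ℕ => ‖c‖ * ‖y‖ / ((N + 1 : ℕ) : ℝ)) atTop (𝓝 0) :=
              (tendsto_add_atTop_iff_nat (f := fun N : ℕ => ‖c‖ * ‖y‖ / (N : ℝ)) 1).2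
                (tendsto_const_div_atTop_nhds_zero_nat _)
            simpa using a1.add a2
          have hle : ‖g y‖ ≤ 0 := by
            refine ge_of_tendsto' hlim fun N => ?_
            have hcN : 1 ≤ ‖c‖ ^ N := one_le_pow₀ hc
            have e : ((N + 1 : ℕ) * c ^ N) • g y = (f ^ (N + 1)) y - c ^ (N + 1) • y := by
              rw [hN]; abel
            have e2 : ((N + 1 : ℕ) : ℝ) * ‖c‖ ^ N * ‖g y‖ ≤
                ‖(f ^ (N + 1)) y‖ + ‖c‖ ^ (N + 1) * ‖y‖ := by
              have := norm_sub_le ((f ^ (N + 1)) y) (c ^ (N + 1) • y)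
              rw [← e, norm_smul, norm_smul, norm_mul, norm_pow, norm_pow,
                RCLike.norm_natCast] at this
              exact this
            have hN0 : (0 : ℝ) < ((N + 1 : ℕ) : ℝ) := by positivity
            rw [← add_div, le_div_iff₀ hN0]
            have e3 : ‖c‖ ^ N * (((N + 1 : ℕ) : ℝ) * ‖g y‖ - ‖c‖ * ‖y‖) ≤ ‖(f ^ (N + 1)) y‖ := by
              rw [pow_succ ‖c‖] at e2; nlinarith
            by_cases hs : 0 ≤ ((N + 1 : ℕ) : ℝ) * ‖g y‖ - ‖c‖ * ‖y‖
            · nlinarith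
            · nlinarith [norm_nonneg ((f ^ (N + 1)) y)]
          exact norm_le_zero_iff.1 hle
      have hg0 : g x = 0 := key m x hx h
      have hfx : f x = c • x + 0 := by rw [hfg, hg0]
      have hN := pow_apply_of_sub_smul_eq hfx (by simp)
      simp only [smul_zero, add_zero] at hN
      by_cases hx0 : x = 0
      · rw [hx0]; exact zero_mem _
      -- Bernoulli's inequality: for ‖c‖ > 1 the powers of ‖c‖ grow at least linearly.
      have hc1 : ‖c‖ ≤ 1 := by
        by_contra hcc
        push Not at hcc
        have hxx : 0 < ‖x‖ := norm_pos_iff.2 hx0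
        have h1 : ∀ N : ℕ, (‖c‖ - 1) * ‖x‖ ≤ ‖(f ^ (N + 1)) x‖ / ((N + 1 : ℕ) : ℝ) := by
          intro N
          rw [hN, norm_smul, norm_pow, le_div_iff₀ (by positivity)]
          have := one_add_mul_le_pow (show -2 ≤ ‖c‖ - 1 by linarith) (N + 1)
          rw [add_sub_cancel] at this
          nlinarith
        have := ge_of_tendsto'
          ((tendsto_add_atTop_iff_nat (f := fun N : ℕ => ‖(f ^ N) x‖ / (N : ℝ)) 1).2 hx) h1
        nlinarith
      refine ⟨‖x‖, fun N => ?_⟩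
      cases N with
      | zero => simp
      | succ N =>
        rw [hN, norm_smul, norm_pow]
        exact mul_le_of_le_one_left (norm_nonneg _) (pow_le_one₀ (norm_nonneg _) hc1)

/-- An invariant subspace is the sum of its intersections with the generalised eigenspaces, which
span everything over ℂ. It remains to treat one eigenvalue at a time. -/
theorem sublinearOrbits_le_boundedOrbits {V : Type*} [NormedAddCommGroup V] [NormedSpace ℂ V]
    [FiniteDimensional ℂ V] (f : Module.End ℂ V) : sublinearOrbits f ≤ boundedOrbits f := by
  have h := Submodule.inf_iSup_genEigenspace (p := sublinearOrbits f) (f := f)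
    (fun x hx => map_mem_sublinearOrbits hx) ⊤
  have htop := Module.End.iSup_maxGenEigenspace_eq_top f
  simp only [Module.End.maxGenEigenspace] at htop
  rw [htop, inf_top_eq] at h
  rw [h]
  refine iSup_le fun μ x hx => ?_
  obtain ⟨m, hm⟩ := Module.End.mem_maxGenEigenspace f μ x |>.1 hx.2
  exact mem_boundedOrbits_of_pow_sub_smul μ m x hx.1 (by
    simpa [Algebra.algebraMap_eq_smul_one] using hm)

/-- On the bounded orbits the eigenvalue 1 has no Jordan block of size two, so the kernel and the
range of f - 1 are disjoint. By rank-nullity they span. This is the mean ergodic decomposition. -/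
theorem exists_fixed_add_coboundary [FiniteDimensional 𝕜 V] {f : Module.End 𝕜 V} {x : V}
    (hx : x ∈ boundedOrbits f) :
    ∃ y z, f y = y ∧ z ∈ boundedOrbits f ∧ x = y + (f z - z) := by
  let g : Module.End 𝕜 (boundedOrbits f) :=
    f.restrict (fun x hx => map_mem_boundedOrbits hx) - 1
  have hdisj : Disjoint (LinearMap.ker g) (LinearMap.range g) := by
    rw [Submodule.disjoint_def]
    rintro y hy ⟨z, rfl⟩
    have h1 : f z.1 = (1 : 𝕜) • z.1 + (g z).1 := by simp [g]
    have h2 : f (g z).1 = (1 : 𝕜) • (g z).1 := by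
      have := congrArg Subtype.val (LinearMap.mem_ker.1 hy)
      simp only [g, LinearMap.sub_apply, Module.End.one_apply, Submodule.coe_sub,
        LinearMap.coe_restrict_apply, ZeroMemClass.coe_zero] at this
      rw [one_smul]
      simp only [g, LinearMap.sub_apply, Module.End.one_apply, Submodule.coe_sub,
        LinearMap.coe_restrict_apply]
      exact sub_eq_zero.1 this
    obtain ⟨K, hK⟩ := z.2
    -- If g z is fixed by f, the orbit of z moves by g z at every step, whereas it is bounded.
    have hb : ∀ N : ℕ, ((N + 1 : ℕ) : ℝ) * ‖(g z).1‖ ≤ K + ‖z.1‖ := by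
      intro N
      have e := pow_apply_of_sub_smul_eq h1 h2 N
      simp only [one_pow, one_smul, mul_one] at e
      have e' : ((N + 1 : ℕ) : 𝕜) • (g z).1 = (f ^ (N + 1)) z.1 - z.1 := by rw [e]; abel
      have := norm_sub_le ((f ^ (N + 1)) z.1) z.1
      rw [← e', norm_smul, RCLike.norm_natCast] at this
      exact this.trans (add_le_add (hK _) le_rfl)
    by_contra hne
    have hpos : 0 < ‖(g z).1‖ := norm_pos_iff.2 fun h => hne (Subtype.ext h)
    obtain ⟨N, hN⟩ := exists_nat_gt ((K + ‖z.1‖) / ‖(g z).1‖)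
    rw [div_lt_iff₀ hpos] at hN
    have := hb N
    push_cast at this
    nlinarith
  have htop : LinearMap.ker g ⊔ LinearMap.range g = ⊤ := by
    refine Submodule.eq_top_of_disjoint _ _ ?_ hdisj
    rw [add_comm]
    exact (LinearMap.finrank_range_add_finrank_ker g).ge
  have hx' : (⟨x, hx⟩ : boundedOrbits f) ∈ LinearMap.ker g ⊔ LinearMap.range g := by
    rw [htop]; trivial
  obtain ⟨y, hy, _, ⟨z, rfl⟩, hyz⟩ := Submodule.mem_sup.1 hx'
  refine ⟨y.1, z.1, ?_, z.2, ?_⟩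
  · have := congrArg Subtype.val (LinearMap.mem_ker.1 hy)
    simp only [g, LinearMap.sub_apply, Module.End.one_apply, Submodule.coe_sub,
      LinearMap.coe_restrict_apply, ZeroMemClass.coe_zero] at this
    exact sub_eq_zero.1 this
  · have := congrArg Subtype.val hyz
    simp only [g, LinearMap.sub_apply, Module.End.one_apply, Submodule.coe_sub,
      LinearMap.coe_restrict_apply, Submodule.coe_add] at this
    exact this.symm

/-- Banach–Steinhaus on the finite-dimensional, hence complete, space of bounded orbits makes the
bound uniform in the vector. -/
theorem exists_norm_pow_le_mul_norm [FiniteDimensional 𝕜 V] (f : Module.End 𝕜 V) :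
    ∃ K : ℝ, 0 ≤ K ∧ ∀ N : ℕ, ∀ x ∈ boundedOrbits f, ‖(f ^ N) x‖ ≤ K * ‖x‖ := by
  have : CompleteSpace (boundedOrbits f) := FiniteDimensional.complete 𝕜 _
  obtain ⟨K, hK⟩ := banach_steinhaus
    (g := fun N : ℕ => LinearMap.toContinuousLinearMap ((f ^ N) ∘ₗ (boundedOrbits f).subtype))
    (fun x => x.2)
  refine ⟨K, (norm_nonneg _).trans (hK 0), fun N x hx => ?_⟩
  exact (ContinuousLinearMap.le_opNorm
    (LinearMap.toContinuousLinearMap ((f ^ N) ∘ₗ (boundedOrbits f).subtype)) ⟨x, hx⟩).trans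
    (mul_le_mul_of_nonneg_right (hK N) (norm_nonneg _))

end BoundedOrbits

/-! ### Periodic functions: from one period to bounded intervals -/

section PeriodicIntegrals

open scoped ENNReal

theorem lintegral_Ioc_eq_of_periodic {T : ℝ} (hT : 0 < T) {g : ℝ → ℝ≥0∞} (hg : Function.Periodic g T)
    (c d : ℝ) : ∫⁻ t in Ioc c (c + T), g t = ∫⁻ t in Ioc d (d + T), g t := by
  refine (isAddFundamentalDomain_Ioc hT c).setLIntegral_eq (isAddFundamentalDomain_Ioc hT d) g ?_
  rintro ⟨_, k, rfl⟩ x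
  have := hg.int_mul k x
  rw [add_comm] at this
  simpa [AddSubmonoid.vadd_def, AddSubgroup.vadd_def] using this

theorem Icc_subset_iUnion_Ioc {T : ℝ} (hT : 0 < T) (R : ℝ) :
    ∃ s : Finset ℤ, Icc (-R) R ⊆ ⋃ k : s, Ioc ((k : ℤ) * T) ((k : ℤ) * T + T) := by
  -- The windows are open on the left, so t lies in the one numbered ⌈t / T⌉ - 1.
  refine ⟨Finset.Icc (⌈-R / T⌉ - 1) (⌈R / T⌉ - 1), fun t ht => ?_⟩
  simp only [mem_iUnion]
  refine ⟨⟨⌈t / T⌉ - 1, Finset.mem_Icc.2 ⟨?_, ?_⟩⟩, ?_⟩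
  · have : -R / T ≤ t / T := by gcongr; exact ht.1
    have := Int.ceil_mono this
    omega
  · have : t / T ≤ R / T := by gcongr; exact ht.2
    have := Int.ceil_mono this
    omega
  · push_cast
    have h1 := Int.le_ceil (t / T)
    have h2 := Int.ceil_lt_add_one (t / T)
    rw [div_le_iff₀ hT] at h1
    have h3 : ((⌈t / T⌉ : ℝ) - 1) < t / T := by linarith
    rw [lt_div_iff₀ hT] at h3
    exact ⟨h3, by linarith⟩

/-- The constant, the square root of the number of windows covering [-R, R], is chosen before F.
Thus L² convergence over one period carries over to every bounded interval. -/
theorem exists_eLpNorm_two_Icc_le {T : ℝ} (hT : 0 < T) (R : ℝ) : ∃ c : ℝ≥0∞, c ≠ ∞ ∧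
    ∀ {E : Type} [NormedAddCommGroup E] (F : ℝ → E), Function.Periodic F T →
      eLpNorm F 2 (volume.restrict (Icc (-R) R)) ≤
        c * eLpNorm F 2 (volume.restrict (Ioc 0 T)) := by
  obtain ⟨s, hs⟩ := Icc_subset_iUnion_Ioc hT R
  refine ⟨(s.card : ℝ≥0∞) ^ (1 / 2 : ℝ), by finiteness, fun {E} _ F hF => ?_⟩
  have hg : Function.Periodic (fun t => ‖F t‖ₑ ^ (2 : ℝ)) T := fun t => by simp only [hF t]
  rw [eLpNorm_eq_lintegral_rpow_enorm_toReal two_ne_zero ENNReal.ofNat_ne_top,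
    eLpNorm_eq_lintegral_rpow_enorm_toReal two_ne_zero ENNReal.ofNat_ne_top]
  simp only [ENNReal.toReal_ofNat]
  rw [← ENNReal.mul_rpow_of_nonneg _ _ (by norm_num)]
  gcongr
  calc ∫⁻ t in Icc (-R) R, ‖F t‖ₑ ^ (2 : ℝ)
      ≤ ∫⁻ t in ⋃ k : s, Ioc ((k : ℤ) * T) ((k : ℤ) * T + T), ‖F t‖ₑ ^ (2 : ℝ) :=
        lintegral_mono_set hs
    _ ≤ ∑' k : s, ∫⁻ t in Ioc ((k : ℤ) * T) ((k : ℤ) * T + T), ‖F t‖ₑ ^ (2 : ℝ) :=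
        lintegral_iUnion_le _ _
    _ = ∑' k : s, ∫⁻ t in Ioc (0 : ℝ) T, ‖F t‖ₑ ^ (2 : ℝ) := by
        refine tsum_congr fun k => ?_
        have := lintegral_Ioc_eq_of_periodic hT hg ((k : ℤ) * T) 0
        rwa [zero_add] at this
    _ = s.card * ∫⁻ t in Ioc (0 : ℝ) T, ‖F t‖ₑ ^ (2 : ℝ) := by
        rw [tsum_fintype]; simp

theorem aestronglyMeasurable_of_periodic {T : ℝ} (hT : 0 < T) {E : Type*} [TopologicalSpace E]
    [TopologicalSpace.PseudoMetrizableSpace E] {F : ℝ → E} (hF : Function.Periodic F T)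
    (h : AEStronglyMeasurable F (volume.restrict (Ioc 0 T))) : AEStronglyMeasurable F := by
  have h1 : AEStronglyMeasurable F
      (volume.restrict (⋃ k : ℤ, Ioc ((k : ℝ) * T) ((k : ℝ) * T + T))) := by
    refine aestronglyMeasurable_iUnion_iff.2 fun k => ?_
    have h0 : AEStronglyMeasurable F (volume.restrict (Ioc 0 (0 + T))) := by rwa [zero_add]
    refine ((isAddFundamentalDomain_Ioc hT _).aestronglyMeasurable_on_iff
      (isAddFundamentalDomain_Ioc hT 0) ?_).2 h0
    rintro ⟨_, k, rfl⟩ x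
    have := hF.int_mul k x
    rw [add_comm] at this
    simpa [AddSubmonoid.vadd_def, AddSubgroup.vadd_def] using this
  have h2 : (⋃ k : ℤ, Ioc ((k : ℝ) * T) ((k : ℝ) * T + T)) = univ := by
    refine eq_univ_of_forall fun t => ?_
    obtain ⟨s, hs⟩ := Icc_subset_iUnion_Ioc hT |t|
    obtain ⟨k, hk⟩ := mem_iUnion.1 (hs (abs_le.1 le_rfl))
    exact mem_iUnion.2 ⟨k, hk⟩
  rwa [h2, Measure.restrict_univ] at h1

theorem memLp_two_Icc_of_periodic {T : ℝ} (hT : 0 < T) {E : Type} [NormedAddCommGroup E]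
    {F : ℝ → E} (hF : Function.Periodic F T) (h : MemLp F 2 (volume.restrict (Ioc 0 T))) (R : ℝ) :
    MemLp F 2 (volume.restrict (Icc (-R) R)) := by
  refine ⟨(aestronglyMeasurable_of_periodic hT hF h.1).restrict, ?_⟩
  obtain ⟨c, hc, hle⟩ := exists_eLpNorm_two_Icc_le hT R
  exact (hle F hF).trans_lt (ENNReal.mul_lt_top hc.lt_top h.2)

end PeriodicIntegrals

/-! ### The flow and the monodromy of conjugation -/

section Flow

variable {n : ℕ} (A : Mat n)

theorem flow_add (s t : ℝ) : flow A (s + t) = flow A s * flow A t := by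
  rw [flow, flow, flow, add_smul]
  exact Matrix.exp_add_of_commute _ _ (((Commute.refl A).smul_left s).smul_right t)

@[simp]
theorem flow_zero : flow A 0 = 1 := by
  rw [flow, zero_smul, NormedSpace.exp_zero]

theorem flow_mul_flow_neg (t : ℝ) : flow A t * flow A (-t) = 1 := by
  rw [← flow_add, add_neg_cancel, flow_zero]

section

attribute [local instance] Matrix.linftyOpNormedRing Matrix.linftyOpNormedAlgebra

theorem hasDerivAt_flow_matrix (t : ℝ) :
    HasDerivAt (fun s => NormedSpace.exp (s • A)) (NormedSpace.exp (t • A) * A) t :=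
  hasDerivAt_exp_smul_const A t

theorem hasDerivAt_flow (t : ℝ) (i j : Fin n) :
    HasDerivAt (fun s => flow A s i j) ((flow A t * A) i j) t := by
  have h := hasDerivAt_pi.1 (hasDerivAt_flow_matrix A t) i
  exact hasDerivAt_pi.1 h j

end

theorem continuous_flow_apply (i j : Fin n) : Continuous fun t => flow A t i j :=
  continuous_iff_continuousAt.2 fun t => (hasDerivAt_flow A t i j).continuousAt

/-- Conjugation by the flow over the time `T`, on arrays of entries. -/
noncomputable def monodromy (T : ℝ) : Module.End ℝ (Fin n → Fin n → ℝ) where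
  toFun X := Matrix.of.symm (flow A (-T) * Matrix.of X * flow A T)
  map_add' X Y := by
    change Matrix.of.symm (flow A (-T) * (Matrix.of X + Matrix.of Y) * flow A T) = _
    rw [mul_add, add_mul]; rfl
  map_smul' c X := by
    change Matrix.of.symm (flow A (-T) * (c • Matrix.of X) * flow A T) = _
    rw [Matrix.mul_smul, Matrix.smul_mul]; rfl

/-- The entries of `conj A P t`. -/
noncomputable def conjEntries (P : ℝ → Mat n) (t : ℝ) : Fin n → Fin n → ℝ :=
  fun i j => conj A P t i j

/-- The group law splits e^{∓A(t+T)}, and P does not see the shift. This reduces the behaviour of M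
on [0, ∞) to one period and the powers of a linear map. -/
theorem conjEntries_add_period {T : ℝ} {P : ℝ → Mat n} (hP : Function.Periodic P T) (t : ℝ) :
    conjEntries A P (t + T) = monodromy A T (conjEntries A P t) := by
  have : conj A P (t + T) = flow A (-T) * conj A P t * flow A T := by
    rw [conj, hP t, conj, neg_add, add_comm (-t), flow_add, flow_add]
    simp only [mul_assoc]
  exact congrArg Matrix.of.symm this

theorem conjEntries_add_nat_mul {T : ℝ} {P : ℝ → Mat n} (hP : Function.Periodic P T) (N : ℕ)
    (t : ℝ) : conjEntries A P (t + N * T) = (monodromy A T ^ N) (conjEntries A P t) := by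
  induction N with
  | zero => simp
  | succ N ih =>
    rw [pow_succ', Module.End.mul_apply, ← ih, ← conjEntries_add_period A hP]
    congr 1; push_cast; ring

theorem conj_apply (P : ℝ → Mat n) (t : ℝ) (i j : Fin n) :
    conj A P t i j = ∑ q, ∑ p, flow A (-t) i p * P t p q * flow A t q j := by
  simp only [conj, Matrix.mul_apply, Finset.sum_mul]

theorem memLp_conj {T : ℝ} (hT : 0 < T) {P : ℝ → Mat n} (hper : Function.Periodic P T)
    (hP : ∀ i j, MemLp (fun t => P t i j) 2 (volume.restrict (Ioc 0 T))) (R : ℝ) (i j : Fin n) :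
    MemLp (fun t => conj A P t i j) 2 (volume.restrict (Icc (-R) R)) := by
  simp only [conj_apply]
  refine memLp_finsetSum _ fun q _ => memLp_finsetSum _ fun p _ => ?_
  have h1 : MemLp (fun t => P t p q) 2 (volume.restrict (Icc (-R) R)) :=
    memLp_two_Icc_of_periodic hT (fun t => by simp only [hper t]) (hP p q) R
  have h2 : ∀ g : ℝ → ℝ, Continuous g → MemLp g ⊤ (volume.restrict (Icc (-R) R)) := by
    intro g hg
    obtain ⟨K, hK⟩ := isCompact_Icc.exists_bound_of_continuousOn (s := Icc (-R) R) hg.continuousOn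
    exact memLp_top_of_bound hg.aestronglyMeasurable K
      ((ae_restrict_iff' measurableSet_Icc).2 (ae_of_all _ hK))
  have h3 := MemLp.mul' (r := 2) (p := ⊤) (q := 2) h1
    (h2 _ ((continuous_flow_apply A i p).comp continuous_neg))
  exact MemLp.mul' (r := 2) (p := 2) (q := ⊤) (h2 _ (continuous_flow_apply A q j)) h3

end Flow

/-! ### Passage from real to complex endomorphisms -/

section Complexification

variable {ι κ : Type*}

/-- The complexification of an endomorphism of a space of real arrays. -/
def complexify (f : Module.End ℝ (ι → κ → ℝ)) : Module.End ℂ (ι → κ → ℂ) where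
  toFun Z i j := (f (fun i j => (Z i j).re) i j : ℂ) + (f (fun i j => (Z i j).im) i j : ℂ) * Complex.I
  map_add' Y Z := by
    have h1 : (fun i j => ((Y + Z) i j).re) = (fun i j => (Y i j).re) + fun i j => (Z i j).re := by
      ext; simp
    have h2 : (fun i j => ((Y + Z) i j).im) = (fun i j => (Y i j).im) + fun i j => (Z i j).im := by
      ext; simp
    ext i j
    rw [h1, h2, map_add, map_add]
    simp only [Pi.add_apply, Complex.ofReal_add]
    ring
  map_smul' c Z := by
    have h1 : (fun i j => ((c • Z) i j).re) =
        c.re • (fun i j => (Z i j).re) - c.im • fun i j => (Z i j).im := by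
      ext; simp
    have h2 : (fun i j => ((c • Z) i j).im) =
        c.re • (fun i j => (Z i j).im) + c.im • fun i j => (Z i j).re := by
      ext; simp
    ext i j
    rw [h1, h2, map_add, map_sub]
    simp only [map_smul, Pi.add_apply, Pi.sub_apply, Pi.smul_apply, smul_eq_mul,
      Complex.ofReal_add, Complex.ofReal_sub, Complex.ofReal_mul, RingHom.id_apply]
    apply Complex.ext <;> simp

theorem complexify_pow_ofReal (f : Module.End ℝ (ι → κ → ℝ)) (N : ℕ) (X : ι → κ → ℝ) :
    (complexify f ^ N) (fun i j => (X i j : ℂ)) = fun i j => ((f ^ N) X i j : ℂ) := by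
  induction N with
  | zero => simp
  | succ N ih =>
    rw [pow_succ', pow_succ', Module.End.mul_apply, Module.End.mul_apply, ih]
    ext i j
    have h0 : (fun (_ : ι) (_ : κ) => (0 : ℝ)) = 0 := rfl
    simp [complexify, h0]

/-- The Jordan argument needs an algebraically closed field. Complexification commutes with powers
on real arrays and the sup norm is unchanged, so both growth conditions transfer. -/
theorem sublinearOrbits_le_boundedOrbits_real [Fintype ι] [Fintype κ]
    (f : Module.End ℝ (ι → κ → ℝ)) : sublinearOrbits f ≤ boundedOrbits f := by
  intro x hx
  have hn : ∀ X : ι → κ → ℝ, ‖fun i j => (X i j : ℂ)‖ = ‖X‖ := by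
    intro X
    simp only [Pi.norm_def, Pi.nnnorm_def, Complex.nnnorm_real]
  have h1 : (fun i j => (x i j : ℂ)) ∈ sublinearOrbits (complexify f) := by
    have hx' : Tendsto (fun N : ℕ => ‖(f ^ N) x‖ / N) atTop (𝓝 0) := hx
    change Tendsto _ _ _
    simpa only [complexify_pow_ofReal, hn] using hx'
  obtain ⟨K, hK⟩ := sublinearOrbits_le_boundedOrbits _ h1
  exact ⟨K, fun N => by simpa only [complexify_pow_ofReal, hn] using hK N⟩

end Complexification

/-! ### Time averages and bounded primitives -/

section Averages

variable {n : ℕ} {A : Mat n} {T : ℝ} {P : ℝ → Mat n}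

theorem memLp_conj_uIoc (hT : 0 < T) (hper : Function.Periodic P T)
    (hP : ∀ i j, MemLp (fun t => P t i j) 2 (volume.restrict (Ioc 0 T))) (a b : ℝ) (i j : Fin n) :
    MemLp (fun t => conj A P t i j) 2 (volume.restrict (uIoc a b)) := by
  refine (memLp_conj A hT hper hP (max |a| |b|) i j).mono_measure (Measure.restrict_mono ?_ le_rfl)
  intro t ht
  rw [mem_uIoc] at ht
  have h1 := abs_le.1 (le_max_left |a| |b|)
  have h2 := abs_le.1 (le_max_right |a| |b|)
  constructor <;> rcases ht with ht | ht <;> linarith [ht.1, ht.2, h1.1, h1.2, h2.1, h2.2]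

theorem intervalIntegrable_conj (hT : 0 < T) (hper : Function.Periodic P T)
    (hP : ∀ i j, MemLp (fun t => P t i j) 2 (volume.restrict (Ioc 0 T))) (a b : ℝ) (i j : Fin n) :
    IntervalIntegrable (fun t => conj A P t i j) volume a b := by
  have : IsFiniteMeasure (volume.restrict (uIoc a b)) := by
    rw [uIoc]; infer_instance
  exact intervalIntegrable_iff.2 ((memLp_conj_uIoc hT hper hP a b i j).integrable (by norm_num))

theorem intervalIntegrable_conj_sq (hT : 0 < T) (hper : Function.Periodic P T)
    (hP : ∀ i j, MemLp (fun t => P t i j) 2 (volume.restrict (Ioc 0 T))) (a b : ℝ) (i j : Fin n) :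
    IntervalIntegrable (fun t => conj A P t i j ^ 2) volume a b :=
  intervalIntegrable_iff.2 (memLp_conj_uIoc hT hper hP a b i j).integrable_sq

theorem intervalIntegrable_conjEntries (hT : 0 < T) (hper : Function.Periodic P T)
    (hP : ∀ i j, MemLp (fun t => P t i j) 2 (volume.restrict (Ioc 0 T))) (a b : ℝ) :
    IntervalIntegrable (conjEntries A P) volume a b :=
  intervalIntegrable_iff.2 (integrable_pi_iff.2 fun i => integrable_pi_iff.2 fun j =>
    intervalIntegrable_iff.1 (intervalIntegrable_conj hT hper hP a b i j))

theorem intervalIntegral_conjEntries_apply (hT : 0 < T) (hper : Function.Periodic P T)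
    (hP : ∀ i j, MemLp (fun t => P t i j) 2 (volume.restrict (Ioc 0 T))) (a b : ℝ) (i j : Fin n) :
    (∫ t in a..b, conjEntries A P t) i j = ∫ t in a..b, conj A P t i j :=
  (ContinuousLinearMap.intervalIntegral_comp_comm
    ((ContinuousLinearMap.proj (R := ℝ) (φ := fun _ : Fin n => ℝ) j) ∘L
      (ContinuousLinearMap.proj (R := ℝ) (φ := fun _ : Fin n => Fin n → ℝ) i))
    (intervalIntegrable_conjEntries hT hper hP a b)).symm

theorem integral_conjEntries_shift (hT : 0 < T) (hper : Function.Periodic P T)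
    (hP : ∀ i j, MemLp (fun t => P t i j) 2 (volume.restrict (Ioc 0 T))) (N : ℕ) (s : ℝ) :
    ∫ t in (N * T)..(N * T + s), conjEntries A P t =
      (monodromy A T ^ N) (∫ t in (0 : ℝ)..s, conjEntries A P t) := by
  have h1 := ContinuousLinearMap.intervalIntegral_comp_comm
    (LinearMap.toContinuousLinearMap (monodromy A T ^ N))
    (intervalIntegrable_conjEntries (A := A) hT hper hP 0 s)
  simp only [LinearMap.coe_toContinuousLinearMap'] at h1
  rw [← h1]
  simp only [← conjEntries_add_nat_mul A hper]
  rw [intervalIntegral.integral_comp_add_right, zero_add, add_comm s]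

theorem exists_norm_integral_window_le (hT : 0 < T) (hper : Function.Periodic P T)
    (hP : ∀ i j, MemLp (fun t => P t i j) 2 (volume.restrict (Ioc 0 T)))
    (hL : L2UniformlyBounded T (conj A P)) :
    ∃ K : ℝ, 0 ≤ K ∧ ∀ s u : ℝ, 0 ≤ s → 0 ≤ u → u ≤ T →
      ‖∫ t in s..(s + u), conjEntries A P t‖ ≤ K := by
  obtain ⟨K, hK⟩ := hL
  -- From |m| ≤ 1 + m², integrated over a full window.
  refine ⟨T + |K|, by positivity, fun s u hs hu huT => ?_⟩
  refine (pi_norm_le_iff_of_nonneg (by positivity)).2 fun i =>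
    (pi_norm_le_iff_of_nonneg (by positivity)).2 fun j => ?_
  rw [intervalIntegral_conjEntries_apply hT hper hP, Real.norm_eq_abs]
  calc |∫ t in s..(s + u), conj A P t i j|
      ≤ ∫ t in s..(s + u), |conj A P t i j| :=
        intervalIntegral.abs_integral_le_integral_abs (by linarith)
    _ ≤ ∫ t in s..(s + u), (1 + conj A P t i j ^ 2) := by
        refine intervalIntegral.integral_mono_on (by linarith)
          (intervalIntegrable_conj hT hper hP _ _ i j).abs
          (intervalIntegrable_const.add (intervalIntegrable_conj_sq hT hper hP _ _ i j))
          fun t _ => ?_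
        rcases abs_cases (conj A P t i j) with h | h <;> nlinarith [sq_nonneg (conj A P t i j - 1), sq_nonneg (conj A P t i j + 1)]
    _ ≤ ∫ t in s..(s + T), (1 + conj A P t i j ^ 2) := by
        refine intervalIntegral.integral_mono_interval le_rfl (by linarith) (by linarith)
          (ae_of_all _ fun t => ?_)
          (intervalIntegrable_const.add (intervalIntegrable_conj_sq hT hper hP _ _ i j))
        simp only [Pi.zero_apply]; positivity
    _ = T + ∫ t in s..(s + T), conj A P t i j ^ 2 := by
        rw [intervalIntegral.integral_add intervalIntegrable_const
          (intervalIntegrable_conj_sq hT hper hP _ _ i j)]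
        simp
    _ ≤ T + |K| := by gcongr; exact (hK s hs i j).trans (le_abs_self K)

theorem exists_nat_mul_add (hT : 0 < T) {t : ℝ} (ht : 0 ≤ t) :
    ∃ (N : ℕ) (u : ℝ), 0 ≤ u ∧ u < T ∧ t = N * T + u := by
  refine ⟨⌊t / T⌋₊, t - ⌊t / T⌋₊ * T, ?_, ?_, by ring⟩
  · have := Nat.floor_le (div_nonneg ht hT.le)
    rw [le_div_iff₀ hT] at this
    linarith
  · have := Nat.lt_floor_add_one (t / T)
    rw [div_lt_iff₀ hT] at this
    linarith

/-- Decompose the integral over the first period as y + (Lz - z) with y fixed by the monodromy L.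
The N-th window contributes y + L^(N+1) z - L^N z, so the sum telescopes to N y plus a bounded term.
-/
theorem exists_mean_bounded_primitive (hT : 0 < T) (hper : Function.Periodic P T)
    (hP : ∀ i j, MemLp (fun t => P t i j) 2 (volume.restrict (Ioc 0 T)))
    (hL : L2UniformlyBounded T (conj A P)) :
    ∃ (B : Mat n) (K : ℝ), ∀ t : ℝ, 0 ≤ t → ∀ i j,
      |(∫ τ in (0 : ℝ)..t, conj A P τ i j) - t * B i j| ≤ K := by
  obtain ⟨K, hK0, hK⟩ := exists_norm_integral_window_le hT hper hP hL
  set X := ∫ t in (0 : ℝ)..T, conjEntries A P t with hX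
  have hXb : X ∈ boundedOrbits (monodromy A T) := by
    refine ⟨K, fun N => ?_⟩
    rw [hX, ← integral_conjEntries_shift hT hper hP]
    exact hK _ _ (by positivity) hT.le le_rfl
  obtain ⟨y, z, hy, ⟨Kz, hKz⟩, hXyz⟩ := exists_fixed_add_coboundary hXb
  have hyN : ∀ N : ℕ, (monodromy A T ^ N) y = y := by
    intro N
    induction N with
    | zero => simp
    | succ N ih => rw [pow_succ, Module.End.mul_apply, hy, ih]
  have hint := intervalIntegrable_conjEntries (A := A) hT hper hP
  have hN : ∀ N : ℕ, ∫ t in (0 : ℝ)..(N * T), conjEntries A P t =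
      (N : ℝ) • y + (monodromy A T ^ N) z - z := by
    intro N
    induction N with
    | zero => simp
    | succ N ih =>
      have e : ((N + 1 : ℕ) : ℝ) * T = N * T + T := by push_cast; ring
      rw [e, ← intervalIntegral.integral_add_adjacent_intervals (hint 0 (N * T)) (hint _ _), ih,
        integral_conjEntries_shift hT hper hP, ← hX, hXyz, map_add, map_sub, hyN,
        ← Module.End.mul_apply, ← pow_succ]
      push_cast
      module
  -- B is y per unit of time. In the bound, Kz + ‖z‖ comes from the telescoped part, K from M over
  -- the last incomplete window, and the final term from B over it.
  refine ⟨Matrix.of (T⁻¹ • y), Kz + ‖z‖ + K + T * (T⁻¹ * ‖y‖), fun t ht i j => ?_⟩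
  obtain ⟨N, u, hu0, huT, rfl⟩ := exists_nat_mul_add hT ht
  have e : (∫ τ in (0 : ℝ)..(N * T + u), conj A P τ i j) - (N * T + u) * (Matrix.of (T⁻¹ • y)) i j =
      ((monodromy A T ^ N) z - z + (∫ t in (N * T)..(N * T + u), conjEntries A P t) -
        u • T⁻¹ • y) i j := by
    rw [← intervalIntegral_conjEntries_apply hT hper hP,
      ← intervalIntegral.integral_add_adjacent_intervals (hint 0 (N * T)) (hint _ _), hN]
    simp only [Pi.add_apply, Pi.sub_apply, Pi.smul_apply, smul_eq_mul, Matrix.of_apply]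
    field_simp
    ring
  rw [e, ← Real.norm_eq_abs]
  refine ((norm_le_pi_norm _ j).trans (norm_le_pi_norm _ i)).trans ?_
  refine (norm_sub_le _ _).trans (add_le_add ((norm_add_le _ _).trans
    (add_le_add ((norm_sub_le _ _).trans (add_le_add (hKz N) le_rfl))
      (hK _ _ (by positivity) hu0 huT.le))) ?_)
  rw [norm_smul, norm_smul, Real.norm_of_nonneg hu0, Real.norm_of_nonneg (by positivity)]
  gcongr

theorem tendsto_timeAverage {M : ℝ → Mat n} {B : Mat n} {K : ℝ}
    (h : ∀ t : ℝ, 0 ≤ t → ∀ i j, |(∫ τ in (0 : ℝ)..t, M τ i j) - t * B i j| ≤ K) :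
    Tendsto (timeAverage M) atTop (𝓝 B) := by
  refine tendsto_pi_nhds.2 fun i => tendsto_pi_nhds.2 fun j => ?_
  rw [tendsto_iff_norm_sub_tendsto_zero]
  refine squeeze_zero' (Eventually.of_forall fun _ => norm_nonneg _) ?_
    (tendsto_const_nhds.div_atTop tendsto_id : Tendsto (fun t : ℝ => K / t) atTop (𝓝 0))
  filter_upwards [eventually_gt_atTop 0] with t ht
  rw [le_div_iff₀ ht]
  have := h t ht.le i j
  have e : timeAverage M t i j - B i j = ((∫ τ in (0 : ℝ)..t, M τ i j) - t * B i j) / t := by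
    simp only [timeAverage, Matrix.of_apply]
    field_simp
  rw [e, Real.norm_eq_abs, abs_div, abs_of_pos ht, div_mul_cancel₀ _ ht.ne']
  exact this

/-- The integrals up to NT + s and up to NT, divided by N, have the same limit. Their difference is
the N-th monodromy power of the integral over [0, s], whose orbit is therefore sublinear. -/
theorem integral_mem_boundedOrbits_of_tendsto (hT : 0 < T) (hper : Function.Periodic P T)
    (hP : ∀ i j, MemLp (fun t => P t i j) 2 (volume.restrict (Ioc 0 T))) {L : Mat n}
    (hL : Tendsto (timeAverage (conj A P)) atTop (𝓝 L)) {s : ℝ} (hs : 0 ≤ s) :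
    ∫ t in (0 : ℝ)..s, conjEntries A P t ∈ boundedOrbits (monodromy A T) := by
  refine sublinearOrbits_le_boundedOrbits_real _ ?_
  have key : Tendsto (fun N : ℕ => (N : ℝ)⁻¹ • (monodromy A T ^ N)
      (∫ t in (0 : ℝ)..s, conjEntries A P t)) atTop (𝓝 0) := by
    refine tendsto_pi_nhds.2 fun i => tendsto_pi_nhds.2 fun j => ?_
    have hLij := tendsto_pi_nhds.1 (tendsto_pi_nhds.1 hL i) j
    have hseq : ∀ u : ℝ, 0 ≤ u → Tendsto (fun N : ℕ => (N : ℝ)⁻¹ *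
        ∫ τ in (0 : ℝ)..(N * T + u), conj A P τ i j) atTop (𝓝 (T * L i j)) := by
      intro u hu
      have h1 : Tendsto (fun N : ℕ => (N : ℝ) * T + u) atTop atTop :=
        tendsto_atTop_add_const_right _ _ (tendsto_natCast_atTop_atTop.atTop_mul_const hT)
      have h2 : Tendsto (fun N : ℕ => T + u / (N : ℝ)) atTop (𝓝 T) := by
        simpa using (tendsto_const_nhds (x := T)).add (tendsto_const_div_atTop_nhds_zero_nat u)
      refine (h2.mul (hLij.comp h1)).congr' ?_
      filter_upwards [eventually_gt_atTop 0] with N hN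
      have hN' : (0 : ℝ) < N := by exact_mod_cast hN
      simp only [Function.comp, timeAverage, Matrix.of_apply]
      have : (N : ℝ) * T + u ≠ 0 := by positivity
      field_simp
    have h3 := (hseq s hs).sub (hseq 0 le_rfl)
    rw [sub_self] at h3
    refine h3.congr fun N => ?_
    have hint := intervalIntegrable_conj (A := A) hT hper hP
    rw [← integral_conjEntries_shift hT hper hP, ← mul_sub, add_zero,
      intervalIntegral.integral_interval_sub_left (hint _ _ i j) (hint _ _ i j)]
    simp only [Pi.smul_apply, smul_eq_mul, intervalIntegral_conjEntries_apply hT hper hP]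
  change Tendsto _ _ _
  have := key.norm
  simpa [norm_smul, div_eq_inv_mul] using this

/-- Lebesgue differentiation: almost every value is a limit of difference quotients of the
primitive. These lie in a finite-dimensional, hence closed, subspace. Right quotients keep both
endpoints nonnegative. -/
theorem ae_conjEntries_mem_boundedOrbits (hT : 0 < T) (hper : Function.Periodic P T)
    (hP : ∀ i j, MemLp (fun t => P t i j) 2 (volume.restrict (Ioc 0 T))) {L : Mat n}
    (hL : Tendsto (timeAverage (conj A P)) atTop (𝓝 L)) :
    ∀ᵐ s : ℝ, s ∈ Ico 0 T → conjEntries A P s ∈ boundedOrbits (monodromy A T) := by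
  filter_upwards [(intervalIntegrable_conjEntries (A := A) hT hper hP 0 T).ae_hasDerivAt_integral]
    with s h hs
  have hd := h (by rw [uIcc_of_le hT.le]; exact ⟨hs.1, hs.2.le⟩) 0 left_mem_uIcc
  have hcl : IsClosed (boundedOrbits (monodromy A T) : Set (Fin n → Fin n → ℝ)) :=
    Submodule.closed_of_finiteDimensional _
  refine hcl.mem_of_tendsto (hasDerivAt_iff_tendsto_slope_left_right.1 hd).2 ?_
  filter_upwards [self_mem_nhdsWithin] with y hy
  have hy0 : 0 ≤ y := hs.1.trans (le_of_lt hy)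
  rw [slope_def_module]
  exact Submodule.smul_mem _ _ (sub_mem (integral_mem_boundedOrbits_of_tendsto hT hper hP hL hy0)
    (integral_mem_boundedOrbits_of_tendsto hT hper hP hL hs.1))

theorem exists_ae_norm_conjEntries_le (hT : 0 < T) (hper : Function.Periodic P T)
    (hP : ∀ i j, MemLp (fun t => P t i j) 2 (volume.restrict (Ioc 0 T))) {L : Mat n}
    (hL : Tendsto (timeAverage (conj A P)) atTop (𝓝 L)) :
    ∃ K : ℝ, 0 ≤ K ∧ ∀ᵐ s : ℝ, s ∈ Ico 0 T → ∀ N : ℕ,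
      ‖conjEntries A P (s + N * T)‖ ≤ K * ‖conjEntries A P s‖ := by
  obtain ⟨K, hK0, hK⟩ := exists_norm_pow_le_mul_norm (monodromy A T)
  refine ⟨K, hK0, ?_⟩
  filter_upwards [ae_conjEntries_mem_boundedOrbits hT hper hP hL] with s hs hsT N
  rw [conjEntries_add_nat_mul A hper]
  exact hK N _ (hs hsT)

theorem l2UniformlyBounded_of_tendsto (hT : 0 < T) (hper : Function.Periodic P T)
    (hP : ∀ i j, MemLp (fun t => P t i j) 2 (volume.restrict (Ioc 0 T))) {L : Mat n}
    (hL : Tendsto (timeAverage (conj A P)) atTop (𝓝 L)) :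
    L2UniformlyBounded T (conj A P) := by
  obtain ⟨K, hK0, hK⟩ := exists_ae_norm_conjEntries_le hT hper hP hL
  have hsq := intervalIntegrable_conj_sq (A := A) hT hper hP
  -- Q dominates the squared entries at t + NT for all N at once, and is integrable over one period.
  set Q : ℝ → ℝ := fun t => K ^ 2 * ∑ p, ∑ q, conj A P t p q ^ 2 with hQ
  have hQint : IntervalIntegrable Q volume 0 T :=
    IntervalIntegrable.const_mul (intervalIntegrable_iff.2 (integrable_finsetSum _ fun p _ =>
      integrable_finsetSum _ fun q _ => intervalIntegrable_iff.1 (hsq 0 T p q))) _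
  have hwin : ∀ (N : ℕ) (i j : Fin n),
      ∫ t in (N * T)..(N * T + T), conj A P t i j ^ 2 ≤ ∫ t in (0 : ℝ)..T, Q t := by
    intro N i j
    have e : ∫ t in (N * T)..(N * T + T), conj A P t i j ^ 2 =
        ∫ t in (0 : ℝ)..T, conj A P (t + N * T) i j ^ 2 := by
      rw [intervalIntegral.integral_comp_add_right (fun t => conj A P t i j ^ 2), zero_add,
        add_comm T]
    rw [e]
    refine intervalIntegral.integral_mono_ae_restrict hT.le ?_ hQint ?_
    · have := (hsq (0 + N * T) (T + N * T) i j).comp_add_right (N * T)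
      simpa using this
    · rw [Filter.EventuallyLE, ae_restrict_iff' measurableSet_Icc]
      have hTne : ∀ᵐ s : ℝ, s ≠ T := by simp [ae_iff, measure_singleton]
      filter_upwards [hK, hTne] with s hs hsT hmem
      have h1 := hs ⟨hmem.1, lt_of_le_of_ne hmem.2 hsT⟩ N
      have h2 : |conj A P (s + N * T) i j| ≤ K * ‖conjEntries A P s‖ := by
        rw [← Real.norm_eq_abs]
        exact ((norm_le_pi_norm (conjEntries A P (s + N * T) i) j).trans
          (norm_le_pi_norm (conjEntries A P (s + N * T)) i)).trans h1
      have h3 : ‖conjEntries A P s‖ ≤ √(∑ p, ∑ q, conj A P s p q ^ 2) := by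
        refine (pi_norm_le_iff_of_nonneg (Real.sqrt_nonneg _)).2 fun p =>
          (pi_norm_le_iff_of_nonneg (Real.sqrt_nonneg _)).2 fun q => ?_
        rw [Real.norm_eq_abs]
        refine Real.abs_le_sqrt ?_
        refine (Finset.single_le_sum (f := fun q => conj A P s p q ^ 2)
          (fun _ _ => sq_nonneg _) (Finset.mem_univ q)).trans ?_
        exact Finset.single_le_sum (f := fun p => ∑ q, conj A P s p q ^ 2)
          (fun _ _ => Finset.sum_nonneg fun _ _ => sq_nonneg _) (Finset.mem_univ p)
      have h4 : 0 ≤ ∑ p, ∑ q, conj A P s p q ^ 2 :=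
        Finset.sum_nonneg fun _ _ => Finset.sum_nonneg fun _ _ => sq_nonneg _
      calc conj A P (s + N * T) i j ^ 2 = |conj A P (s + N * T) i j| ^ 2 := (sq_abs _).symm
        _ ≤ (K * √(∑ p, ∑ q, conj A P s p q ^ 2)) ^ 2 := by
            gcongr
            exact h2.trans (mul_le_mul_of_nonneg_left h3 hK0)
        _ = Q s := by rw [mul_pow, Real.sq_sqrt h4]
  -- A window starting at an arbitrary s ≥ 0 is contained in two consecutive windows of the grid.
  refine ⟨(∫ t in (0 : ℝ)..T, Q t) + ∫ t in (0 : ℝ)..T, Q t, fun s hs i j => ?_⟩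
  obtain ⟨N, u, hu0, huT, rfl⟩ := exists_nat_mul_add hT hs
  have h1 := hwin N i j
  have h2 := hwin (N + 1) i j
  have e : ((N + 1 : ℕ) : ℝ) * T = N * T + T := by push_cast; ring
  rw [e] at h2
  calc ∫ τ in (N * T + u)..(N * T + u + T), conj A P τ i j ^ 2
      ≤ ∫ τ in (N * T)..(N * T + T + T), conj A P τ i j ^ 2 :=
        intervalIntegral.integral_mono_interval (by linarith) (by linarith) (by linarith)
          (ae_of_all _ fun t => sq_nonneg _) (hsq _ _ i j)
    _ = (∫ τ in (N * T)..(N * T + T), conj A P τ i j ^ 2) +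
          ∫ τ in (N * T + T)..(N * T + T + T), conj A P τ i j ^ 2 :=
        (intervalIntegral.integral_add_adjacent_intervals (hsq _ _ i j) (hsq _ _ i j)).symm
    _ ≤ _ := add_le_add h1 h2

/-- On one period the flow is bounded by compactness, so M is bounded there together with P. The
uniform bound on the monodromy powers carries this to all later periods. -/
theorem uniformlyBounded_of_tendsto (hT : 0 < T) (hper : Function.Periodic P T)
    (hP : ∀ i j, MemLp (fun t => P t i j) 2 (volume.restrict (Ioc 0 T)))
    (hPb : ∃ K : ℝ, ∀ᵐ t : ℝ, ∀ i j, |P t i j| ≤ K) {L : Mat n}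
    (hL : Tendsto (timeAverage (conj A P)) atTop (𝓝 L)) :
    UniformlyBounded (conj A P) := by
  obtain ⟨K, hK0, hK⟩ := exists_ae_norm_conjEntries_le hT hper hP hL
  obtain ⟨KP, hKP⟩ := hPb
  have hF : ∀ p q, ∃ F : ℝ, ∀ t ∈ Icc (-T) T, ‖flow A t p q‖ ≤ F := fun p q =>
    isCompact_Icc.exists_bound_of_continuousOn (continuous_flow_apply A p q).continuousOn
  choose F hF using hF
  have hFn : ∀ p q, 0 ≤ F p q := fun p q =>
    (norm_nonneg _).trans (hF p q 0 ⟨by linarith, hT.le⟩)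
  set K1 : ℝ := ∑ i, ∑ j, ∑ q, ∑ p, F i p * |KP| * F q j with hK1
  have hb : ∀ᵐ s : ℝ, s ∈ Ico 0 T → ‖conjEntries A P s‖ ≤ K1 := by
    filter_upwards [hKP] with s hs hsT
    have hK1n : 0 ≤ K1 := by
      refine Finset.sum_nonneg fun i _ => Finset.sum_nonneg fun j _ => Finset.sum_nonneg fun q _ =>
        Finset.sum_nonneg fun p _ => ?_
      have := hFn i p
      have := hFn q j
      positivity
    refine (pi_norm_le_iff_of_nonneg hK1n).2 fun i => (pi_norm_le_iff_of_nonneg hK1n).2 fun j => ?_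
    have hnn : ∀ i j, 0 ≤ ∑ q, ∑ p, F i p * |KP| * F q j := fun i j =>
      Finset.sum_nonneg fun q _ => Finset.sum_nonneg fun p _ => by
        have := hFn i p
        have := hFn q j
        positivity
    have h0 : ‖conjEntries A P s i j‖ ≤ ∑ q, ∑ p, F i p * |KP| * F q j := by
      rw [conjEntries, conj_apply]
      refine (norm_sum_le _ _).trans (Finset.sum_le_sum fun q _ => (norm_sum_le _ _).trans
        (Finset.sum_le_sum fun p _ => ?_))
      rw [norm_mul, norm_mul]
      have h1 := hF i p (-s) ⟨by linarith [hsT.2], by linarith [hsT.1]⟩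
      have h2 := hF q j s ⟨by linarith [hsT.1], hsT.2.le⟩
      have h3 : ‖P s p q‖ ≤ |KP| := (hs p q).trans (le_abs_self _)
      have := hFn i p
      gcongr
    refine h0.trans ((Finset.single_le_sum (f := fun j => ∑ q, ∑ p, F i p * |KP| * F q j)
      (fun j _ => hnn i j) (Finset.mem_univ j)).trans ?_)
    exact Finset.single_le_sum (f := fun i => ∑ j, ∑ q, ∑ p, F i p * |KP| * F q j)
      (fun i _ => Finset.sum_nonneg fun j _ => hnn i j) (Finset.mem_univ i)
  refine ⟨K * K1, ?_⟩
  have hall : ∀ᵐ s : ℝ, s ∈ Ico 0 T → ∀ N : ℕ, ‖conjEntries A P (s + N * T)‖ ≤ K * K1 := by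
    filter_upwards [hK, hb] with s h1 h2 hs N
    exact (h1 hs N).trans (mul_le_mul_of_nonneg_left (h2 hs) hK0)
  -- Countably many translates of the exceptional null set are still null.
  have hshift : ∀ᵐ t : ℝ, ∀ N : ℕ, t - N * T ∈ Ico 0 T → ∀ N' : ℕ,
      ‖conjEntries A P (t - N * T + N' * T)‖ ≤ K * K1 :=
    ae_all_iff.2 fun N =>
      (measurePreserving_sub_right volume ((N : ℝ) * T)).quasiMeasurePreserving.ae hall
  filter_upwards [hshift] with t ht ht0 i j
  obtain ⟨N, u, hu0, huT, rfl⟩ := exists_nat_mul_add hT ht0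
  have := ht N ⟨by linarith, by linarith⟩ N
  rw [sub_add_cancel] at this
  exact ((norm_le_pi_norm (conjEntries A P (N * T + u) i) j).trans
          (norm_le_pi_norm (conjEntries A P (N * T + u)) i)).trans this

theorem l2UniformlyBounded_of_uniformlyBounded (hT : 0 < T) (hper : Function.Periodic P T)
    (hP : ∀ i j, MemLp (fun t => P t i j) 2 (volume.restrict (Ioc 0 T)))
    (h : UniformlyBounded (conj A P)) : L2UniformlyBounded T (conj A P) := by
  obtain ⟨K, hK⟩ := h
  refine ⟨T * K ^ 2, fun s hs i j => ?_⟩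
  have e : T * K ^ 2 = ∫ _ in s..(s + T), K ^ 2 := by simp
  rw [e]
  refine intervalIntegral.integral_mono_ae_restrict (by linarith)
    (intervalIntegrable_conj_sq hT hper hP _ _ i j) intervalIntegrable_const ?_
  rw [Filter.EventuallyLE, ae_restrict_iff' measurableSet_Icc]
  filter_upwards [hK] with t ht hts
  rw [← sq_abs]
  gcongr
  exact ht (hs.trans hts.1) i j

end Averages

/-! ### The action of matrices on Euclidean space -/

section Act

variable {n : ℕ}

@[simp]
theorem act_apply (N : Mat n) (v : Vec n) (i : Fin n) : act N v i = ∑ j, N i j * v j := rfl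

theorem act_add_right (N : Mat n) (v w : Vec n) : act N (v + w) = act N v + act N w := by
  ext i; simp [mul_add, Finset.sum_add_distrib]

theorem act_sub_right (N : Mat n) (v w : Vec n) : act N (v - w) = act N v - act N w := by
  ext i; simp [mul_sub, Finset.sum_sub_distrib]

theorem act_add_left (N M : Mat n) (v : Vec n) : act (N + M) v = act N v + act M v := by
  ext i; simp [add_mul, Finset.sum_add_distrib]

theorem act_sub_left (N M : Mat n) (v : Vec n) : act (N - M) v = act N v - act M v := by
  ext i; simp [sub_mul, Finset.sum_sub_distrib]

theorem act_neg_left (N : Mat n) (v : Vec n) : act (-N) v = -act N v := by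
  ext i; simp

theorem act_smul_left (c : ℝ) (N : Mat n) (v : Vec n) : act (c • N) v = c • act N v := by
  ext i; simp [Finset.mul_sum, mul_assoc]

theorem act_smul_right (c : ℝ) (N : Mat n) (v : Vec n) : act N (c • v) = c • act N v := by
  ext i; simp only [act_apply, PiLp.smul_apply, smul_eq_mul, Finset.mul_sum]
  exact Finset.sum_congr rfl fun j _ => by ring

theorem act_zero_left (v : Vec n) : act (0 : Mat n) v = 0 := by
  ext i; simp

theorem act_one (v : Vec n) : act (1 : Mat n) v = v := by
  rw [act, Matrix.one_mulVec]

theorem act_mul (N M : Mat n) (v : Vec n) : act (N * M) v = act N (act M v) := by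
  simp [act, Matrix.mulVec_mulVec]

theorem norm_act_le {N : Mat n} {K : ℝ} (hN : ∀ i j, |N i j| ≤ K) (v : Vec n) :
    ‖act N v‖ ≤ n * (n * K) * ‖v‖ := by
  have h1 : ‖act N v‖ ≤ ∑ i, |act N v i| := by
    rw [EuclideanSpace.norm_eq]
    refine Real.sqrt_le_iff.2 ⟨Finset.sum_nonneg fun i _ => abs_nonneg _, ?_⟩
    exact Finset.sum_sq_le_sq_sum_of_nonneg fun i _ => abs_nonneg _
  have h2 : ∀ i, |act N v i| ≤ n * K * ‖v‖ := by
    intro i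
    rw [act_apply]
    refine (Finset.abs_sum_le_sum_abs _ _).trans ?_
    calc ∑ j, |N i j * v j| ≤ ∑ _j : Fin n, K * ‖v‖ := by
          refine Finset.sum_le_sum fun j _ => ?_
          rw [abs_mul]
          exact mul_le_mul (hN i j) (PiLp.norm_apply_le v j) (abs_nonneg _)
            ((abs_nonneg _).trans (hN i j))
      _ = n * K * ‖v‖ := by simp; ring
  calc ‖act N v‖ ≤ ∑ i, |act N v i| := h1
    _ ≤ ∑ _i : Fin n, n * K * ‖v‖ := Finset.sum_le_sum fun i _ => h2 i
    _ = n * (n * K) * ‖v‖ := by simp; ring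

theorem continuousOn_act {N : ℝ → Mat n} {v : ℝ → Vec n} {s : Set ℝ}
    (hN : ∀ i j, ContinuousOn (fun t => N t i j) s) (hv : ContinuousOn v s) :
    ContinuousOn (fun t => act (N t) (v t)) s := by
  refine (PiLp.continuous_toLp 2 _).comp_continuousOn
    (continuousOn_pi.2 fun i => ?_)
  change ContinuousOn (fun t => ∑ j, N t i j * v t j) s
  exact continuousOn_finsetSum _ fun j _ => (hN i j).mul
    ((EuclideanSpace.proj (𝕜 := ℝ) j).continuous.comp_continuousOn hv)

end Act

/-! ### Product rule for Carathéodory solutions -/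

section ProductRule

/-- u and v agree on [0, t] with absolutely continuous primitives, whose derivatives are a and b
almost everywhere. Integration by parts for absolutely continuous functions applies. -/
theorem mul_eq_add_integral {u v a b : ℝ → ℝ} {t : ℝ} (ht : 0 ≤ t)
    (ha : IntervalIntegrable a volume 0 t) (hb : IntervalIntegrable b volume 0 t)
    (hu : ∀ s ∈ Icc 0 t, u s = u 0 + ∫ τ in (0 : ℝ)..s, a τ)
    (hv : ∀ s ∈ Icc 0 t, v s = v 0 + ∫ τ in (0 : ℝ)..s, b τ) :
    u t * v t = u 0 * v 0 + ∫ s in (0 : ℝ)..t, (a s * v s + u s * b s) := by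
  have hac : ∀ (c : ℝ) {g : ℝ → ℝ}, IntervalIntegrable g volume 0 t →
      AbsolutelyContinuousOnInterval (fun s => c + ∫ τ in (0 : ℝ)..s, g τ) 0 t := by
    intro c g hg
    have h0 : AbsolutelyContinuousOnInterval (fun _ : ℝ => c) 0 t :=
      (contDiff_const (𝕜 := ℝ) (n := 1)).contDiffOn.absolutelyContinuousOnInterval
    exact h0.fun_add (hg.absolutelyContinuousOnInterval_intervalIntegral left_mem_uIcc)
  have key := (hac (u 0) ha).integral_deriv_mul_eq_sub (hac (v 0) hb)
  rw [← hu t ⟨ht, le_rfl⟩, ← hv t ⟨ht, le_rfl⟩] at key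
  simp only [intervalIntegral.integral_same, add_zero] at key
  rw [eq_comm, ← eq_sub_iff_add_eq', ← key]
  refine intervalIntegral.integral_congr_ae ?_
  filter_upwards [ha.ae_hasDerivAt_integral, hb.ae_hasDerivAt_integral] with s h1 h2 hs
  have hs' : s ∈ uIcc 0 t := uIoc_subset_uIcc hs
  have hsI : s ∈ Icc 0 t := by rwa [uIcc_of_le ht] at hs'
  rw [((h1 hs' 0 left_mem_uIcc).const_add (u 0)).deriv,
    ((h2 hs' 0 left_mem_uIcc).const_add (v 0)).deriv, ← hu s hsI, ← hv s hsI]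

variable {n : ℕ}

theorem intervalIntegrable_vec_iff {g : ℝ → Vec n} {a b : ℝ} :
    IntervalIntegrable g volume a b ↔ ∀ i, IntervalIntegrable (fun t => g t i) volume a b := by
  simp only [intervalIntegrable_iff, IntegrableOn]
  exact integrable_piLp_iff

theorem intervalIntegral_vec_apply {g : ℝ → Vec n} {a b : ℝ}
    (hg : IntervalIntegrable g volume a b) (i : Fin n) :
    (∫ t in a..b, g t) i = ∫ t in a..b, g t i :=
  (ContinuousLinearMap.intervalIntegral_comp_comm (EuclideanSpace.proj (𝕜 := ℝ) i) hg).symm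

theorem continuousOn_of_eq_add_integral {E : Type*} [NormedAddCommGroup E] [NormedSpace ℝ E]
    {v b : ℝ → E} {t : ℝ} (ht : 0 ≤ t)
    (hb : IntervalIntegrable b volume 0 t)
    (hv : ∀ s ∈ Icc 0 t, v s = v 0 + ∫ τ in (0 : ℝ)..s, b τ) : ContinuousOn v (Icc 0 t) := by
  have := intervalIntegral.continuousOn_primitive_interval' hb left_mem_uIcc
  rw [uIcc_of_le ht] at this
  exact (continuousOn_const.add this).congr hv

theorem intervalIntegrable_act {N : ℝ → Mat n} {v : ℝ → Vec n} {t : ℝ} (ht : 0 ≤ t)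
    (hN : ∀ i j, IntervalIntegrable (fun s => N s i j) volume 0 t)
    (hv : ContinuousOn v (Icc 0 t)) :
    IntervalIntegrable (fun s => act (N s) (v s)) volume 0 t := by
  refine intervalIntegrable_vec_iff.2 fun i => ?_
  simp only [act_apply]
  refine intervalIntegrable_iff.2 (integrable_finsetSum _ fun j _ =>
    intervalIntegrable_iff.1 ((hN i j).mul_continuousOn ?_))
  rw [uIcc_of_le ht]
  exact (EuclideanSpace.proj (𝕜 := ℝ) j).continuous.comp_continuousOn hv

theorem intervalIntegrable_act' {N : ℝ → Mat n} {v : ℝ → Vec n} {t : ℝ} (ht : 0 ≤ t)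
    (hN : ∀ i j, ContinuousOn (fun s => N s i j) (Icc 0 t))
    (hv : IntervalIntegrable v volume 0 t) :
    IntervalIntegrable (fun s => act (N s) (v s)) volume 0 t := by
  refine intervalIntegrable_vec_iff.2 fun i => ?_
  simp only [act_apply]
  refine intervalIntegrable_iff.2 (integrable_finsetSum _ fun j _ =>
    intervalIntegrable_iff.1 ((intervalIntegrable_vec_iff.1 hv j).continuousOn_mul ?_))
  rw [uIcc_of_le ht]
  exact hN i j

/-- The product rule entry by entry. It serves for the variation of constants, for passing from x to
e^{-At} x, and for integrating by parts against the primitive of M - B. -/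
theorem act_eq_add_integral {Y Y' : ℝ → Mat n} {v b : ℝ → Vec n} {t : ℝ} (ht : 0 ≤ t)
    (hY' : ∀ i j, IntervalIntegrable (fun s => Y' s i j) volume 0 t)
    (hb : IntervalIntegrable b volume 0 t)
    (hY : ∀ s ∈ Icc 0 t, ∀ i j, Y s i j = Y 0 i j + ∫ τ in (0 : ℝ)..s, Y' τ i j)
    (hv : ∀ s ∈ Icc 0 t, v s = v 0 + ∫ τ in (0 : ℝ)..s, b τ) :
    IntervalIntegrable (fun s => act (Y' s) (v s) + act (Y s) (b s)) volume 0 t ∧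
    act (Y t) (v t) = act (Y 0) (v 0) +
      ∫ s in (0 : ℝ)..t, (act (Y' s) (v s) + act (Y s) (b s)) := by
  have hvc := continuousOn_of_eq_add_integral ht hb hv
  have hYc : ∀ i j, ContinuousOn (fun s => Y s i j) (Icc 0 t) := fun i j =>
    continuousOn_of_eq_add_integral ht (hY' i j) fun s hs => hY s hs i j
  have h1 := intervalIntegrable_act ht hY' hvc
  have h2 := intervalIntegrable_act' ht hYc hb
  refine ⟨h1.add h2, ?_⟩
  ext i
  have hbi := intervalIntegrable_vec_iff.1 hb
  have hvi : ∀ j, ∀ s ∈ Icc 0 t, v s j = v 0 j + ∫ τ in (0 : ℝ)..s, b τ j := by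
    intro j s hs
    have hsub : IntervalIntegrable b volume 0 s :=
      hb.mono_set (by rw [uIcc_of_le hs.1, uIcc_of_le ht]; exact Icc_subset_Icc_right hs.2)
    rw [hv s hs, PiLp.add_apply, intervalIntegral_vec_apply hsub]
  rw [PiLp.add_apply, intervalIntegral_vec_apply (h1.add h2)]
  simp only [PiLp.add_apply, act_apply]
  have hprod : ∀ j, IntervalIntegrable (fun s => Y' s i j * v s j + Y s i j * b s j) volume 0 t := by
    intro j
    refine ((hY' i j).mul_continuousOn ?_).add ((hbi j).continuousOn_mul ?_)
    · rw [uIcc_of_le ht]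
      exact (EuclideanSpace.proj (𝕜 := ℝ) j).continuous.comp_continuousOn hvc
    · rw [uIcc_of_le ht]; exact hYc i j
  simp only [← Finset.sum_add_distrib]
  rw [intervalIntegral.integral_finsetSum fun j _ => hprod j, ← Finset.sum_add_distrib]
  exact Finset.sum_congr rfl fun j _ =>
    mul_eq_add_integral ht (hY' i j) (hbi j) (fun s hs => hY s hs i j) (hvi j)

end ProductRule

/-! ### Gronwall's inequality in integral form -/

section Gronwall

theorem le_mul_exp_of_le_add_integral {g : ℝ → ℝ} {t c k : ℝ} (ht : 0 ≤ t) (hk : 0 ≤ k)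
    (hg : ContinuousOn g (Icc 0 t))
    (h : ∀ s ∈ Icc 0 t, g s ≤ c + k * ∫ τ in (0 : ℝ)..s, g τ) : g t ≤ c * Real.exp (k * t) := by
  -- Extending g by its endpoint values makes the right-hand side differentiable everywhere, so that
  -- the differential form of Gronwall applies to it.
  set G : ℝ → ℝ := IccExtend ht (domRestrict (Icc 0 t) g) with hG
  have hGc : Continuous G := (continuousOn_iff_continuous_domRestrict.1 hg).Icc_extend'
  have hGg : ∀ s ∈ Icc 0 t, G s = g s := fun s hs => by
    rw [hG, IccExtend_of_mem ht _ hs, domRestrict_apply]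
  have hint : ∀ s ∈ Icc 0 t, ∫ τ in (0 : ℝ)..s, g τ = ∫ τ in (0 : ℝ)..s, G τ := by
    intro s hs
    refine intervalIntegral.integral_congr fun τ hτ => ?_
    rw [uIcc_of_le hs.1] at hτ
    exact (hGg τ ⟨hτ.1, hτ.2.trans hs.2⟩).symm
  have hd : ∀ s, HasDerivAt (fun s => c + k * ∫ τ in (0 : ℝ)..s, G τ) (k * G s) s := fun s =>
    ((hGc.integral_hasStrictDerivAt 0 s).hasDerivAt.const_mul k).const_add c
  have hb := le_gronwallBound_of_liminf_deriv_right_le (δ := c) (K := k) (ε := 0) (a := 0) (b := t)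
    (f := fun s => c + k * ∫ τ in (0 : ℝ)..s, G τ) (f' := fun s => k * G s)
    (fun s _ => (hd s).continuousAt.continuousWithinAt)
    (fun s _ r hr => (hd s).hasDerivWithinAt.liminf_right_slope_le hr) (by simp)
    (fun s hs => by
      have hs' : s ∈ Icc 0 t := ⟨hs.1, hs.2.le⟩
      rw [add_zero]
      refine mul_le_mul_of_nonneg_left ?_ hk
      rw [hGg s hs', ← hint s hs']
      exact h s hs') t ⟨ht, le_rfl⟩
  rw [gronwallBound_ε0, sub_zero] at hb
  refine le_trans ?_ hb
  have := h t ⟨ht, le_rfl⟩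
  rwa [hint t ⟨ht, le_rfl⟩] at this

end Gronwall

/-! ### The cell problem and the error estimate -/

section CellProblem

variable {n : ℕ}

theorem flow_apply_eq_add_integral (A : Mat n) (s : ℝ) (i j : Fin n) :
    flow A s i j = flow A 0 i j + ∫ τ in (0 : ℝ)..s, (A * flow A τ) i j := by
  have hcomm : ∀ τ, A * flow A τ = flow A τ * A := fun τ =>
    (((Commute.refl A).smul_right τ).exp_right).eq
  have hc : Continuous fun τ => (flow A τ * A) i j := by
    simp only [Matrix.mul_apply]
    exact continuous_finsetSum _ fun k _ => (continuous_flow_apply A i k).mul continuous_const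
  simp only [hcomm]
  rw [intervalIntegral.integral_eq_sub_of_hasDerivAt (fun τ _ => hasDerivAt_flow A τ i j)
    (hc.intervalIntegrable _ _)]
  ring

theorem flow_neg_apply_eq_add_integral (A : Mat n) (s : ℝ) (i j : Fin n) :
    flow A (-s) i j = flow A (-0) i j + ∫ τ in (0 : ℝ)..s, (-(flow A (-τ) * A)) i j := by
  have hc : Continuous fun τ => (-(flow A (-τ) * A)) i j := by
    simp only [Matrix.neg_apply, Matrix.mul_apply]
    exact (continuous_finsetSum _ fun k _ =>
      ((continuous_flow_apply A i k).comp continuous_neg).mul continuous_const).neg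
  have hd : ∀ τ, HasDerivAt (fun τ => flow A (-τ) i j) ((-(flow A (-τ) * A)) i j) τ := fun τ => by
    have := (hasDerivAt_flow A (-τ) i j).comp τ (hasDerivAt_neg τ)
    simpa [Function.comp_def] using this
  rw [intervalIntegral.integral_eq_sub_of_hasDerivAt (fun τ _ => hd τ)
    (hc.intervalIntegrable _ _)]
  ring

theorem intervalIntegrable_of_integrableOn_Icc {E : Type*} [NormedAddCommGroup E] {g : ℝ → E}
    {S t : ℝ} (hg : IntegrableOn g (Icc 0 S)) (ht : t ∈ Icc 0 S) :
    IntervalIntegrable g volume 0 t :=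
  (intervalIntegrable_iff_integrableOn_Icc_of_le ht.1).2 (hg.mono_set (Icc_subset_Icc_right ht.2))

theorem IsSolution.intervalIntegrable {S : ℝ} {N : ℝ → Mat n} {h x : ℝ → Vec n}
    (hx : IsSolution S N h x) {t : ℝ} (ht : t ∈ Icc 0 S) :
    IntervalIntegrable (fun τ => act (N τ) (x τ) + h τ) volume 0 t :=
  intervalIntegrable_of_integrableOn_Icc hx.2.1 ht

theorem IsSolution.eq_of_le {S : ℝ} {N : ℝ → Mat n} {h x : ℝ → Vec n}
    (hx : IsSolution S N h x) {t : ℝ} (ht : t ∈ Icc 0 S) :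
    ∀ s ∈ Icc 0 t, x s = x 0 + ∫ τ in (0 : ℝ)..s, (act (N τ) (x τ) + h τ) :=
  fun s hs => hx.2.2 s ⟨hs.1, hs.2.trans ht.2⟩

/-- Variation of constants: Ω(t) = e^{Nt} (x₀ + ∫₀ᵗ e^{-Ns} h(s) ds), checked by the product rule.
-/
theorem exists_isSolution_const {S : ℝ} (hS : 0 ≤ S) (N : Mat n) {h : ℝ → Vec n}
    (hh : IntegrableOn h (Icc 0 S)) (x0 : Vec n) :
    ∃ Ω : ℝ → Vec n, Ω 0 = x0 ∧ IsSolution S (fun _ => N) h Ω := by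
  have hb : IntegrableOn (fun s => act (flow N (-s)) (h s)) (Icc 0 S) :=
    (intervalIntegrable_iff_integrableOn_Icc_of_le hS).1 (intervalIntegrable_act' hS
      (fun i j => ((continuous_flow_apply N i j).comp continuous_neg).continuousOn)
      (intervalIntegrable_of_integrableOn_Icc hh ⟨hS, le_rfl⟩))
  set v : ℝ → Vec n := fun t => x0 + ∫ s in (0 : ℝ)..t, act (flow N (-s)) (h s) with hv
  have hv0 : v 0 = x0 := by simp [hv]
  have hY' : ∀ (t : ℝ) i j, IntervalIntegrable (fun s => (N * flow N s) i j) volume 0 t := by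
    intro t i j
    simp only [Matrix.mul_apply]
    exact (continuous_finsetSum _ fun k _ =>
      continuous_const.mul (continuous_flow_apply N k j)).intervalIntegrable _ _
  have hprod := fun (t : ℝ) (ht : t ∈ Icc 0 S) =>
    act_eq_add_integral (Y := flow N) (Y' := fun s => N * flow N s) (v := v) ht.1 (hY' t)
      (intervalIntegrable_of_integrableOn_Icc hb ht)
      (fun s _ i j => flow_apply_eq_add_integral N s i j) (fun s _ => by rw [hv0])
  have hfun : ∀ s, act (N * flow N s) (v s) + act (flow N s) (act (flow N (-s)) (h s)) =
      act N (act (flow N s) (v s)) + h s := by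
    intro s
    rw [act_mul, ← act_mul (flow N s), flow_mul_flow_neg, act_one]
  simp only [hfun, flow_zero, act_one, hv0] at hprod
  have h0 : act (flow N 0) (v 0) = x0 := by rw [flow_zero, act_one, hv0]
  refine ⟨fun t => act (flow N t) (v t), h0, ?_, ?_, ?_⟩
  · exact continuousOn_of_eq_add_integral hS (hprod S ⟨hS, le_rfl⟩).1
      fun t ht => by rw [(hprod t ht).2, h0]
  · exact (intervalIntegrable_iff_integrableOn_Icc_of_le hS).1 (hprod S ⟨hS, le_rfl⟩).1
  · intro t ht
    change act (flow N t) (v t) = act (flow N 0) (v 0) +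
      ∫ τ in (0 : ℝ)..t, (act N (act (flow N τ) (v τ)) + h τ)
    rw [(hprod t ht).2, h0]

/-- In the moving frame w = e^{-At} x the term A x cancels, leaving w' = εMw + e^{-At} f. -/
theorem IsSolution.act_flow_neg_eq {S ε : ℝ} {A : Mat n} {P : ℝ → Mat n} {f x : ℝ → Vec n}
    (hx : IsSolution S (fun t => A + ε • P t) f x)
    (hf : IntegrableOn (fun τ => act (flow A (-τ)) (f τ)) (Icc 0 S)) {t : ℝ} (ht : t ∈ Icc 0 S) :
    IntervalIntegrable (fun s => ε • act (conj A P s) (act (flow A (-s)) (x s))) volume 0 t ∧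
    act (flow A (-t)) (x t) = x 0 + forcing A f t +
      ∫ s in (0 : ℝ)..t, ε • act (conj A P s) (act (flow A (-s)) (x s)) := by
  have hY' : ∀ i j, IntervalIntegrable (fun s => (-(flow A (-s) * A)) i j) volume 0 t := by
    intro i j
    simp only [Matrix.neg_apply, Matrix.mul_apply]
    exact (continuous_finsetSum _ fun k _ => ((continuous_flow_apply A i k).comp
      continuous_neg).mul continuous_const).neg.intervalIntegrable _ _
  have hprod := act_eq_add_integral (Y := fun s => flow A (-s)) (Y' := fun s => -(flow A (-s) * A))
    ht.1 hY' (hx.intervalIntegrable ht)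
    (fun s _ i j => flow_neg_apply_eq_add_integral A s i j) (hx.eq_of_le ht)
  have hfun : ∀ s, act (-(flow A (-s) * A)) (x s) +
      act (flow A (-s)) (act (A + ε • P s) (x s) + f s) =
      ε • act (conj A P s) (act (flow A (-s)) (x s)) + act (flow A (-s)) (f s) := by
    intro s
    have : act (conj A P s) (act (flow A (-s)) (x s)) = act (flow A (-s)) (act (P s) (x s)) := by
      rw [conj, ← act_mul, mul_assoc, flow_mul_flow_neg, mul_one, act_mul]
    rw [this, act_add_right, act_add_left, act_add_right, act_smul_left, act_smul_right,
      act_neg_left, act_mul]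
    abel
  simp only [hfun, neg_zero, flow_zero, act_one] at hprod
  have hfi := intervalIntegrable_of_integrableOn_Icc hf ht
  have hint : IntervalIntegrable (fun s => ε • act (conj A P s) (act (flow A (-s)) (x s)))
      volume 0 t := by simpa using hprod.1.sub hfi
  refine ⟨hint, ?_⟩
  rw [hprod.2, intervalIntegral.integral_add hint hfi, forcing]
  abel

theorem continuousOn_forcing {S : ℝ} {A : Mat n} {f : ℝ → Vec n} (hS : 0 ≤ S)
    (hf : IntegrableOn (fun τ => act (flow A (-τ)) (f τ)) (Icc 0 S)) :
    ContinuousOn (forcing A f) (Icc 0 S) :=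
  continuousOn_of_eq_add_integral hS (intervalIntegrable_of_integrableOn_Icc hf ⟨hS, le_rfl⟩)
    fun s _ => by simp [forcing]

theorem le_maxNorm {y : ℝ → Vec n} {S s t : ℝ} (hy : ContinuousOn y (Icc 0 S)) (hst : s ∈ Icc 0 t)
    (ht : t ≤ S) : ‖y s‖ ≤ maxNorm y t :=
  le_csSup ((isCompact_Icc.image_of_continuousOn
    (hy.norm.mono (Icc_subset_Icc_right ht))).bddAbove) (mem_image_of_mem _ hst)

/-- First-order averaging: the difference between the amplitude and the solution of the cell
problem is controlled through the primitive of `M - B`. -/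
theorem norm_sub_cell_le {Chat ε k K : ℝ} {A B : Mat n} {P : ℝ → Mat n} (hε : 0 < ε)
    (hChat : 0 < Chat)
    (hM : ∀ᵐ t : ℝ, 0 ≤ t → ∀ v : Vec n, ‖act (conj A P t) v‖ ≤ k * ‖v‖) (hk : 0 ≤ k)
    (hMi : ∀ a b i j, IntervalIntegrable (fun t => conj A P t i j) volume a b)
    (hB : ∀ v : Vec n, ‖act B v‖ ≤ k * ‖v‖)
    (hΨ : ∀ t : ℝ, 0 ≤ t → ∀ i j, |(∫ τ in (0 : ℝ)..t, conj A P τ i j) - t * B i j| ≤ K)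
    (hK : ∀ N : Mat n, (∀ i j, |N i j| ≤ K) → ∀ v : Vec n, ‖act N v‖ ≤ k * ‖v‖)
    {f x Ω : ℝ → Vec n}
    (hf : IntegrableOn (fun τ => act (flow A (-τ)) (f τ)) (Icc 0 (Chat / ε)))
    (hx : IsSolution (Chat / ε) (fun t => A + ε • P t) f x) (hΩ0 : Ω 0 = x 0)
    (hΩ : IsSolution (Chat / ε) (fun _ => ε • B)
      (fun t => ε • act (conj A P t) (forcing A f t)) Ω) {t : ℝ} (ht : t ∈ Icc 0 (Chat / ε)) :
    ‖act (flow A (-t)) (x t) - Ω t - forcing A f t‖ ≤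
      ε * (k + k * k * Chat) * (maxNorm Ω t + maxNorm (forcing A f) t) * Real.exp (k * Chat) := by
  set S := Chat / ε with hSdef
  have hS : 0 ≤ S := by positivity
  set φ := forcing A f with hφ
  set E : ℝ → Vec n := fun t => act (flow A (-t)) (x t) - Ω t - φ t with hE
  have hφc : ContinuousOn φ (Icc 0 S) := continuousOn_forcing hS hf
  have hEc : ContinuousOn E (Icc 0 S) :=
    ((continuousOn_act (fun i j => ((continuous_flow_apply A i j).comp
      continuous_neg).continuousOn) hx.1).sub hΩ.1).sub hφc
  set Ψ : ℝ → Mat n := fun t => Matrix.of fun i j =>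
    ∫ τ in (0 : ℝ)..t, (conj A P τ - B) i j with hΨdef
  have hMBi : ∀ a b i j, IntervalIntegrable (fun t => (conj A P t - B) i j) volume a b :=
    fun a b i j => (hMi a b i j).sub intervalIntegrable_const
  have hΨb : ∀ t, 0 ≤ t → ∀ v : Vec n, ‖act (Ψ t) v‖ ≤ k * ‖v‖ := by
    intro t ht
    refine hK _ fun i j => ?_
    have := hΨ t ht i j
    have e : Ψ t i j = (∫ τ in (0 : ℝ)..t, conj A P τ i j) - t * B i j := by
      simp only [hΨdef, Matrix.of_apply, Matrix.sub_apply]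
      rw [intervalIntegral.integral_sub (hMi 0 t i j) intervalIntegrable_const]
      simp
    rwa [e]
  set D := maxNorm Ω t + maxNorm φ t with hD
  have hΩle : ∀ s ∈ Icc 0 t, ‖Ω s‖ ≤ maxNorm Ω t := fun s hs => le_maxNorm hΩ.1 hs ht.2
  have hφle : ∀ s ∈ Icc 0 t, ‖φ s‖ ≤ maxNorm φ t := fun s hs => le_maxNorm hφc hs ht.2
  have hD0 : 0 ≤ D := add_nonneg ((norm_nonneg _).trans (hΩle 0 ⟨le_rfl, ht.1⟩))
    ((norm_nonneg _).trans (hφle 0 ⟨le_rfl, ht.1⟩))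
  have hεS : ε * S = Chat := by rw [hSdef]; field_simp
  have hmain : ∀ s ∈ Icc 0 t, ‖E s‖ ≤ ε * (k + k * k * Chat) * D +
      ε * k * ∫ τ in (0 : ℝ)..s, ‖E τ‖ := by
    intro s hs
    have hsS : s ∈ Icc 0 S := ⟨hs.1, hs.2.trans ht.2⟩
    obtain ⟨hwi, hw⟩ := hx.act_flow_neg_eq hf hsS
    have hΩs := hΩ.2.2 s hsS
    have hΩi := hΩ.intervalIntegrable hsS
    have hEcs : ContinuousOn E (Icc 0 s) := hEc.mono (Icc_subset_Icc_right hsS.2)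
    have hΩcs : ContinuousOn Ω (Icc 0 s) := hΩ.1.mono (Icc_subset_Icc_right hsS.2)
    have hMEi : IntervalIntegrable (fun τ => act (conj A P τ) (E τ)) volume 0 s :=
      intervalIntegrable_act hs.1 (hMi 0 s) hEcs
    have hMBΩi : IntervalIntegrable (fun τ => act (conj A P τ - B) (Ω τ)) volume 0 s :=
      intervalIntegrable_act hs.1 (hMBi 0 s) hΩcs
    obtain ⟨hpi, hp⟩ := act_eq_add_integral (Y := Ψ) (Y' := fun τ => conj A P τ - B) hs.1
      (hMBi 0 s) hΩi (fun s _ i j => by simp [hΨdef]) (hΩ.eq_of_le hsS)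
    have hΨ0 : Ψ 0 = 0 := by ext i j; simp [hΨdef]
    rw [hΨ0, act_zero_left, zero_add] at hp
    have hΨbi : IntervalIntegrable (fun τ => act (Ψ τ) (act (ε • B) (Ω τ) +
        ε • act (conj A P τ) (φ τ))) volume 0 s := by simpa using hpi.sub hMBΩi
    rw [intervalIntegral.integral_add hMBΩi hΨbi] at hp
    -- The source εMφ of the cell problem is chosen to cancel here, leaving E' = εME + ε(M - B)Ω.
    have hEs : E s = ε • (∫ τ in (0 : ℝ)..s, act (conj A P τ) (E τ)) +
        ε • ∫ τ in (0 : ℝ)..s, act (conj A P τ - B) (Ω τ) := by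
      rw [← smul_add, ← intervalIntegral.integral_add hMEi hMBΩi, ← intervalIntegral.integral_smul]
      have e1 : E s = (∫ τ in (0 : ℝ)..s, ε • act (conj A P τ) (act (flow A (-τ)) (x τ))) -
          ∫ τ in (0 : ℝ)..s, (act (ε • B) (Ω τ) + ε • act (conj A P τ) (φ τ)) := by
        simp only [hE]
        rw [hw, hΩs, hΩ0]
        abel
      rw [e1, ← intervalIntegral.integral_sub hwi hΩi]
      refine intervalIntegral.integral_congr fun τ _ => ?_
      simp only [hE, act_sub_right, act_sub_left, act_smul_left, smul_add, smul_sub]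
      abel
    have b1 : ‖∫ τ in (0 : ℝ)..s, act (conj A P τ) (E τ)‖ ≤ k * ∫ τ in (0 : ℝ)..s, ‖E τ‖ := by
      rw [← intervalIntegral.integral_const_mul]
      refine intervalIntegral.norm_integral_le_of_norm_le hs.1 ?_ ?_
      · filter_upwards [hM] with τ hτ hτs
        exact hτ hτs.1.le _
      · refine (ContinuousOn.intervalIntegrable ?_).const_mul _
        rw [uIcc_of_le hs.1]; exact hEcs.norm
    -- The integrand is ΨΩ'. It is of size ε and is integrated over a time at most Ĉ/ε, so the bound
    -- is independent of ε.
    have b2 : ‖∫ τ in (0 : ℝ)..s, act (Ψ τ) (act (ε • B) (Ω τ) +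
        ε • act (conj A P τ) (φ τ))‖ ≤ k * k * Chat * D := by
      calc ‖∫ τ in (0 : ℝ)..s, act (Ψ τ) (act (ε • B) (Ω τ) + ε • act (conj A P τ) (φ τ))‖
          ≤ ∫ _ in (0 : ℝ)..s, k * (ε * k * D) := by
            refine intervalIntegral.norm_integral_le_of_norm_le hs.1 ?_ intervalIntegrable_const
            filter_upwards [hM] with τ hτ hτs
            have hτt : τ ∈ Icc 0 t := ⟨hτs.1.le, hτs.2.trans hs.2⟩
            refine (hΨb τ hτs.1.le _).trans (mul_le_mul_of_nonneg_left ?_ hk)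
            refine (norm_add_le _ _).trans ?_
            rw [act_smul_left, norm_smul, norm_smul, Real.norm_of_nonneg hε.le, ← mul_add,
              mul_assoc]
            refine mul_le_mul_of_nonneg_left ?_ hε.le
            rw [hD, mul_add]
            exact add_le_add
              ((hB _).trans (mul_le_mul_of_nonneg_left (hΩle τ hτt) hk))
              ((hτ hτs.1.le _).trans (mul_le_mul_of_nonneg_left (hφle τ hτt) hk))
        _ = k * k * (ε * s) * D := by simp; ring
        _ ≤ k * k * Chat * D := by
            have : ε * s ≤ Chat := hεS ▸ mul_le_mul_of_nonneg_left hsS.2 hε.le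
            gcongr
    -- By parts: the boundary term ΨΩ, which vanishes at 0, minus the integral of ΨΩ'.
    have b3 : ‖∫ τ in (0 : ℝ)..s, act (conj A P τ - B) (Ω τ)‖ ≤ k * D + k * k * Chat * D := by
      rw [← sub_eq_iff_eq_add] at hp
      rw [← hp]
      refine (norm_sub_le _ _).trans (add_le_add ((hΨb s hs.1 _).trans ?_) b2)
      have h0 : 0 ≤ maxNorm φ t := (norm_nonneg _).trans (hφle 0 ⟨le_rfl, ht.1⟩)
      have := hΩle s hs
      gcongr
      linarith
    rw [hEs]
    refine (norm_add_le _ _).trans ?_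
    rw [norm_smul, norm_smul, Real.norm_of_nonneg hε.le]
    calc ε * ‖∫ τ in (0 : ℝ)..s, act (conj A P τ) (E τ)‖ +
          ε * ‖∫ τ in (0 : ℝ)..s, act (conj A P τ - B) (Ω τ)‖
        ≤ ε * (k * ∫ τ in (0 : ℝ)..s, ‖E τ‖) + ε * (k * D + k * k * Chat * D) := by gcongr
      _ = _ := by ring
  -- The Gronwall exponent εkt is at most kĈ on the whole interval.
  have hgr := le_mul_exp_of_le_add_integral ht.1 (by positivity)
    (hEc.mono (Icc_subset_Icc_right ht.2)).norm hmain
  refine hgr.trans (mul_le_mul_of_nonneg_left (Real.exp_le_exp.2 ?_) (by positivity))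
  have : ε * t ≤ Chat := hεS ▸ mul_le_mul_of_nonneg_left ht.2 hε.le
  calc ε * k * t = k * (ε * t) := by ring
    _ ≤ k * Chat := by gcongr

theorem cell_problem_approximation {A B : Mat n} {P : ℝ → Mat n}
    (hM : UniformlyBounded (conj A P))
    (hMi : ∀ a b i j, IntervalIntegrable (fun t => conj A P t i j) volume a b) {K : ℝ}
    (hΨ : ∀ t : ℝ, 0 ≤ t → ∀ i j, |(∫ τ in (0 : ℝ)..t, conj A P τ i j) - t * B i j| ≤ K)
    {Chat : ℝ} (hChat : 0 < Chat) :
    ∃ C : ℝ, 0 < C ∧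
      ∀ ε : ℝ, 0 < ε → ∀ f : ℝ → Vec n,
        IntegrableOn (fun τ => act (flow A (-τ)) (f τ)) (Icc 0 (Chat / ε)) →
        ∀ x : ℝ → Vec n, IsSolution (Chat / ε) (fun t => A + ε • P t) f x →
          (∃ Ω : ℝ → Vec n, Ω 0 = x 0 ∧
            IsSolution (Chat / ε) (fun _ => ε • B)
              (fun t => ε • act (conj A P t) (forcing A f t)) Ω) ∧
          ∀ Ω : ℝ → Vec n, Ω 0 = x 0 →
            IsSolution (Chat / ε) (fun _ => ε • B)
              (fun t => ε • act (conj A P t) (forcing A f t)) Ω →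
            ∃ E : ℝ → Vec n, ∀ t ∈ Icc 0 (Chat / ε),
              x t = act (flow A t) (Ω t + forcing A f t + E t) ∧
              ‖E t‖ ≤ C * ε * Real.exp (ε ^ 2 * C * t) *
                (maxNorm Ω t + maxNorm (forcing A f) t) := by
  obtain ⟨K0, hK0⟩ := hM
  set KB : ℝ := ∑ i, ∑ j, |B i j| with hKB
  have hKBn : 0 ≤ KB := Finset.sum_nonneg fun i _ => Finset.sum_nonneg fun j _ => abs_nonneg _
  have hBle : ∀ i j, |B i j| ≤ KB := fun i j =>
    (Finset.single_le_sum (f := fun j => |B i j|) (fun _ _ => abs_nonneg _)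
      (Finset.mem_univ j)).trans
    (Finset.single_le_sum (f := fun i => ∑ j, |B i j|)
      (fun _ _ => Finset.sum_nonneg fun _ _ => abs_nonneg _) (Finset.mem_univ i))
  -- One entrywise bound, hence one operator bound k, for M, for B and for the primitive of M - B.
  set K1 : ℝ := |K0| + KB + |K| with hK1
  set k : ℝ := n * (n * K1) with hk
  have hk0 : 0 ≤ k := by positivity
  have hle : ∀ N : Mat n, (∀ i j, |N i j| ≤ K1) → ∀ v : Vec n, ‖act N v‖ ≤ k * ‖v‖ :=
    fun N hN v => norm_act_le hN v
  have hMk : ∀ᵐ t : ℝ, 0 ≤ t → ∀ v : Vec n, ‖act (conj A P t) v‖ ≤ k * ‖v‖ := by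
    filter_upwards [hK0] with t ht ht0
    refine hle _ fun i j => (ht ht0 i j).trans ?_
    have := le_abs_self K0
    have := abs_nonneg K
    linarith
  have hBk : ∀ v : Vec n, ‖act B v‖ ≤ k * ‖v‖ := hle _ fun i j => (hBle i j).trans (by
    have := abs_nonneg K
    have := abs_nonneg K0
    linarith)
  have hKk : ∀ N : Mat n, (∀ i j, |N i j| ≤ K) → ∀ v : Vec n, ‖act N v‖ ≤ k * ‖v‖ :=
    fun N hN => hle N fun i j => (hN i j).trans (by
      have := le_abs_self K
      have := abs_nonneg K0
      linarith)
  -- C - 1 is the constant given by Gronwall; the summand 1 keeps C positive even if k = 0. The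
  -- factor exp(ε²Ct) ≥ 1 only weakens the estimate.
  set C : ℝ := (k + k * k * Chat) * Real.exp (k * Chat) + 1 with hC
  have hC0 : 0 < C := by positivity
  refine ⟨C, hC0, fun ε hε f hf x hx => ⟨?_, fun Ω hΩ0 hΩ => ?_⟩⟩
  · have hS : 0 ≤ Chat / ε := by positivity
    refine exists_isSolution_const hS _ ?_ _
    exact ((intervalIntegrable_iff_integrableOn_Icc_of_le hS).1
      (intervalIntegrable_act hS (hMi 0 _) (continuousOn_forcing hS hf))).smul ε
  · refine ⟨fun t => act (flow A (-t)) (x t) - Ω t - forcing A f t, fun t ht => ⟨?_, ?_⟩⟩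
    · have : Ω t + forcing A f t + (act (flow A (-t)) (x t) - Ω t - forcing A f t) =
          act (flow A (-t)) (x t) := by abel
      rw [this, ← act_mul, flow_mul_flow_neg, act_one]
    · have hS : 0 ≤ Chat / ε := by positivity
      have hD : 0 ≤ maxNorm Ω t + maxNorm (forcing A f) t := add_nonneg
        ((norm_nonneg _).trans (le_maxNorm hΩ.1 (left_mem_Icc.2 ht.1) ht.2))
        ((norm_nonneg _).trans (le_maxNorm (continuousOn_forcing hS hf)
          (left_mem_Icc.2 ht.1) ht.2))
      refine (norm_sub_cell_le hε hChat hMk hk0 hMi hBk hΨ hKk hf hx hΩ0 hΩ ht).trans ?_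
      have he : 1 ≤ Real.exp (ε ^ 2 * C * t) := Real.one_le_exp (by
        have := ht.1
        positivity)
      calc ε * (k + k * k * Chat) * (maxNorm Ω t + maxNorm (forcing A f) t) * Real.exp (k * Chat)
          = (C - 1) * ε * 1 * (maxNorm Ω t + maxNorm (forcing A f) t) := by rw [hC]; ring
        _ ≤ C * ε * Real.exp (ε ^ 2 * C * t) * (maxNorm Ω t + maxNorm (forcing A f) t) := by
            gcongr
            linarith

end CellProblem

/-! ### Polynomials in the shift acting on sequences -/

section ShiftOperator

open Polynomial

/-- The shift on complex sequences. -/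
noncomputable def seqShift : Module.End ℂ (ℕ → ℂ) := LinearMap.funLeft ℂ ℂ Nat.succ

@[simp]
theorem seqShift_apply (f : ℕ → ℂ) (N : ℕ) : seqShift f N = f (N + 1) := rfl

theorem seqShift_pow_apply (k : ℕ) (f : ℕ → ℂ) (N : ℕ) : (seqShift ^ k) f N = f (N + k) := by
  induction k generalizing N with
  | zero => simp
  | succ k ih =>
    rw [pow_succ', Module.End.mul_apply, seqShift_apply, ih]
    congr 1; ring

theorem aeval_seqShift_apply (p : ℂ[X]) (f : ℕ → ℂ) (N : ℕ) :
    aeval seqShift p f N = ∑ i ∈ Finset.range (p.natDegree + 1), p.coeff i * f (N + i) := by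
  rw [aeval_eq_sum_range]
  simp [LinearMap.sum_apply, seqShift_pow_apply]

theorem exists_norm_aeval_seqShift_le (p : ℂ[X]) {f : ℕ → ℂ} {K : ℝ} (hf : ∀ N, ‖f N‖ ≤ K) :
    ∃ K' : ℝ, ∀ N, ‖aeval seqShift p f N‖ ≤ K' := by
  refine ⟨∑ i ∈ Finset.range (p.natDegree + 1), ‖p.coeff i‖ * K, fun N => ?_⟩
  rw [aeval_seqShift_apply]
  refine (norm_sum_le _ _).trans (Finset.sum_le_sum fun i _ => ?_)
  rw [norm_mul]
  exact mul_le_mul_of_nonneg_left (hf _) (norm_nonneg _)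

theorem hasSum_aeval_seqShift {ι : Type*} (p : ℂ[X]) {U : ι → ℕ → ℂ} {m : ℕ → ℂ}
    (h : ∀ N, HasSum (fun σ => U σ N) (m N)) (N : ℕ) :
    HasSum (fun σ => aeval seqShift p (U σ) N) (aeval seqShift p m N) := by
  simp only [aeval_seqShift_apply]
  exact hasSum_sum fun i _ => (h (N + i)).mul_left _

theorem aeval_apply_of_apply_eq_smul {V : Type*} [AddCommGroup V] [Module ℂ V]
    {f : Module.End ℂ V} {v : V} {c : ℂ} (h : f v = c • v) (p : ℂ[X]) :
    aeval f p v = p.eval c • v := by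
  induction p using Polynomial.induction_on' with
  | add p q hp hq => rw [map_add, LinearMap.add_apply, hp, hq, eval_add, add_smul]
  | monomial k a =>
    have hk : ∀ k : ℕ, (f ^ k) v = c ^ k • v := by
      intro k
      induction k with
      | zero => simp
      | succ k ih => rw [pow_succ', Module.End.mul_apply, ih, map_smul, h, smul_smul, pow_succ]
    rw [aeval_monomial, Module.End.mul_apply, hk, eval_monomial, Module.algebraMap_end_apply,
      smul_smul]

/-- Conjugating by z ^ N turns shift - z into z times the forward difference. -/
theorem aeval_X_sub_C_pow_apply (z : ℂ) (g : ℂ → ℂ) (m : ℕ) :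
    aeval seqShift ((X - C z) ^ m) (fun N : ℕ => z ^ N * g N) =
      fun N : ℕ => z ^ (N + m) * (fwdDiff (1 : ℂ))^[m] g N := by
  induction m with
  | zero => simp
  | succ m ih =>
    rw [pow_succ', map_mul, Module.End.mul_apply, ih, Function.iterate_succ_apply']
    ext N
    simp only [map_sub, aeval_X, aeval_C, LinearMap.sub_apply, Pi.sub_apply, seqShift_apply,
      Module.algebraMap_end_apply, Pi.smul_apply, smul_eq_mul, fwdDiff]
    push_cast
    ring

theorem aeval_seqShift_eq_zero {p q : ℂ[X]} {z : ℂ} {m : ℕ} (hp : (X - C z) ^ m ∣ p)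
    (hq : q.natDegree < m) : aeval seqShift p (fun N : ℕ => z ^ N * q.eval (N : ℂ)) = 0 := by
  obtain ⟨r, rfl⟩ := hp
  rw [mul_comm, map_mul, Module.End.mul_apply, aeval_X_sub_C_pow_apply z (fun x => q.eval x),
    Polynomial.fwdDiff_iter_eq_zero_of_degree_lt hq]
  have : (fun N : ℕ => z ^ (N + m) * (0 : ℂ → ℂ) N) = 0 := by ext; simp
  rw [this, map_zero]

/-- The K-th difference of a polynomial of degree at most K is the constant K! times its K-th
coefficient. What remains is an eigenvector of the shift, on which r acts by evaluation. -/
theorem aeval_seqShift_top {r q : ℂ[X]} {z : ℂ} {K : ℕ} (hq : q.natDegree ≤ K) :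
    aeval seqShift ((X - C z) ^ K * r) (fun N : ℕ => z ^ N * q.eval (N : ℂ)) =
      fun N : ℕ => r.eval z * (K.factorial * z ^ K) * q.coeff K * z ^ N := by
  have h1 : aeval seqShift ((X - C z) ^ K) (fun N : ℕ => z ^ N * q.eval (N : ℂ)) =
      fun N : ℕ => (K.factorial * z ^ K * q.coeff K) * z ^ N := by
    rw [aeval_X_sub_C_pow_apply z (fun x => q.eval x)]
    rcases hq.lt_or_eq with h | h
    · rw [Polynomial.fwdDiff_iter_eq_zero_of_degree_lt h]
      ext N
      simp [coeff_eq_zero_of_natDegree_lt h]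
    · have := Polynomial.fwdDiff_iter_degree_eq_factorial q
      rw [h] at this
      rw [this]
      ext N
      simp only [Pi.smul_apply, Pi.natCast_apply, smul_eq_mul, leadingCoeff, h]
      ring
  rw [mul_comm, map_mul, Module.End.mul_apply, h1,
    aeval_apply_of_apply_eq_smul (c := z) (by ext N; simp [pow_succ]; ring)]
  ext N
  simp only [Pi.smul_apply, smul_eq_mul]
  ring

/-- Resonance: forcing at the eigenvalue z makes H grow like N ‖κ‖. The closed form is multiplied by
z to avoid the exponent N - 1. -/
theorem eq_zero_of_bounded_of_sub_eq {H : ℕ → ℂ} {K : ℝ} (hH : ∀ N, ‖H N‖ ≤ K) {z κ : ℂ}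
    (hz : ‖z‖ = 1) (h : ∀ N, H (N + 1) - z * H N = κ * z ^ N) : κ = 0 := by
  have h1 : ∀ N : ℕ, z * H N = z ^ N * (z * H 0 + N * κ) := by
    intro N
    induction N with
    | zero => simp
    | succ N ih =>
      have := h N
      rw [sub_eq_iff_eq_add] at this
      rw [this, ih]
      push_cast
      ring
  by_contra hκ
  have hκ' : 0 < ‖κ‖ := norm_pos_iff.2 hκ
  obtain ⟨N, hN⟩ := exists_nat_gt ((K + K) / ‖κ‖)
  rw [div_lt_iff₀ hκ'] at hN
  have h2 := congrArg norm (h1 N)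
  rw [norm_mul, norm_mul, norm_pow, hz, one_pow, one_mul, one_mul] at h2
  have h3 : ‖(N : ℂ) * κ‖ ≤ ‖z * H 0 + N * κ‖ + ‖z * H 0‖ := by
    have := norm_sub_le (z * H 0 + N * κ) (z * H 0)
    rwa [add_sub_cancel_left] at this
  rw [← h2, norm_mul, norm_mul, hz, one_mul, Complex.norm_natCast] at h3
  linarith [hH N, hH 0]

theorem eq_zero_of_bounded_geometric {G : ℕ → ℂ} {K : ℝ} (hG : ∀ N, ‖G N‖ ≤ K) {z κ : ℂ}
    (hz : 1 < ‖z‖) (h : ∀ N, G N = κ * z ^ N) : κ = 0 := by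
  by_contra hκ
  have hκ' : 0 < ‖κ‖ := norm_pos_iff.2 hκ
  obtain ⟨N, hN⟩ := pow_unbounded_of_one_lt (K / ‖κ‖) hz
  rw [div_lt_iff₀ hκ'] at hN
  have := hG N
  rw [h N, norm_mul, norm_pow] at this
  linarith

/-- A polynomial in the shift that annihilates a bounded sequence up to a term `κ z ^ N` with
`z` outside the closed unit disc, or `z` on the unit circle and the polynomial divisible by
`X - z`, shows that `κ = 0`. -/
theorem eq_zero_of_bounded_of_aeval {m : ℕ → ℂ} {M : ℝ} (hm : ∀ N, ‖m N‖ ≤ M) {r : ℂ[X]} {z κ : ℂ}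
    {K : ℕ} (hz : 1 < ‖z‖ ∨ (‖z‖ = 1 ∧ K ≠ 0))
    (h : ∀ N, aeval seqShift ((X - C z) ^ K * r) m N = κ * z ^ N) : κ = 0 := by
  rcases hz with hz | ⟨hz, hK⟩
  · obtain ⟨K', hK'⟩ := exists_norm_aeval_seqShift_le ((X - C z) ^ K * r) hm
    exact eq_zero_of_bounded_geometric hK' hz h
  · obtain ⟨k, rfl⟩ := Nat.exists_eq_succ_of_ne_zero hK
    obtain ⟨K', hK'⟩ := exists_norm_aeval_seqShift_le ((X - C z) ^ k * r) hm
    refine eq_zero_of_bounded_of_sub_eq hK' hz fun N => ?_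
    rw [← h N, Nat.succ_eq_add_one, pow_succ', mul_assoc, map_mul _ (X - C z), Module.End.mul_apply]
    simp

end ShiftOperator

/-! ### Window moments of exponential polynomials -/

section ExponentialSequences

open Polynomial

/-- The moments `∫₀ᵀ (t + N T) ^ k e ^ (w (t + N T)) g(t) dt` of an exponential polynomial over the
consecutive windows of length `T`. -/
noncomputable def windowMoment (T : ℝ) (k : ℕ) (w : ℂ) (g : ℝ → ℂ) (N : ℕ) : ℂ :=
  ∫ t in (0 : ℝ)..T, ((t : ℂ) + N * T) ^ k * Complex.exp (w * (t + N * T)) * g t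

/-- Expand (t + NT)^k by the binomial theorem in powers of N. Only the top power is free of t, so
its coefficient involves the plain exponential integral. -/
theorem windowMoment_eq (T : ℝ) (k : ℕ) (w : ℂ) {g : ℝ → ℂ} (hg : Continuous g) :
    ∃ q : ℂ[X], q.natDegree ≤ k ∧
      q.coeff k = (T : ℂ) ^ k * ∫ t in (0 : ℝ)..T, Complex.exp (w * t) * g t ∧
      windowMoment T k w g = fun N : ℕ => Complex.exp (w * T) ^ N * q.eval (N : ℂ) := by
  set c : ℕ → ℂ := fun j => (T : ℂ) ^ j * (k.choose j) *
    ∫ t in (0 : ℝ)..T, (t : ℂ) ^ (k - j) * (Complex.exp (w * t) * g t) with hc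
  refine ⟨∑ j ∈ Finset.range (k + 1), Polynomial.C (c j) * X ^ j, ?_, ?_, ?_⟩
  · refine natDegree_sum_le_of_forall_le _ _ fun j hj => ?_
    exact (natDegree_C_mul_X_pow_le _ _).trans (Nat.lt_succ_iff.1 (Finset.mem_range.1 hj))
  · rw [finsetSum_coeff]
    simp only [coeff_C_mul_X_pow]
    rw [Finset.sum_eq_single k]
    · simp [hc]
    · intro j _ hj; rw [if_neg (Ne.symm hj)]
    · intro h; simp at h
  · ext N
    have h1 : ∀ t : ℝ, ((t : ℂ) + N * T) ^ k * Complex.exp (w * (t + N * T)) * g t =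
        ∑ j ∈ Finset.range (k + 1), Complex.exp (w * T) ^ N * ((N : ℂ) ^ j *
          ((T : ℂ) ^ j * (k.choose j) * ((t : ℂ) ^ (k - j) * (Complex.exp (w * t) * g t)))) := by
      intro t
      have e : Complex.exp (w * (t + N * T)) = Complex.exp (w * t) * Complex.exp (w * T) ^ N := by
        rw [← Complex.exp_nat_mul, ← Complex.exp_add]
        congr 1; ring
      rw [e, add_comm (t : ℂ), add_pow, Finset.sum_mul, Finset.sum_mul]
      refine Finset.sum_congr rfl fun j _ => ?_
      rw [mul_pow]
      ring
    rw [windowMoment]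
    simp only [h1]
    rw [intervalIntegral.integral_finsetSum]
    · simp only [intervalIntegral.integral_const_mul]
      rw [eval_finsetSum, Finset.mul_sum]
      refine Finset.sum_congr rfl fun j _ => ?_
      simp only [hc, eval_mul, eval_C, eval_pow, eval_X]
      ring
    · intro j _
      exact Continuous.intervalIntegrable (by fun_prop) _ _

/-- Equal multipliers mean that (w - w₀)T is in 2πiℤ, so this is the orthogonality of characters
over one period. -/
theorem integral_exp_mul_exp_neg {T : ℝ} {w w0 : ℂ}
    (h : Complex.exp (w * T) = Complex.exp (w0 * T)) (Γ : ℂ) :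
    ∫ t in (0 : ℝ)..T, Complex.exp (w * t) * (Γ * Complex.exp (-(w0 * t))) =
      if w = w0 then T * Γ else 0 := by
  have e : ∀ t : ℝ, Complex.exp (w * t) * (Γ * Complex.exp (-(w0 * t))) =
      Γ * Complex.exp ((w - w0) * t) := by
    intro t
    rw [mul_left_comm, ← Complex.exp_add]
    congr 2; ring
  simp only [e]
  rw [intervalIntegral.integral_const_mul]
  split_ifs with hw
  · simp [hw, mul_comm]
  · rw [integral_exp_mul_complex (sub_ne_zero.2 hw), sub_mul, Complex.exp_sub, h,
      div_self (Complex.exp_ne_zero _)]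
    simp

/-- The factor r kills every multiplier other than e^{w₀T}, and (X - e^{w₀T})^K kills degrees below
K at that multiplier. Exponents sharing the multiplier in degree K are separated by orthogonality.
-/
theorem aeval_windowMoment {T : ℝ} {w w0 : ℂ} (Γ : ℂ) {k K d : ℕ} {r : ℂ[X]}
    (hk : k < d) (hr : Complex.exp (w * T) ≠ Complex.exp (w0 * T) →
      (X - C (Complex.exp (w * T))) ^ d ∣ r)
    (hkK : Complex.exp (w * T) = Complex.exp (w0 * T) → k ≤ K) (N : ℕ) :
    aeval seqShift ((X - C (Complex.exp (w0 * T))) ^ K * r)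
      (windowMoment T k w fun t => Γ * Complex.exp (-(w0 * t))) N =
      if w = w0 ∧ k = K then r.eval (Complex.exp (w0 * T)) *
        (K.factorial * Complex.exp (w0 * T) ^ K) * (T ^ K * (T * Γ)) * Complex.exp (w0 * T) ^ N
      else 0 := by
  obtain ⟨q, hq, hqk, hU⟩ := windowMoment_eq T k w
    (g := fun t => Γ * Complex.exp (-(w0 * t))) (by fun_prop)
  rw [hU]
  by_cases hz : Complex.exp (w * T) = Complex.exp (w0 * T)
  · rw [hz, aeval_seqShift_top (hq.trans (hkK hz))]
    rcases (hkK hz).lt_or_eq with h | h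
    · rw [if_neg (by omega), coeff_eq_zero_of_natDegree_lt (hq.trans_lt h)]
      simp
    · subst h
      rw [hqk, integral_exp_mul_exp_neg hz]
      by_cases hw : w = w0 <;> simp [hw]
  · rw [aeval_seqShift_eq_zero ((hr hz).mul_left _) (hq.trans_lt hk), if_neg]
    · rfl
    · rintro ⟨rfl, -⟩; exact hz rfl

end ExponentialSequences

/-! ### Every expansion has the same growth component -/

section GrowthComponent

open Polynomial
open scoped ENNReal

variable {n : ℕ}

theorem modeTerm_apply (C D : ℝ × ℝ × ℕ → Mat n) (σ : ℝ × ℝ × ℕ) (t : ℝ) (i j : Fin n) :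
    modeTerm C D σ t i j = (t ^ σ.2.2 * Real.exp (σ.1 * t)) *
      (Real.cos (σ.2.1 * t) * C σ i j + Real.sin (σ.2.1 * t) * D σ i j) := rfl

theorem continuous_modeTerm (C D : ℝ × ℝ × ℕ → Mat n) (σ : ℝ × ℝ × ℕ) (i j : Fin n) :
    Continuous fun t => modeTerm C D σ t i j := by
  simp only [modeTerm_apply]
  fun_prop

/-- On a bounded interval the L² norm controls the L¹ norm, and ψ is bounded, so unconditional
convergence passes to the integrals. -/
theorem HasL2Sum.hasSum_integral {S : Set (ℝ × ℝ × ℕ)} {C D : ℝ × ℝ × ℕ → Mat n} {M : ℝ → Mat n}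
    (h : HasL2Sum S C D M)
    (hM : ∀ a b i j, IntervalIntegrable (fun t => M t i j) volume a b)
    {a b : ℝ} (hab : a ≤ b) {ψ : ℝ → ℂ} (hψ : Continuous ψ) (i j : Fin n) :
    HasSum (fun σ : S => ∫ t in a..b, (modeTerm C D σ t i j : ℂ) * ψ t)
      (∫ t in a..b, (M t i j : ℂ) * ψ t) := by
  obtain ⟨K, hK⟩ := isCompact_Icc.exists_bound_of_continuousOn (s := Icc a b) hψ.continuousOn
  set R : ℝ := max |a| |b| + 1 with hR
  have hR0 : 0 < R := by positivity
  have hsub : Ioc a b ⊆ Icc (-R) R := by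
    intro t ht
    have h1 := abs_le.1 (le_max_left |a| |b|)
    have h2 := abs_le.1 (le_max_right |a| |b|)
    exact ⟨by linarith [ht.1, h1.1], by linarith [ht.2, h2.2]⟩
  have hterm : ∀ σ : S, IntervalIntegrable (fun t => (modeTerm C D σ t i j : ℂ) * ψ t) volume a b :=
    fun σ => ((Complex.continuous_ofReal.comp (continuous_modeTerm C D σ i j)).mul
      hψ).intervalIntegrable _ _
  have hMc : IntervalIntegrable (fun t => (M t i j : ℂ) * ψ t) volume a b :=
    IntervalIntegrable.mul_continuousOn (by
      have := hM a b i j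
      rw [intervalIntegrable_iff] at this ⊢
      exact this.ofReal) hψ.continuousOn
  set F : Finset S → ℝ → ℝ := fun s t => M t i j - ∑ σ ∈ s, modeTerm C D σ.1 t i j with hF
  have hdiff : ∀ s : Finset S, (∑ σ ∈ s, ∫ t in a..b, (modeTerm C D σ t i j : ℂ) * ψ t) -
      ∫ t in a..b, (M t i j : ℂ) * ψ t = -∫ t in a..b, (F s t : ℂ) * ψ t := by
    intro s
    rw [← intervalIntegral.integral_finsetSum fun σ _ => hterm σ, ← intervalIntegral.integral_sub
      ?_ hMc, ← intervalIntegral.integral_neg]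
    · refine intervalIntegral.integral_congr fun t _ => ?_
      simp only [hF, Complex.ofReal_sub, Complex.ofReal_sum, sub_mul, Finset.sum_mul]
      ring
    · exact intervalIntegrable_iff.2 (integrable_finsetSum _ fun σ _ =>
        intervalIntegrable_iff.1 (hterm σ))
  have hFm : ∀ s, AEStronglyMeasurable (F s) (volume.restrict (Ioc a b)) := by
    intro s
    have h1 := (hM a b i j).aestronglyMeasurable
    exact h1.sub (continuous_finsetSum _ fun σ _ => continuous_modeTerm C D σ.1 i j).aestronglyMeasurable
  set c : ℝ≥0∞ := volume.restrict (Ioc a b) univ ^ (1 / (1 : ℝ≥0∞).toReal - 1 / (2 : ℝ≥0∞).toReal)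
    with hc
  have hcfin : c ≠ ∞ := by
    rw [hc, Measure.restrict_apply_univ, Real.volume_Ioc]
    exact ENNReal.rpow_ne_top_of_nonneg (by norm_num) ENNReal.ofReal_ne_top
  have hbound : ∀ s, ‖∫ t in a..b, (F s t : ℂ) * ψ t‖ₑ ≤
      ENNReal.ofReal K * (eLpNorm (F s) 2 (volume.restrict (Icc (-R) R)) * c) := by
    intro s
    rw [intervalIntegral.integral_of_le hab]
    calc ‖∫ t in Ioc a b, (F s t : ℂ) * ψ t‖ₑ ≤ ∫⁻ t in Ioc a b, ‖(F s t : ℂ) * ψ t‖ₑ :=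
          enorm_integral_le_lintegral_enorm _
      _ ≤ ∫⁻ t in Ioc a b, ENNReal.ofReal K * ‖F s t‖ₑ := by
          refine setLIntegral_mono_ae' measurableSet_Ioc (ae_of_all _ fun t ht => ?_)
          rw [enorm_mul, mul_comm]
          refine mul_le_mul' ?_ ?_
          · rw [← ofReal_norm]
            exact ENNReal.ofReal_le_ofReal (hK t (Ioc_subset_Icc_self ht))
          · rw [← ofReal_norm, ← ofReal_norm, Complex.norm_real]
      _ = ENNReal.ofReal K * eLpNorm (F s) 1 (volume.restrict (Ioc a b)) := by
          rw [lintegral_const_mul' _ _ ENNReal.ofReal_ne_top, eLpNorm_one_eq_lintegral_enorm]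
      _ ≤ ENNReal.ofReal K * (eLpNorm (F s) 2 (volume.restrict (Ioc a b)) * c) := by
          gcongr
          exact eLpNorm_le_eLpNorm_mul_rpow_measure_univ (by norm_num) (hFm s)
      _ ≤ _ := by
          gcongr
  have hlim : Tendsto (fun s : Finset S => ENNReal.ofReal K *
      (eLpNorm (F s) 2 (volume.restrict (Icc (-R) R)) * c)) atTop (𝓝 0) := by
    have h1 := ENNReal.Tendsto.mul_const (b := c) (h R hR0 i j) (Or.inr hcfin)
    have h2 := ENNReal.Tendsto.const_mul (a := ENNReal.ofReal K) h1 (Or.inr ENNReal.ofReal_ne_top)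
    simpa using h2
  rw [HasSum, SummationFilter.unconditional_filter, tendsto_iff_edist_tendsto_0]
  refine tendsto_of_tendsto_of_tendsto_of_le_of_le tendsto_const_nhds hlim (fun _ => zero_le)
    fun s => ?_
  simp only [edist_eq_enorm_sub, hdiff, enorm_neg]
  exact hbound s

/-- The complex amplitude of `e ^ (a + i b) t` in a real mode. -/
noncomputable def amplitude (C D : ℝ × ℝ × ℕ → Mat n) (i j : Fin n) (σ : ℝ × ℝ × ℕ) : ℂ :=
  (C σ i j - D σ i j * Complex.I) / 2

theorem ofReal_modeTerm (C D : ℝ × ℝ × ℕ → Mat n) (σ : ℝ × ℝ × ℕ) (t : ℝ) (i j : Fin n) :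
    (modeTerm C D σ t i j : ℂ) = (t : ℂ) ^ σ.2.2 *
      (amplitude C D i j σ * Complex.exp ((σ.1 + σ.2.1 * Complex.I) * t) +
        amplitude C (-D) i j σ * Complex.exp ((σ.1 - σ.2.1 * Complex.I) * t)) := by
  have e1 : Complex.exp ((σ.1 + σ.2.1 * Complex.I) * t) =
      Complex.exp (σ.1 * t) * Complex.exp (σ.2.1 * t * Complex.I) := by
    rw [← Complex.exp_add]; congr 1; ring
  have e2 : Complex.exp ((σ.1 - σ.2.1 * Complex.I) * t) =
      Complex.exp (σ.1 * t) * Complex.exp (-(σ.2.1 * t) * Complex.I) := by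
    rw [← Complex.exp_add]; congr 1; ring
  rw [modeTerm_apply, e1, e2]
  push_cast
  rw [Complex.cos, Complex.sin]
  simp only [amplitude, Pi.neg_apply, Matrix.neg_apply, Complex.ofReal_neg]
  ring

/-- The moments over consecutive windows of the entry of `M`, against `e ^ (-w₀ t)`. -/
noncomputable def entryMoment (M : ℝ → Mat n) (T : ℝ) (w0 : ℂ) (i j : Fin n) (N : ℕ) : ℂ :=
  ∫ t in (0 : ℝ)..T, (M (t + N * T) i j : ℂ) * Complex.exp (-(w0 * t))

theorem HasL2Sum.hasSum_entryMoment {S : Set (ℝ × ℝ × ℕ)} {C D : ℝ × ℝ × ℕ → Mat n}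
    {M : ℝ → Mat n} (h : HasL2Sum S C D M)
    (hM : ∀ a b i j, IntervalIntegrable (fun t => M t i j) volume a b) {T : ℝ} (hT : 0 < T)
    (w0 : ℂ) (i j : Fin n) (N : ℕ) :
    HasSum (fun σ : S => entryMoment (modeTerm C D σ) T w0 i j N) (entryMoment M T w0 i j N) := by
  have key := h.hasSum_integral hM (a := 0 + N * T) (b := T + N * T) (by linarith)
    (ψ := fun t => Complex.exp (-(w0 * ((t : ℂ) - N * T)))) (by fun_prop) i j
  simp only [← intervalIntegral.integral_comp_add_right] at key
  have e : ∀ x : ℝ, ((x + N * T : ℝ) : ℂ) - N * T = x := fun x => by push_cast; ring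
  simp only [e] at key
  exact key

theorem entryMoment_modeTerm (C D : ℝ × ℝ × ℕ → Mat n) (T : ℝ) (w0 : ℂ) (i j : Fin n)
    (σ : ℝ × ℝ × ℕ) :
    entryMoment (modeTerm C D σ) T w0 i j =
      windowMoment T σ.2.2 (σ.1 + σ.2.1 * Complex.I)
        (fun t => amplitude C D i j σ * Complex.exp (-(w0 * t))) +
      windowMoment T σ.2.2 (σ.1 - σ.2.1 * Complex.I)
        (fun t => amplitude C (-D) i j σ * Complex.exp (-(w0 * t))) := by
  ext N
  simp only [entryMoment, windowMoment, Pi.add_apply]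
  rw [← intervalIntegral.integral_add (Continuous.intervalIntegrable (by fun_prop) _ _)
    (Continuous.intervalIntegrable (by fun_prop) _ _)]
  refine intervalIntegral.integral_congr fun t _ => ?_
  simp only [ofReal_modeTerm]
  push_cast
  ring

/-- The amplitude that the mode `σ` contributes to the frequency `e ^ (a + i b) t`, `b ≥ 0`. -/
noncomputable def frequencyAmplitude (C D : ℝ × ℝ × ℕ → Mat n) (i j : Fin n) (σ : ℝ × ℝ × ℕ) : ℂ :=
  amplitude C D i j σ + if σ.2.1 = 0 then amplitude C (-D) i j σ else 0

theorem frequencyAmplitude_of_eq_zero {C D : ℝ × ℝ × ℕ → Mat n} {i j : Fin n} {σ : ℝ × ℝ × ℕ}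
    (hσ : σ.2.1 = 0) : frequencyAmplitude C D i j σ = C σ i j := by
  rw [frequencyAmplitude, if_pos hσ, amplitude, amplitude]
  simp only [Pi.neg_apply, Matrix.neg_apply, Complex.ofReal_neg]
  ring

/-- For b = 0 the sine vanishes identically and D is undetermined, so the conclusion concerns the
function and not the coefficients. -/
theorem modeTerm_eq_zero_of_frequencyAmplitude {C D : ℝ × ℝ × ℕ → Mat n} {i j : Fin n}
    {σ : ℝ × ℝ × ℕ} (h : frequencyAmplitude C D i j σ = 0) (t : ℝ) :
    modeTerm C D σ t i j = 0 := by
  rw [modeTerm_apply]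
  by_cases hb : σ.2.1 = 0
  · rw [frequencyAmplitude_of_eq_zero hb, Complex.ofReal_eq_zero] at h
    simp [hb, h]
  · rw [frequencyAmplitude, if_neg hb, add_zero, amplitude, div_eq_zero_iff] at h
    have h' := h.resolve_right two_ne_zero
    have hre := congrArg Complex.re h'
    have him := congrArg Complex.im h'
    simp at hre him
    simp [hre, him]

-- A real mode is a pair of complex ones with exponents a ± ib, and each is filtered separately.
-- Modes with the same a and degree above K would survive the filter, so `hnull` requires them to
-- vanish.
open scoped Classical in
theorem aeval_entryMoment_modeTerm {C D : ℝ × ℝ × ℕ → Mat n} {T : ℝ} (hT : 0 < T) {i j : Fin n}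
    {a0 b0 : ℝ} (hb0 : 0 ≤ b0) {K d : ℕ} {r : ℂ[X]} {σ : ℝ × ℝ × ℕ} (hb : 0 ≤ σ.2.1)
    (hk : σ.2.2 < d)
    (hr1 : Complex.exp ((σ.1 + σ.2.1 * Complex.I) * T) ≠ Complex.exp ((a0 + b0 * Complex.I) * T) →
      (X - Polynomial.C (Complex.exp ((σ.1 + σ.2.1 * Complex.I) * T))) ^ d ∣ r)
    (hr2 : Complex.exp ((σ.1 - σ.2.1 * Complex.I) * T) ≠ Complex.exp ((a0 + b0 * Complex.I) * T) →
      (X - Polynomial.C (Complex.exp ((σ.1 - σ.2.1 * Complex.I) * T))) ^ d ∣ r)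
    (hnull : σ.1 = a0 → K < σ.2.2 → ∀ t, modeTerm C D σ t i j = 0) (N : ℕ) :
    aeval seqShift ((X - Polynomial.C (Complex.exp ((a0 + b0 * Complex.I) * T))) ^ K * r)
      (entryMoment (modeTerm C D σ) T (a0 + b0 * Complex.I) i j) N =
      if σ = (a0, b0, K) then r.eval (Complex.exp ((a0 + b0 * Complex.I) * T)) *
        (K.factorial * Complex.exp ((a0 + b0 * Complex.I) * T) ^ K) *
        (T ^ K * (T * frequencyAmplitude C D i j σ)) *
        Complex.exp ((a0 + b0 * Complex.I) * T) ^ N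
      else 0 := by
  by_cases hbad : σ.1 = a0 ∧ K < σ.2.2
  · have h0 : entryMoment (modeTerm C D σ) T (a0 + b0 * Complex.I) i j = 0 := by
      ext N
      simp [entryMoment, hnull hbad.1 hbad.2]
    rw [h0, map_zero, if_neg]
    · rfl
    · rintro rfl
      exact lt_irrefl _ hbad.2
  -- Comparing moduli, a common multiplier forces the same real exponent a₀.
  · have hre : ∀ w : ℂ, w.re = σ.1 →
        Complex.exp (w * T) = Complex.exp ((a0 + b0 * Complex.I) * T) → σ.2.2 ≤ K := by
      intro w hw h
      by_contra hlt
      push Not at hlt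
      refine hbad ⟨?_, hlt⟩
      have := congrArg norm h
      rw [Complex.norm_exp, Complex.norm_exp, Real.exp_eq_exp] at this
      simp [hw] at this
      exact this.resolve_right hT.ne'
    rw [entryMoment_modeTerm, map_add, Pi.add_apply,
      aeval_windowMoment _ hk hr1 (hre _ (by simp)), aeval_windowMoment _ hk hr2 (hre _ (by simp))]
    obtain ⟨a, b, k⟩ := σ
    simp only at *
    have c1 : ((a : ℂ) + b * Complex.I = a0 + b0 * Complex.I ∧ k = K) ↔
        ((a, b, k) : ℝ × ℝ × ℕ) = (a0, b0, K) := by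
      simp [Complex.ext_iff, and_assoc]
    -- Both frequencies are nonnegative, so -b = b₀ only when both vanish.
    have c2 : ((a : ℂ) - b * Complex.I = a0 + b0 * Complex.I ∧ k = K) ↔
        (((a, b, k) : ℝ × ℝ × ℕ) = (a0, b0, K) ∧ b = 0) := by
      simp only [Complex.ext_iff, Prod.mk.injEq]
      simp
      constructor
      · rintro ⟨⟨h1, h2⟩, h3⟩
        have : b = 0 := by linarith
        exact ⟨⟨h1, by linarith, h3⟩, this⟩
      · rintro ⟨⟨h1, h2, h3⟩, h4⟩
        exact ⟨⟨h1, by linarith⟩, h3⟩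
    simp only [c1, c2, frequencyAmplitude]
    by_cases h1 : ((a, b, k) : ℝ × ℝ × ℕ) = (a0, b0, K)
    · by_cases h2 : b = 0
      · rw [if_pos h1, if_pos ⟨h1, h2⟩, if_pos h1, if_pos h2]; ring
      · simp only [h1, h2, if_true, if_false, and_false]; ring
    · simp only [h1, if_false, false_and, add_zero]

/-- Over a period 2π/ω the frequencies θ + lω all have the multiplier of θ. Infinitely many modes
thus share finitely many multipliers, which is what makes a polynomial annihilator possible. -/
theorem exists_multiplier_finset {ω : ℝ} (hω : 0 < ω) {S : Set (ℝ × ℝ × ℕ)} {C D : ℝ × ℝ × ℕ → Mat n}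
    {M : ℝ → Mat n} (h : IsExpansion ω M S C D) :
    ∃ Z : Finset ℂ, ∀ σ ∈ S,
      Complex.exp ((σ.1 + σ.2.1 * Complex.I) * (2 * Real.pi / ω : ℝ)) ∈ Z ∧
      Complex.exp ((σ.1 - σ.2.1 * Complex.I) * (2 * Real.pi / ω : ℝ)) ∈ Z := by
  classical
  obtain ⟨Θ, hΘ⟩ := h.frequency_mem
  set Q := h.exponent_finite.toFinset ×ˢ Θ with hQ
  have hωc : (ω : ℂ) ≠ 0 := by exact_mod_cast hω.ne'
  refine ⟨Q.image (fun p => Complex.exp ((p.1 + p.2 * Complex.I) * (2 * Real.pi / ω : ℝ))) ∪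
    Q.image (fun p => Complex.exp ((p.1 - p.2 * Complex.I) * (2 * Real.pi / ω : ℝ))),
    fun σ hσ => ?_⟩
  obtain ⟨θ, hθ, l, hl⟩ := hΘ σ hσ
  have hmem : (σ.1, θ) ∈ Q := by
    rw [hQ, Finset.mem_product]
    exact ⟨h.exponent_finite.mem_toFinset.2 (mem_image_of_mem _ hσ), hθ⟩
  refine ⟨Finset.mem_union_left _ (Finset.mem_image.2 ⟨(σ.1, θ), hmem, ?_⟩),
    Finset.mem_union_right _ (Finset.mem_image.2 ⟨(σ.1, θ), hmem, ?_⟩)⟩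
  · refine Complex.exp_eq_exp_iff_exists_int.2 ⟨-l, ?_⟩
    simp only [hl]
    push_cast
    field_simp
    ring
  · refine Complex.exp_eq_exp_iff_exists_int.2 ⟨l, ?_⟩
    simp only [hl]
    push_cast
    field_simp
    ring

-- Take for r the product of high powers of X - z over all multipliers z other than the chosen one.
-- Applied termwise to the moments, the filter leaves only the mode (a₀, b₀, K). The value of κ for
-- K = 0 serves to identify the constant mode.
open scoped Classical in
theorem exists_extraction {ω : ℝ} (hω : 0 < ω) {S : Set (ℝ × ℝ × ℕ)} {C D : ℝ × ℝ × ℕ → Mat n}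
    {M : ℝ → Mat n} (h : IsExpansion ω M S C D)
    (hM : ∀ a b i j, IntervalIntegrable (fun t => M t i j) volume a b) {i j : Fin n}
    {a0 b0 : ℝ} (hb0 : 0 ≤ b0) {K : ℕ}
    (hnull : ∀ σ ∈ S, σ.1 = a0 → K < σ.2.2 → ∀ t, modeTerm C D σ t i j = 0) :
    ∃ (r : ℂ[X]) (κ : ℂ), r.eval (Complex.exp ((a0 + b0 * Complex.I) * (2 * Real.pi / ω : ℝ))) ≠ 0 ∧
      κ ≠ 0 ∧ (K = 0 → κ = (2 * Real.pi / ω : ℝ) *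
        r.eval (Complex.exp ((a0 + b0 * Complex.I) * (2 * Real.pi / ω : ℝ)))) ∧
      ∀ N, aeval seqShift ((X - Polynomial.C
          (Complex.exp ((a0 + b0 * Complex.I) * (2 * Real.pi / ω : ℝ)))) ^ K * r)
        (entryMoment M (2 * Real.pi / ω) (a0 + b0 * Complex.I) i j) N =
        (κ * if (a0, b0, K) ∈ S then frequencyAmplitude C D i j (a0, b0, K) else 0) *
          Complex.exp ((a0 + b0 * Complex.I) * (2 * Real.pi / ω : ℝ)) ^ N := by
  obtain ⟨Z, hZ⟩ := exists_multiplier_finset hω h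
  have hT : 0 < 2 * Real.pi / ω := by positivity
  set T : ℝ := 2 * Real.pi / ω with hTdef
  set z0 := Complex.exp ((a0 + b0 * Complex.I) * T) with hz0
  have hz0' : z0 ≠ 0 := Complex.exp_ne_zero _
  -- Degrees are at most 2n - 2, hence below 2n, since the index i forces n > 0.
  set r : ℂ[X] := ∏ z ∈ Z.erase z0, (X - Polynomial.C z) ^ (2 * n) with hr
  have hrd : ∀ z ∈ Z, z ≠ z0 → (X - Polynomial.C z) ^ (2 * n) ∣ r := fun z hz hne =>
    Finset.dvd_prod_of_mem (fun z => (X - Polynomial.C z) ^ (2 * n)) (Finset.mem_erase.2 ⟨hne, hz⟩)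
  have hr0 : r.eval z0 ≠ 0 := by
    rw [hr, eval_prod, Finset.prod_ne_zero_iff]
    intro z hz
    rw [eval_pow, eval_sub, eval_X, eval_C]
    exact pow_ne_zero _ (sub_ne_zero.2 (Finset.ne_of_mem_erase hz).symm)
  have hTc : (T : ℂ) ≠ 0 := by exact_mod_cast hT.ne'
  have hn : 0 < n := i.pos
  refine ⟨r, r.eval z0 * (K.factorial * z0 ^ K) * (T ^ K * T), hr0, ?_, ?_, fun N => ?_⟩
  · have : (K.factorial : ℂ) ≠ 0 := by exact_mod_cast K.factorial_ne_zero
    exact mul_ne_zero (mul_ne_zero hr0 (mul_ne_zero this (pow_ne_zero _ hz0')))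
      (mul_ne_zero (pow_ne_zero _ hTc) hTc)
  · rintro rfl
    simp [mul_comm]
  · have hsum := hasSum_aeval_seqShift ((X - Polynomial.C z0) ^ K * r)
      (fun N => h.hasSum.hasSum_entryMoment hM hT (a0 + b0 * Complex.I) i j N) N
    have hterm : ∀ σ : S, aeval seqShift ((X - Polynomial.C z0) ^ K * r)
        (entryMoment (modeTerm C D σ) T (a0 + b0 * Complex.I) i j) N =
        if σ.1 = (a0, b0, K) then r.eval z0 * (K.factorial * z0 ^ K) *
          (T ^ K * (T * frequencyAmplitude C D i j σ)) * z0 ^ N else 0 := fun σ =>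
      aeval_entryMoment_modeTerm hT hb0 (h.frequency_nonneg σ σ.2) (d := 2 * n)
        (by have := h.degree_le σ σ.2; omega) (hrd _ (hZ σ σ.2).1) (hrd _ (hZ σ σ.2).2)
        (hnull σ σ.2) N
    simp only [hterm] at hsum
    by_cases hmem : ((a0, b0, K) : ℝ × ℝ × ℕ) ∈ S
    · have h1 := hasSum_single (f := fun σ : S => if σ.1 = (a0, b0, K) then
          r.eval z0 * (K.factorial * z0 ^ K) *
          (T ^ K * (T * frequencyAmplitude C D i j σ)) * z0 ^ N else 0) ⟨(a0, b0, K), hmem⟩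
          (fun σ hσ => if_neg fun h => hσ (Subtype.ext h))
      rw [hsum.unique h1, if_pos hmem]
      simp only [if_true]
      ring
    · have h1 : (fun σ : S => if σ.1 = (a0, b0, K) then
          r.eval z0 * (K.factorial * z0 ^ K) *
          (T ^ K * (T * frequencyAmplitude C D i j σ)) * z0 ^ N else 0) = fun _ => 0 := by
        ext σ
        rw [if_neg]
        intro h
        exact hmem (h ▸ σ.2)
      rw [h1] at hsum
      rw [hsum.unique hasSum_zero, if_neg hmem]
      ring

theorem exists_norm_entryMoment_le {M : ℝ → Mat n} (hM : UniformlyBounded M) {T : ℝ} (hT : 0 < T)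
    (w0 : ℂ) (i j : Fin n) : ∃ K : ℝ, ∀ N, ‖entryMoment M T w0 i j N‖ ≤ K := by
  obtain ⟨K, hK⟩ := hM
  obtain ⟨L, hL⟩ := isCompact_Icc.exists_bound_of_continuousOn (s := Icc 0 T)
    (f := fun t : ℝ => Complex.exp (-(w0 * t))) (by fun_prop)
  have hL0 : 0 ≤ L := (norm_nonneg _).trans (hL 0 ⟨le_rfl, hT.le⟩)
  refine ⟨(|K| * L) * |T - 0|, fun N => ?_⟩
  refine intervalIntegral.norm_integral_le_of_norm_le_const_ae ?_
  have h1 := (measurePreserving_add_right volume ((N : ℝ) * T)).quasiMeasurePreserving.ae hK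
  filter_upwards [h1] with t ht hmem
  rw [uIoc_of_le hT.le] at hmem
  rw [norm_mul, Complex.norm_real]
  have h2 : 0 ≤ t + N * T := by have := hmem.1; positivity
  exact mul_le_mul ((ht h2 i j).trans (le_abs_self K)) (hL t (Ioc_subset_Icc_self hmem))
    (norm_nonneg _) (abs_nonneg _)

/-- Downward induction on the degree. Once the higher degrees at a₀ vanish, the mode can be
extracted, and bounded moments exclude an amplitude at ‖z‖ > 1, or at ‖z‖ = 1 with K ≠ 0. -/
theorem IsExpansion.modeTerm_eq_zero {ω : ℝ} (hω : 0 < ω) {S : Set (ℝ × ℝ × ℕ)}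
    {C D : ℝ × ℝ × ℕ → Mat n} {M : ℝ → Mat n} (h : IsExpansion ω M S C D)
    (hM : ∀ a b i j, IntervalIntegrable (fun t => M t i j) volume a b) (hMb : UniformlyBounded M)
    {σ : ℝ × ℝ × ℕ} (hσ : σ ∈ S) (hg : 0 < σ.1 ∨ (σ.1 = 0 ∧ σ.2.2 ≠ 0)) (i j : Fin n) (t : ℝ) :
    modeTerm C D σ t i j = 0 := by
  have hT : 0 < 2 * Real.pi / ω := by positivity
  -- m measures the distance of the degree from 2n; the case m = 0 is void by the degree bound.
  suffices H : ∀ m : ℕ, ∀ σ ∈ S, 0 < σ.1 ∨ (σ.1 = 0 ∧ σ.2.2 ≠ 0) → 2 * n ≤ σ.2.2 + m →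
      ∀ t, modeTerm C D σ t i j = 0 from H (2 * n) σ hσ hg (by omega) t
  intro m
  induction m with
  | zero =>
    intro σ hσ _ hle
    have := h.degree_le σ hσ
    have := i.pos
    omega
  | succ m ih =>
    rintro ⟨a0, b0, K⟩ hσ hg hle
    obtain ⟨r, κ, -, hκ, -, hr⟩ := exists_extraction hω h hM (i := i) (j := j)
      (h.frequency_nonneg _ hσ) (a0 := a0) (K := K) (fun σ hσ' ha hK =>
        ih σ hσ' (by
          rw [ha]
          rcases hg with hg | hg
          · exact Or.inl hg
          · exact Or.inr ⟨hg.1, by omega⟩) (by simp only at hle; omega))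
    obtain ⟨Km, hKm⟩ := exists_norm_entryMoment_le hMb hT (a0 + b0 * Complex.I) i j
    refine modeTerm_eq_zero_of_frequencyAmplitude ?_
    have hz : ‖Complex.exp ((a0 + b0 * Complex.I) * (2 * Real.pi / ω : ℝ))‖ =
        Real.exp (a0 * (2 * Real.pi / ω)) := by
      rw [Complex.norm_exp, Complex.re_mul_ofReal]
      simp
    have h0 := eq_zero_of_bounded_of_aeval hKm (K := K) (by
      rw [hz]
      rcases hg with hg | hg
      · exact Or.inl (Real.one_lt_exp_iff.2 (mul_pos hg hT))
      · simp only at hg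
        exact Or.inr ⟨by simp [hg.1], hg.2⟩) hr
    rw [if_pos hσ] at h0
    exact (mul_eq_zero.1 h0).resolve_left hκ

-- With w₀ = 0 the moments are TB plus the differences of a bounded sequence. The filter gives T
-- r(1) times the constant mode; comparing, the discrepancy is a constant difference of a bounded
-- sequence, hence zero.
open scoped Classical in
theorem IsExpansion.constant_mode_eq {ω : ℝ} (hω : 0 < ω) {S : Set (ℝ × ℝ × ℕ)}
    {C D : ℝ × ℝ × ℕ → Mat n} {M : ℝ → Mat n} (h : IsExpansion ω M S C D)
    (hM : ∀ a b i j, IntervalIntegrable (fun t => M t i j) volume a b) (hMb : UniformlyBounded M)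
    {B : Mat n} {K : ℝ}
    (hΨ : ∀ t : ℝ, 0 ≤ t → ∀ i j, |(∫ τ in (0 : ℝ)..t, M τ i j) - t * B i j| ≤ K) (i j : Fin n) :
    (if ((0, 0, 0) : ℝ × ℝ × ℕ) ∈ S then C (0, 0, 0) i j else 0) = B i j := by
  have hT : 0 < 2 * Real.pi / ω := by positivity
  obtain ⟨r, κ, hr0, -, hκ, hr⟩ := exists_extraction hω h hM (i := i) (j := j) (a0 := 0)
    (b0 := 0) le_rfl (K := 0) (fun σ hσ ha hK => h.modeTerm_eq_zero hω hM hMb hσ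
      (Or.inr ⟨ha, hK.ne'⟩) i j)
  rw [hκ rfl] at hr
  set T : ℝ := 2 * Real.pi / ω with hTdef
  simp only [Complex.ofReal_zero, zero_mul, add_zero, Complex.exp_zero, one_pow, mul_one, pow_zero,
    one_mul, frequencyAmplitude_of_eq_zero] at hr hr0
  -- The bounded primitive of M - B, sampled at multiples of the period.
  set ζ : ℕ → ℂ := fun N => (((∫ τ in (0 : ℝ)..(N * T), M τ i j) - N * T * B i j : ℝ) : ℂ) with hζ
  have hζb : ∀ N, ‖ζ N‖ ≤ K := fun N => by
    rw [hζ, Complex.norm_real, Real.norm_eq_abs]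
    exact hΨ (N * T) (by positivity) i j
  have hm : entryMoment M T 0 i j = (fun _ => (T : ℂ) * B i j) + (seqShift ζ - ζ) := by
    ext N
    simp only [Pi.add_apply, Pi.sub_apply, seqShift_apply, hζ, entryMoment, zero_mul, neg_zero,
      Complex.exp_zero, mul_one]
    rw [intervalIntegral.integral_ofReal,
      intervalIntegral.integral_comp_add_right (fun t => M t i j), zero_add]
    have e : T + N * T = ((N + 1 : ℕ) : ℝ) * T := by push_cast; ring
    rw [e, ← intervalIntegral.integral_interval_sub_left (hM 0 _ i j) (hM 0 (N * T) i j)]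
    push_cast
    ring
  obtain ⟨K', hK'⟩ := exists_norm_aeval_seqShift_le r hζb
  have hconst : aeval seqShift r (fun _ => (T : ℂ) * B i j) =
      r.eval 1 • (fun _ : ℕ => (T : ℂ) * B i j) :=
    aeval_apply_of_apply_eq_smul (by ext N; simp) r
  have hcomm : aeval seqShift r (seqShift ζ) = seqShift (aeval seqShift r ζ) := by
    have := congrArg (fun f => f ζ) (congrArg (aeval seqShift) (mul_comm r X))
    simpa only [map_mul, aeval_X, Module.End.mul_apply] using this
  have h0 := eq_zero_of_bounded_of_sub_eq hK' (z := 1) (κ := T * r.eval 1 *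
      ((if ((0, 0, 0) : ℝ × ℝ × ℕ) ∈ S then (C (0, 0, 0) i j : ℂ) else 0) - B i j)) (by simp)
      (fun N => by
        have := hr N
        rw [hm, map_add, map_sub, hconst, hcomm] at this
        simp only [Pi.add_apply, Pi.sub_apply, Pi.smul_apply, smul_eq_mul, seqShift_apply] at this
        rw [one_pow, mul_one, one_mul, mul_sub, ← this]
        ring)
  have hTc : (T : ℂ) ≠ 0 := by exact_mod_cast hT.ne'
  have h1 := sub_eq_zero.1 ((mul_eq_zero.1 h0).resolve_left (mul_ne_zero hTc hr0))
  split_ifs at h1 ⊢ <;> exact_mod_cast h1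

theorem IsExpansion.hasL2Sum_growthIndices {ω : ℝ} (hω : 0 < ω) {S : Set (ℝ × ℝ × ℕ)}
    {C D : ℝ × ℝ × ℕ → Mat n} {M : ℝ → Mat n} (h : IsExpansion ω M S C D)
    (hM : ∀ a b i j, IntervalIntegrable (fun t => M t i j) volume a b) (hMb : UniformlyBounded M)
    {B : Mat n} {K : ℝ}
    (hΨ : ∀ t : ℝ, 0 ≤ t → ∀ i j, |(∫ τ in (0 : ℝ)..t, M τ i j) - t * B i j| ≤ K) :
    HasL2Sum (S ∩ growthIndices) C D (fun _ => B) := by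
  classical
  intro R _ i j
  have hB := h.constant_mode_eq hω hM hMb hΨ i j
  have hterm : ∀ σ : (S ∩ growthIndices : Set (ℝ × ℝ × ℕ)), ∀ t,
      modeTerm C D σ t i j = if σ.1 = (0, 0, 0) then B i j else 0 := by
    rintro ⟨σ, hσS, hσ⟩ t
    by_cases h0 : σ = (0, 0, 0)
    · subst h0
      rw [if_pos hσS] at hB
      simp [modeTerm_apply, hB]
    · simp only [h0, if_false]
      refine h.modeTerm_eq_zero hω hM hMb hσS ?_ i j t
      rcases hσ with hσ | hσ | hσ
      · exact Or.inl hσ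
      · exact Or.inr hσ
      · exact absurd (Prod.ext hσ.1 (Prod.ext hσ.2.2 hσ.2.1)) h0
  refine tendsto_const_nhds.congr' ?_
  by_cases hmem : ((0, 0, 0) : ℝ × ℝ × ℕ) ∈ S
  · have hg : ((0, 0, 0) : ℝ × ℝ × ℕ) ∈ S ∩ growthIndices :=
      ⟨hmem, Or.inr (Or.inr ⟨rfl, rfl, rfl⟩)⟩
    filter_upwards [eventually_ge_atTop {(⟨(0, 0, 0), hg⟩ : (S ∩ growthIndices : Set (ℝ × ℝ × ℕ)))}]
      with s hs
    have hsum : ∀ t, ∑ σ ∈ s, modeTerm C D σ.1 t i j = B i j := by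
      intro t
      rw [Finset.sum_eq_single (⟨(0, 0, 0), hg⟩ : (S ∩ growthIndices : Set (ℝ × ℝ × ℕ)))]
      · rw [hterm, if_pos rfl]
      · intro σ _ hσ
        rw [hterm, if_neg fun h => hσ (Subtype.ext h)]
      · intro hnot
        exact absurd (hs (Finset.mem_singleton_self _)) hnot
    simp [hsum]
  -- Without a constant mode in S, the entry of B is itself zero.
  · rw [if_neg hmem] at hB
    refine Eventually.of_forall fun s => ?_
    simp [hterm, ← hB]

end GrowthComponent

/-! ### Entries of the flow are exponential polynomials -/

section ExponentialPolynomials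

/-- The complex exponential polynomials of degree less than `n`. -/
def expPoly (n : ℕ) : Submodule ℂ (ℝ → ℂ) :=
  Submodule.span ℂ {g | ∃ k < n, ∃ μ : ℂ, g = fun t : ℝ => (t : ℂ) ^ k * Complex.exp (μ * t)}

variable {n : ℕ}

section

attribute [local instance] Matrix.linftyOpNormedRing Matrix.linftyOpNormedAlgebra

theorem hasSum_exp_mulVec (X : Matrix (Fin n) (Fin n) ℂ) (v : Fin n → ℂ) (i : Fin n) :
    HasSum (fun k : ℕ => ((k.factorial : ℂ)⁻¹ • X ^ k).mulVec v i)
      ((NormedSpace.exp X).mulVec v i) := by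
  have h := NormedSpace.exp_series_hasSum_exp' (𝕂 := ℂ) X
  exact h.map (⟨⟨fun Y => Y.mulVec v i, by simp⟩, fun Y Z => by simp [Matrix.add_mulVec]⟩ :
    Matrix (Fin n) (Fin n) ℂ →+ ℂ) (by
      change Continuous fun Y : Matrix (Fin n) (Fin n) ℂ => Y.mulVec v i
      simp only [Matrix.mulVec, dotProduct]
      exact continuous_finsetSum _ fun j _ =>
        (Continuous.matrix_elem continuous_id i j).mul continuous_const)

theorem map_ofReal_exp (X : Mat n) :
    (NormedSpace.exp X).map ((↑) : ℝ → ℂ) = NormedSpace.exp (X.map ((↑) : ℝ → ℂ)) :=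
  NormedSpace.map_exp (Complex.ofRealHom.mapMatrix (m := Fin n)) (by
    refine continuous_pi fun i => continuous_pi fun j => ?_
    exact Complex.continuous_ofReal.comp ((continuous_apply j).comp (continuous_apply i))) X

end

theorem exp_mulVec_of_pow_mulVec_eq_zero {N : Matrix (Fin n) (Fin n) ℂ} {v : Fin n → ℂ} {m : ℕ}
    (h : (N ^ m).mulVec v = 0) (t : ℂ) (i : Fin n) :
    (NormedSpace.exp (t • N)).mulVec v i =
      ∑ k ∈ Finset.range m, t ^ k * ((k.factorial : ℂ)⁻¹ * (N ^ k).mulVec v i) := by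
  have hs := hasSum_exp_mulVec (t • N) v i
  have hz : ∀ k ∉ Finset.range m, ((k.factorial : ℂ)⁻¹ • (t • N) ^ k).mulVec v i = 0 := by
    intro k hk
    rw [Finset.mem_range, not_lt] at hk
    have : (N ^ k).mulVec v = 0 := by
      rw [← Nat.sub_add_cancel hk, pow_add, ← Matrix.mulVec_mulVec, h, Matrix.mulVec_zero]
    rw [smul_pow, Matrix.smul_mulVec, Matrix.smul_mulVec, this]
    simp
  rw [hs.unique (hasSum_sum_of_ne_finset_zero hz)]
  refine Finset.sum_congr rfl fun k _ => ?_
  rw [smul_pow, Matrix.smul_mulVec, Matrix.smul_mulVec]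
  simp only [Pi.smul_apply, smul_eq_mul]
  ring

theorem exp_smul_eq (X : Matrix (Fin n) (Fin n) ℂ) (μ t : ℂ) :
    NormedSpace.exp (t • X) = Complex.exp (μ * t) • NormedSpace.exp (t • (X - μ • 1)) := by
  have h1 : t • X = Matrix.diagonal (fun _ => μ * t) + t • (X - μ • 1) := by
    rw [← Matrix.smul_one_eq_diagonal, smul_sub, smul_smul, mul_comm μ t]
    abel
  have hc : Commute (Matrix.diagonal fun _ : Fin n => μ * t) (t • (X - μ • 1)) := by
    rw [← Matrix.smul_one_eq_diagonal]
    exact (Commute.one_left _).smul_left _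
  rw [h1, Matrix.exp_add_of_commute _ _ hc, Matrix.exp_diagonal]
  have : NormedSpace.exp (fun _ : Fin n => μ * t) = fun _ => Complex.exp (μ * t) := by
    rw [Pi.exp_def, Complex.exp_eq_exp_ℂ]
  rw [this, ← Matrix.smul_one_eq_diagonal, smul_mul_assoc, one_mul]

/-- The admissible v form a subspace. It contains each generalised eigenspace, where (X - μ)^n
vanishes and the exponential series stops, leaving e^{μt} times a polynomial of degree < n. -/
theorem exp_smul_mulVec_mem_expPoly (X : Matrix (Fin n) (Fin n) ℂ) (v : Fin n → ℂ) (i : Fin n) :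
    (fun t : ℝ => (NormedSpace.exp ((t : ℂ) • X)).mulVec v i) ∈ expPoly n := by
  let W : Submodule ℂ (Fin n → ℂ) :=
    { carrier := {v | ∀ i, (fun t : ℝ => (NormedSpace.exp ((t : ℂ) • X)).mulVec v i) ∈ expPoly n}
      zero_mem' := fun i => by
        simp only [Matrix.mulVec_zero, Pi.zero_apply]
        exact zero_mem _
      add_mem' := fun {v w} hv hw i => by
        simp only [Matrix.mulVec_add, Pi.add_apply]
        exact add_mem (hv i) (hw i)
      smul_mem' := fun c v hv i => by
        simp only [Matrix.mulVec_smul, Pi.smul_apply]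
        exact Submodule.smul_mem _ c (hv i) }
  suffices h : ⊤ ≤ W from h (Submodule.mem_top (x := v)) i
  rw [← Module.End.iSup_maxGenEigenspace_eq_top (Matrix.toLin' X)]
  refine iSup_le fun μ v hv i => ?_
  rw [Module.End.maxGenEigenspace_eq_genEigenspace_finrank, Module.End.mem_genEigenspace_nat,
    LinearMap.mem_ker] at hv
  have hv' : ((X - μ • (1 : Matrix (Fin n) (Fin n) ℂ)) ^ n).mulVec v = 0 := by
    have e : Matrix.toLin' X - μ • 1 = Matrix.toLin' (X - μ • (1 : Matrix (Fin n) (Fin n) ℂ)) := by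
      rw [map_sub, map_smul, Matrix.toLin'_one]; rfl
    rw [e, ← Matrix.toLin'_pow, Module.finrank_fin_fun, Matrix.toLin'_apply] at hv
    exact hv
  have e : (fun t : ℝ => (NormedSpace.exp ((t : ℂ) • X)).mulVec v i) =
      ∑ k ∈ Finset.range n, ((k.factorial : ℂ)⁻¹ *
        ((X - μ • (1 : Matrix (Fin n) (Fin n) ℂ)) ^ k).mulVec v i) •
          fun t : ℝ => (t : ℂ) ^ k * Complex.exp (μ * t) := by
    ext t
    rw [exp_smul_eq X μ t, Matrix.smul_mulVec, Pi.smul_apply,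
      exp_mulVec_of_pow_mulVec_eq_zero hv', Finset.smul_sum, Finset.sum_apply]
    refine Finset.sum_congr rfl fun k _ => ?_
    simp only [Pi.smul_apply, smul_eq_mul]
    ring
  rw [e]
  exact Submodule.sum_mem _ fun k hk => Submodule.smul_mem _ _
    (Submodule.subset_span ⟨k, Finset.mem_range.1 hk, μ, rfl⟩)

theorem flow_mem_expPoly (A : Mat n) (i j : Fin n) :
    (fun t => (flow A t i j : ℂ)) ∈ expPoly n := by
  have h := exp_smul_mulVec_mem_expPoly (A.map ((↑) : ℝ → ℂ)) (Pi.single j 1) i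
  have e : ∀ t : ℝ, (NormedSpace.exp ((t : ℂ) • A.map ((↑) : ℝ → ℂ))).mulVec (Pi.single j 1) i =
      (flow A t i j : ℂ) := by
    intro t
    have : (t : ℂ) • A.map ((↑) : ℝ → ℂ) = (t • A).map ((↑) : ℝ → ℂ) := by
      ext; simp
    rw [this, ← map_ofReal_exp, Matrix.mulVec_single_one, Matrix.col_apply, Matrix.map_apply, flow]
  simpa only [e] using h

theorem flow_neg_eq (A : Mat n) (t : ℝ) : flow A (-t) = flow (-A) t := by
  rw [flow, flow, neg_smul, smul_neg]

end ExponentialPolynomials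

/-! ### Fourier series in L² on bounded intervals -/

section FourierSeries

open scoped ENNReal

/-- The Fourier series converges unconditionally in L² of the circle. Its remainders are T-periodic,
so one period controls [-R, R] with coefficients independent of R. -/
theorem exists_fourier_series_periodic {T : ℝ} (hT : 0 < T) {p : ℝ → ℂ} (hp : Function.Periodic p T)
    (hp2 : MemLp p 2 (volume.restrict (Ioc 0 T))) :
    ∃ c : ℤ → ℂ, ∀ R : ℝ, Tendsto (fun s : Finset ℤ => eLpNorm (fun t => p t -
      ∑ l ∈ s, c l * Complex.exp (2 * Real.pi * Complex.I * l * t / T)) 2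
        (volume.restrict (Icc (-R) R))) atTop (𝓝 0) := by
  have : Fact (0 < T) := ⟨hT⟩
  have hp2' : MemLp p 2 (volume.restrict (Ioc 0 (0 + T))) := by rwa [zero_add]
  have h := hp2'.memLp_liftIoc.haarAddCircle
  set f : Lp ℂ 2 (@AddCircle.haarAddCircle T _) := h.toLp with hf
  refine ⟨fourierCoeff f, fun R => ?_⟩
  obtain ⟨c, hc, hle⟩ := exists_eLpNorm_two_Icc_le hT R
  set F : Finset ℤ → AddCircle T → ℂ := fun s x => AddCircle.liftIoc T 0 p x -
    ∑ l ∈ s, fourierCoeff f l * fourier l x with hF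
  have hFm : ∀ s, AEStronglyMeasurable (F s) volume := fun s =>
    hp2'.memLp_liftIoc.1.sub (continuous_finsetSum _ fun l _ =>
      continuous_const.mul (fourier l).continuous).aestronglyMeasurable
  have h1 : ∀ s, eLpNorm (fun t => p t -
      ∑ l ∈ s, fourierCoeff f l * Complex.exp (2 * Real.pi * Complex.I * l * t / T)) 2
        (volume.restrict (Ioc 0 T)) = eLpNorm (F s) 2 volume := by
    intro s
    have hmp := AddCircle.measurePreserving_mk T 0
    rw [zero_add] at hmp
    rw [← eLpNorm_comp_measurePreserving (hFm s) hmp]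
    refine eLpNorm_congr_ae ((ae_restrict_iff' measurableSet_Ioc).2 (ae_of_all _ fun t ht => ?_))
    simp only [hF, Function.comp, fourier_coe_apply]
    rw [AddCircle.liftIoc_zero_coe_apply ht]
  -- Lebesgue measure on the circle is T times the normalised Haar measure, hence the factor √T.
  have h2 : ∀ s : Finset ℤ, eLpNorm (F s) 2 volume = ENNReal.ofReal T ^ (1 / (2 : ℝ≥0∞)).toReal *
      ‖(∑ l ∈ s, fourierCoeff f l • fourierLp (T := T) 2 l) - f‖ₑ := by
    intro s
    rw [AddCircle.volume_eq_smul_haarAddCircle,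
      eLpNorm_smul_measure_of_ne_top (by norm_num), smul_eq_mul, ← enorm_neg, neg_sub,
      Lp.enorm_def]
    congr 1
    refine eLpNorm_congr_ae ?_
    have hs : ((∑ l ∈ s, fourierCoeff f l • fourierLp (T := T) 2 l : Lp ℂ 2 _) : AddCircle T → ℂ)
        =ᵐ[AddCircle.haarAddCircle] fun x => ∑ l ∈ s, fourierCoeff f l * fourier l x := by
      induction s using Finset.induction_on with
      | empty => simp only [Finset.sum_empty]; exact Lp.coeFn_zero ℂ 2 _
      | insert a s ha ih =>
        rw [Finset.sum_insert ha]
        filter_upwards [Lp.coeFn_add (fourierCoeff f a • fourierLp (T := T) 2 a)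
          (∑ l ∈ s, fourierCoeff f l • fourierLp (T := T) 2 l), ih,
          Lp.coeFn_smul (fourierCoeff f a) (fourierLp (T := T) 2 a),
          coeFn_fourierLp (T := T) 2 a] with x h1 h2 h3 h4
        rw [h1, Pi.add_apply, h2, h3, Pi.smul_apply, h4, Finset.sum_insert ha, smul_eq_mul]
    filter_upwards [Lp.coeFn_sub f (∑ l ∈ s, fourierCoeff f l • fourierLp (T := T) 2 l), hs,
      h.coeFn_toLp] with x e1 e2 e3
    rw [e1, Pi.sub_apply, e2, hf, e3]
  have h3 : Tendsto (fun s : Finset ℤ =>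
      ‖(∑ l ∈ s, fourierCoeff f l • fourierLp (T := T) 2 l) - f‖ₑ) atTop (𝓝 0) := by
    have := hasSum_fourier_series_L2 f
    rw [HasSum, SummationFilter.unconditional_filter, tendsto_iff_edist_tendsto_0] at this
    simpa only [edist_eq_enorm_sub] using this
  have h4 : Tendsto (fun s : Finset ℤ => c * (ENNReal.ofReal T ^ (1 / (2 : ℝ≥0∞)).toReal *
      ‖(∑ l ∈ s, fourierCoeff f l • fourierLp (T := T) 2 l) - f‖ₑ)) atTop (𝓝 0) := by
    have h5 := ENNReal.Tendsto.const_mul (a := c) (ENNReal.Tendsto.const_mul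
      (a := ENNReal.ofReal T ^ (1 / (2 : ℝ≥0∞)).toReal) h3 (Or.inr (by finiteness))) (Or.inr hc)
    simpa using h5
  refine tendsto_of_tendsto_of_tendsto_of_le_of_le tendsto_const_nhds h4 (fun _ => zero_le)
    fun s => ?_
  simp only [← h2, ← h1]
  refine hle _ fun t => ?_
  simp only [hp t]
  congr 1
  refine Finset.sum_congr rfl fun l _ => ?_
  congr 1
  refine Complex.exp_eq_exp_iff_exists_int.2 ⟨l, ?_⟩
  have hTc : (T : ℂ) ≠ 0 := by exact_mod_cast hT.ne'
  push_cast
  field_simp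

end FourierSeries

/-! ### Existence of an expansion -/

section ModeSums

open scoped ENNReal

/-- The scalar mode `c t^k e^{at} cos(bt) + d t^k e^{at} sin(bt)`. -/
noncomputable def scalarMode (c d : ℝ × ℝ × ℕ → ℝ) (σ : ℝ × ℝ × ℕ) (t : ℝ) : ℝ :=
  (t ^ σ.2.2 * Real.exp (σ.1 * t)) *
    (Real.cos (σ.2.1 * t) * c σ + Real.sin (σ.2.1 * t) * d σ)

theorem continuous_scalarMode (c d : ℝ × ℝ × ℕ → ℝ) (σ : ℝ × ℝ × ℕ) :
    Continuous (scalarMode c d σ) := by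
  unfold scalarMode
  fun_prop

/-- The indices with exponent in `a`, nonnegative frequency in `b + ω ℤ` and degree at most `m`. -/
def modeIndices (ω : ℝ) (m : ℕ) (a b : Finset ℝ) : Set (ℝ × ℝ × ℕ) :=
  {σ | σ.1 ∈ a ∧ 0 ≤ σ.2.1 ∧ (∃ θ ∈ b, ∃ l : ℤ, σ.2.1 = θ + l * ω) ∧ σ.2.2 ≤ m}

theorem modeIndices_mono {ω : ℝ} {m : ℕ} {a a' b b' : Finset ℝ} (ha : a ⊆ a') (hb : b ⊆ b') :
    modeIndices ω m a b ⊆ modeIndices ω m a' b' := by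
  rintro σ ⟨h1, h2, ⟨θ, hθ, hl⟩, h4⟩
  exact ⟨ha h1, h2, ⟨θ, hb hθ, hl⟩, h4⟩

/-- The modes with coefficients `c`, `d` sum up to `g` in `L²` on bounded intervals. -/
def HasModeSum (c d : ℝ × ℝ × ℕ → ℝ) (g : ℝ → ℝ) : Prop :=
  ∀ R : ℝ, Tendsto (fun s : Finset (ℝ × ℝ × ℕ) =>
    eLpNorm (fun t => g t - ∑ σ ∈ s, scalarMode c d σ t) 2 (volume.restrict (Icc (-R) R)))
    atTop (𝓝 0)

/-- The functions with a mode expansion over finitely many exponents and frequency classes. -/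
structure HasModeExpansion (ω : ℝ) (m : ℕ) (g : ℝ → ℝ) : Prop where
  aestronglyMeasurable : AEStronglyMeasurable g
  exists_coeff : ∃ (a b : Finset ℝ) (c d : ℝ × ℝ × ℕ → ℝ),
    (∀ σ ∉ modeIndices ω m a b, c σ = 0 ∧ d σ = 0) ∧ HasModeSum c d g

theorem HasModeExpansion.zero (ω : ℝ) (m : ℕ) : HasModeExpansion ω m 0 := by
  refine ⟨aestronglyMeasurable_zero, ∅, ∅, 0, 0, fun _ _ => ⟨rfl, rfl⟩, fun R => ?_⟩
  simp [scalarMode]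

theorem HasModeExpansion.add {ω : ℝ} {m : ℕ} {g g' : ℝ → ℝ} (hg : HasModeExpansion ω m g)
    (hg' : HasModeExpansion ω m g') : HasModeExpansion ω m (g + g') := by
  classical
  obtain ⟨a, b, c, d, hcd, hs⟩ := hg.exists_coeff
  obtain ⟨a', b', c', d', hcd', hs'⟩ := hg'.exists_coeff
  refine ⟨hg.1.add hg'.1, a ∪ a', b ∪ b', c + c', d + d', fun σ hσ => ?_, fun R => ?_⟩
  · have h1 := hcd σ fun h => hσ (modeIndices_mono Finset.subset_union_left
      Finset.subset_union_left h)
    have h2 := hcd' σ fun h => hσ (modeIndices_mono Finset.subset_union_right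
      Finset.subset_union_right h)
    simp [h1, h2]
  · have h3 := (hs R).add (hs' R)
    rw [add_zero] at h3
    refine tendsto_of_tendsto_of_tendsto_of_le_of_le tendsto_const_nhds h3 (fun _ => zero_le)
      fun s => ?_
    have e : (fun t => (g + g') t - ∑ σ ∈ s, scalarMode (c + c') (d + d') σ t) =
        (fun t => g t - ∑ σ ∈ s, scalarMode c d σ t) +
          fun t => g' t - ∑ σ ∈ s, scalarMode c' d' σ t := by
      ext t
      simp only [Pi.add_apply, scalarMode]
      have : ∀ σ : ℝ × ℝ × ℕ, t ^ σ.2.2 * Real.exp (σ.1 * t) *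
          (Real.cos (σ.2.1 * t) * (c σ + c' σ) + Real.sin (σ.2.1 * t) * (d σ + d' σ)) =
          t ^ σ.2.2 * Real.exp (σ.1 * t) *
            (Real.cos (σ.2.1 * t) * c σ + Real.sin (σ.2.1 * t) * d σ) +
          t ^ σ.2.2 * Real.exp (σ.1 * t) *
            (Real.cos (σ.2.1 * t) * c' σ + Real.sin (σ.2.1 * t) * d' σ) := fun σ => by ring
      simp only [this, Finset.sum_add_distrib]
      ring
    simp only [e]
    refine eLpNorm_add_le ?_ ?_ (by norm_num)
    · exact (hg.1.sub (continuous_finsetSum _ fun σ _ =>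
        continuous_scalarMode c d σ).aestronglyMeasurable).restrict
    · exact (hg'.1.sub (continuous_finsetSum _ fun σ _ =>
        continuous_scalarMode c' d' σ).aestronglyMeasurable).restrict

theorem HasModeExpansion.sum {ω : ℝ} {m : ℕ} {ι : Type*} (s : Finset ι) {g : ι → ℝ → ℝ}
    (h : ∀ i ∈ s, HasModeExpansion ω m (g i)) : HasModeExpansion ω m (∑ i ∈ s, g i) :=
  Finset.sum_induction g (HasModeExpansion ω m) (fun _ _ => HasModeExpansion.add)
    (HasModeExpansion.zero ω m) h

theorem finite_abs_add_mul_eq {ω : ℝ} (hω : 0 < ω) (β b : ℝ) :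
    {l : ℤ | |β + l * ω| = b}.Finite := by
  refine (Set.finite_Icc ⌈(-b - β) / ω⌉ ⌊(b - β) / ω⌋).subset fun l hl => ?_
  have h := abs_le.1 (le_of_eq (show |β + l * ω| = b from hl))
  refine ⟨Int.ceil_le.2 ?_, Int.le_floor.2 ?_⟩
  · rw [div_le_iff₀ hω]; linarith [h.1]
  · rw [le_div_iff₀ hω]; linarith [h.2]

/-- Collecting the frequencies `β + l ω`, `l ∈ ℤ`, according to their absolute values. -/
theorem hasModeExpansion_of_tendsto {ω : ℝ} (hω : 0 < ω) {m k : ℕ} (hk : k ≤ m) (a β : ℝ)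
    {g : ℝ → ℝ} (hg : AEStronglyMeasurable g) (x y : ℤ → ℝ)
    (h : ∀ R : ℝ, Tendsto (fun s : Finset ℤ => eLpNorm (fun t => g t - ∑ l ∈ s,
      (t ^ k * Real.exp (a * t)) * (x l * Real.cos ((β + l * ω) * t) -
        y l * Real.sin ((β + l * ω) * t))) 2 (volume.restrict (Icc (-R) R))) atTop (𝓝 0)) :
    HasModeExpansion ω m g := by
  classical
  set idx : ℤ → ℝ × ℝ × ℕ := fun l => (a, |β + l * ω|, k) with hidx
  have hfin : ∀ σ, {l | idx l = σ}.Finite := fun σ =>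
    (finite_abs_add_mul_eq hω β σ.2.1).subset fun l hl => by
      have : idx l = σ := hl
      simp [← this, hidx]
  set fib : ℝ × ℝ × ℕ → Finset ℤ := fun σ => (hfin σ).toFinset with hfib
  have hmem : ∀ σ l, l ∈ fib σ ↔ idx l = σ := fun σ l => by simp [hfib]
  -- The sine is odd, so replacing a negative frequency by its absolute value flips the sign.
  set y' : ℤ → ℝ := fun l => if β + l * ω < 0 then y l else -y l with hy'
  refine ⟨hg, {a}, {β, -β}, fun σ => ∑ l ∈ fib σ, x l, fun σ => ∑ l ∈ fib σ, y' l,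
    fun σ hσ => ?_, fun R => ?_⟩
  · have hempty : fib σ = ∅ := by
      refine Finset.eq_empty_of_forall_notMem fun l hl => hσ ?_
      rw [hmem] at hl
      rw [← hl]
      refine ⟨by simp [hidx], abs_nonneg _, ?_, hk⟩
      rcases abs_choice (β + l * ω) with h | h
      · exact ⟨β, by simp, l, h⟩
      · exact ⟨-β, by simp, -l, by simp only [hidx, h]; push_cast; ring⟩
    simp [hempty]
  -- Unions of finite fibres exhaust ℤ, so regrouping preserves the unconditional sum.
  · have hat : Tendsto (fun s : Finset (ℝ × ℝ × ℕ) => s.biUnion fib) atTop atTop := by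
      refine tendsto_atTop.2 fun t => ?_
      filter_upwards [eventually_ge_atTop (t.image idx)] with s hs l hl
      exact Finset.mem_biUnion.2 ⟨idx l, hs (Finset.mem_image_of_mem _ hl), (hmem _ _).2 rfl⟩
    refine ((h R).comp hat).congr fun s => ?_
    simp only [Function.comp]
    congr 1
    ext t
    congr 1
    rw [Finset.sum_biUnion]
    · refine Finset.sum_congr rfl fun σ _ => ?_
      simp only [scalarMode, Finset.mul_sum, ← Finset.sum_add_distrib]
      refine Finset.sum_congr rfl fun l hl => ?_
      rw [hmem] at hl
      rw [← hl]
      simp only [hidx, hy']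
      rcases lt_or_ge (β + l * ω) 0 with h | h
      · rw [if_pos h, abs_of_neg h, neg_mul, Real.cos_neg, Real.sin_neg]; ring
      · rw [if_neg (not_lt.2 h), abs_of_nonneg h]; ring
    · intro σ _ σ' _ hne
      refine Finset.disjoint_left.2 fun l hl hl' => hne ?_
      rw [hmem] at hl hl'
      rw [← hl, hl']

/-- The factor γ t^k e^{wt} is bounded on [-R, R], so multiplying the Fourier series of p by it
keeps L² convergence. Real parts then give cosines and sines of frequency Im w + lω. -/
theorem hasModeExpansion_exp_mul_periodic {ω : ℝ} (hω : 0 < ω) {m k : ℕ} (hk : k ≤ m) (w γ : ℂ)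
    {p : ℝ → ℝ} (hp : Function.Periodic p (2 * Real.pi / ω))
    (hp2 : MemLp p 2 (volume.restrict (Ioc 0 (2 * Real.pi / ω)))) :
    HasModeExpansion ω m
      (fun t => (γ * ((t : ℂ) ^ k * Complex.exp (w * t) * (p t : ℂ))).re) := by
  have hT : 0 < 2 * Real.pi / ω := by positivity
  have hωc : (ω : ℂ) ≠ 0 := by exact_mod_cast hω.ne'
  obtain ⟨c, hc⟩ := exists_fourier_series_periodic hT (p := fun t => (p t : ℂ))
    (fun t => by simp only [hp t]) hp2.ofReal
  have hpm : AEStronglyMeasurable p := aestronglyMeasurable_of_periodic hT hp hp2.1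
  have hfac : Continuous fun t : ℝ => γ * ((t : ℂ) ^ k * Complex.exp (w * t)) := by fun_prop
  have hgm : AEStronglyMeasurable
      (fun t : ℝ => (γ * ((t : ℂ) ^ k * Complex.exp (w * t) * (p t : ℂ))).re) := by
    have h1 := hfac.aestronglyMeasurable.mul
      (Complex.continuous_ofReal.comp_aestronglyMeasurable hpm)
    refine (Complex.continuous_re.comp_aestronglyMeasurable h1).congr (ae_of_all _ fun t => ?_)
    exact congrArg Complex.re (mul_assoc γ _ _)
  refine hasModeExpansion_of_tendsto hω hk w.re w.im hgm (fun l => (γ * c l).re)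
    (fun l => (γ * c l).im) fun R => ?_
  obtain ⟨L, hL⟩ := isCompact_Icc.exists_bound_of_continuousOn (s := Icc (-R) R) hfac.continuousOn
  have h0 := ENNReal.Tendsto.const_mul (a := ENNReal.ofReal L) (hc R) (Or.inr ENNReal.ofReal_ne_top)
  rw [mul_zero] at h0
  refine tendsto_of_tendsto_of_tendsto_of_le_of_le tendsto_const_nhds h0 (fun _ => zero_le)
    fun s => ?_
  refine eLpNorm_le_mul_eLpNorm_of_ae_le_mul ?_ 2
  rw [ae_restrict_iff' measurableSet_Icc]
  refine ae_of_all _ fun t ht => ?_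
  have hterm : ∀ l : ℤ, (t ^ k * Real.exp (w.re * t)) * ((γ * c l).re *
      Real.cos ((w.im + l * ω) * t) - (γ * c l).im * Real.sin ((w.im + l * ω) * t)) =
      (γ * ((t : ℂ) ^ k * Complex.exp (w * t)) *
        (c l * Complex.exp (2 * Real.pi * Complex.I * l * t / (2 * Real.pi / ω : ℝ)))).re := by
    intro l
    have e1 : Complex.exp (w * t) * Complex.exp (2 * Real.pi * Complex.I * l * t /
        (2 * Real.pi / ω : ℝ)) = (Real.exp (w.re * t) : ℂ) *
          (Real.cos ((w.im + l * ω) * t) + Real.sin ((w.im + l * ω) * t) * Complex.I) := by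
      rw [Complex.ofReal_exp, Complex.ofReal_cos, Complex.ofReal_sin, ← Complex.exp_mul_I,
        ← Complex.exp_add, ← Complex.exp_add]
      congr 1
      have hπ : (Real.pi : ℂ) ≠ 0 := by exact_mod_cast Real.pi_ne_zero
      conv_lhs => rw [← Complex.re_add_im w]
      push_cast
      field_simp
      ring
    have e2 : γ * ((t : ℂ) ^ k * Complex.exp (w * t)) *
        (c l * Complex.exp (2 * Real.pi * Complex.I * l * t / (2 * Real.pi / ω : ℝ))) =
        ((t ^ k * Real.exp (w.re * t) : ℝ) : ℂ) * ((γ * c l) *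
          (Real.cos ((w.im + l * ω) * t) + Real.sin ((w.im + l * ω) * t) * Complex.I)) := by
      rw [show γ * ((t : ℂ) ^ k * Complex.exp (w * t)) *
        (c l * Complex.exp (2 * Real.pi * Complex.I * l * t / (2 * Real.pi / ω : ℝ))) =
        γ * (t : ℂ) ^ k * c l * (Complex.exp (w * t) * Complex.exp (2 * Real.pi * Complex.I * l * t /
          (2 * Real.pi / ω : ℝ))) by ring, e1]
      push_cast
      ring
    rw [e2, Complex.re_ofReal_mul, Complex.mul_re (γ * c l)]
    generalize Real.cos ((w.im + l * ω) * t) = u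
    generalize Real.sin ((w.im + l * ω) * t) = v
    simp
  have hre : (γ * ((t : ℂ) ^ k * Complex.exp (w * t) * (p t : ℂ))).re - ∑ l ∈ s,
      (t ^ k * Real.exp (w.re * t)) * ((γ * c l).re * Real.cos ((w.im + l * ω) * t) -
        (γ * c l).im * Real.sin ((w.im + l * ω) * t)) =
      (γ * ((t : ℂ) ^ k * Complex.exp (w * t)) * ((p t : ℂ) -
        ∑ l ∈ s, c l * Complex.exp (2 * Real.pi * Complex.I * l * t / (2 * Real.pi / ω : ℝ)))).re := by
    simp only [hterm]
    rw [mul_sub, Complex.sub_re, Finset.mul_sum, Complex.re_sum, mul_assoc γ]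
  rw [hre, Real.norm_eq_abs]
  refine (Complex.abs_re_le_norm _).trans ?_
  rw [norm_mul]
  exact mul_le_mul_of_nonneg_right (hL t ht) (norm_nonneg _)

/-- The complex functions all of whose multiples have a real part with a mode expansion. -/
def complexModeExpansions (ω : ℝ) (m : ℕ) : Submodule ℂ (ℝ → ℂ) where
  carrier := {g | ∀ γ : ℂ, HasModeExpansion ω m (fun t => (γ * g t).re)}
  zero_mem' γ := by
    simp only [Pi.zero_apply, mul_zero, Complex.zero_re]
    exact HasModeExpansion.zero ω m
  add_mem' {g g'} hg hg' γ := by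
    simp only [Pi.add_apply, mul_add, Complex.add_re]
    exact (hg γ).add (hg' γ)
  smul_mem' c g hg γ := by
    simp only [Pi.smul_apply, smul_eq_mul, ← mul_assoc]
    exact hg (γ * c)

/-- Bilinearity reduces to monomials t^k e^{μt} and t^k' e^{μ't}. As k, k' ≤ n - 1, the product has
degree at most 2n - 2. -/
theorem expPoly_mul_periodic_mem {ω : ℝ} (hω : 0 < ω) {n : ℕ} {g g' : ℝ → ℂ} (hg : g ∈ expPoly n)
    (hg' : g' ∈ expPoly n) {p : ℝ → ℝ} (hp : Function.Periodic p (2 * Real.pi / ω))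
    (hp2 : MemLp p 2 (volume.restrict (Ioc 0 (2 * Real.pi / ω)))) :
    (fun t => g t * (p t : ℂ) * g' t) ∈ complexModeExpansions ω (2 * n - 2) := by
  induction hg using Submodule.span_induction with
  | zero =>
    simp only [Pi.zero_apply, zero_mul]
    exact zero_mem _
  | add x y _ _ hx hy =>
    simp only [Pi.add_apply, add_mul]
    exact add_mem hx hy
  | smul c x _ hx =>
    simp only [Pi.smul_apply, smul_eq_mul, mul_assoc]
    have := Submodule.smul_mem _ c hx
    simpa only [mul_assoc] using! this
  | mem x hx =>
    obtain ⟨k, hk, μ, rfl⟩ := hx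
    induction hg' using Submodule.span_induction with
    | zero =>
      simp only [Pi.zero_apply, mul_zero]
      exact zero_mem _
    | add x y _ _ hx hy =>
      simp only [Pi.add_apply, mul_add]
      exact add_mem hx hy
    | smul c x _ hx =>
      have := Submodule.smul_mem _ c hx
      refine cast (congrArg (· ∈ complexModeExpansions ω (2 * n - 2)) ?_) this
      ext t
      simp only [Pi.smul_apply, smul_eq_mul]
      ring
    | mem x hx =>
      obtain ⟨k', hk', μ', rfl⟩ := hx
      intro γ
      have h := hasModeExpansion_exp_mul_periodic hω (m := 2 * n - 2) (k := k + k') (by omega)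
        (μ + μ') γ hp hp2
      refine cast (congrArg (HasModeExpansion ω (2 * n - 2)) ?_) h
      ext t
      rw [pow_add, add_mul, Complex.exp_add]
      congr 2
      ring

variable {n : ℕ}

theorem hasModeExpansion_conj {ω : ℝ} (hω : 0 < ω) (A : Mat n) {P : ℝ → Mat n}
    (hper : Function.Periodic P (2 * Real.pi / ω))
    (hP : ∀ i j, MemLp (fun t => P t i j) 2 (volume.restrict (Ioc 0 (2 * Real.pi / ω))))
    (i j : Fin n) : HasModeExpansion ω (2 * n - 2) (fun t => conj A P t i j) := by
  have hterm : ∀ p q, (fun t => (flow A (-t) i p : ℂ) * (P t p q : ℂ) * (flow A t q j : ℂ)) ∈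
      complexModeExpansions ω (2 * n - 2) := by
    intro p q
    simp only [flow_neg_eq]
    exact expPoly_mul_periodic_mem hω (flow_mem_expPoly (-A) i p) (flow_mem_expPoly A q j)
      (p := fun t => P t p q) (fun t => by simp only [hper t]) (hP p q)
  have h := HasModeExpansion.sum (Finset.univ : Finset (Fin n)) fun q _ =>
    HasModeExpansion.sum (Finset.univ : Finset (Fin n)) fun p _ => hterm p q 1
  refine cast (congrArg (HasModeExpansion ω (2 * n - 2)) ?_) h
  ext t
  simp only [Finset.sum_apply, conj_apply]
  refine Finset.sum_congr rfl fun q _ => Finset.sum_congr rfl fun p _ => ?_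
  rw [one_mul, ← Complex.ofReal_mul, ← Complex.ofReal_mul, Complex.ofReal_re]

/-- Each entry brings its own finite sets of exponents and frequency classes. Their unions serve all
entries, with coefficients zero where an entry lacks the mode. -/
theorem exists_isExpansion {ω : ℝ} {M : ℝ → Mat n}
    (h : ∀ i j, HasModeExpansion ω (2 * n - 2) (fun t => M t i j)) :
    ∃ S C D, IsExpansion ω M S C D := by
  classical
  choose a b c d hcd hsum using fun i j => (h i j).exists_coeff
  set a' : Finset ℝ := Finset.univ.biUnion fun i => Finset.univ.biUnion fun j => a i j with ha'
  set b' : Finset ℝ := Finset.univ.biUnion fun i => Finset.univ.biUnion fun j => b i j with hb'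
  have hsub : ∀ i j, modeIndices ω (2 * n - 2) (a i j) (b i j) ⊆
      modeIndices ω (2 * n - 2) a' b' := fun i j => modeIndices_mono
    (fun x hx => Finset.mem_biUnion.2 ⟨i, Finset.mem_univ _,
      Finset.mem_biUnion.2 ⟨j, Finset.mem_univ _, hx⟩⟩)
    (fun x hx => Finset.mem_biUnion.2 ⟨i, Finset.mem_univ _,
      Finset.mem_biUnion.2 ⟨j, Finset.mem_univ _, hx⟩⟩)
  refine ⟨modeIndices ω (2 * n - 2) a' b', fun σ => Matrix.of fun i j => c i j σ,
    fun σ => Matrix.of fun i j => d i j σ, ?_, fun σ hσ => hσ.2.1, ⟨b', fun σ hσ => hσ.2.2.1⟩,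
    fun σ hσ => hσ.2.2.2, fun R _ i j => ?_⟩
  · refine a'.finite_toSet.subset ?_
    rintro _ ⟨σ, hσ, rfl⟩
    exact hσ.1
  · set S := modeIndices ω (2 * n - 2) a' b' with hS
    have hmode : ∀ σ, σ ∉ range (Subtype.val : S → ℝ × ℝ × ℕ) →
        scalarMode (c i j) (d i j) σ = 0 := by
      intro σ hσ
      have := hcd i j σ fun hmem => hσ ⟨⟨σ, hsub i j hmem⟩, rfl⟩
      ext t
      simp [scalarMode, this.1, this.2]
    -- As terms outside S vanish, finite sums over all triples and over S have the same image
    -- filter.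
    have hmap := Subtype.val_injective.map_atTop_finsetSum_eq
      (f := fun σ => scalarMode (c i j) (d i j) σ) hmode
    have h1 : Tendsto (fun f : ℝ → ℝ => eLpNorm (fun t => M t i j - f t) 2
        (volume.restrict (Icc (-R) R)))
        (map (fun s : Finset (ℝ × ℝ × ℕ) => ∑ σ ∈ s, scalarMode (c i j) (d i j) σ) atTop)
        (𝓝 0) := by
      rw [tendsto_map'_iff]
      refine (hsum i j R).congr fun s => ?_
      simp only [Function.comp, Finset.sum_apply]
    rw [← hmap, tendsto_map'_iff] at h1
    refine h1.congr fun s => ?_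
    simp only [Function.comp, Finset.sum_apply]
    rfl

end ModeSums

end TemporalHomogenization

/-! ### The homogenization theorem -/

theorem theorem1 (n : ℕ) (A : Mat n) (ω : ℝ) (hω : 0 < ω) (P : ℝ → Mat n)
    (hper : Function.Periodic P (2 * Real.pi / ω))
    (hP : ∀ i j, MemLp (fun t => P t i j) 2 (volume.restrict (Ioc 0 (2 * Real.pi / ω)))) :
    (UniformlyBounded (conj A P) →
      ∃ B : Mat n,
        (∀ Chat : ℝ, 0 < Chat → ∃ C : ℝ, 0 < C ∧
          ∀ ε : ℝ, 0 < ε → ∀ f : ℝ → Vec n,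
            IntegrableOn (fun τ => act (flow A (-τ)) (f τ)) (Icc 0 (Chat / ε)) →
            ∀ x : ℝ → Vec n, IsSolution (Chat / ε) (fun t => A + ε • P t) f x →
              (∃ Ω : ℝ → Vec n, Ω 0 = x 0 ∧
                IsSolution (Chat / ε) (fun _ => ε • B)
                  (fun t => ε • act (conj A P t) (forcing A f t)) Ω) ∧
              ∀ Ω : ℝ → Vec n, Ω 0 = x 0 →
                IsSolution (Chat / ε) (fun _ => ε • B)
                  (fun t => ε • act (conj A P t) (forcing A f t)) Ω →
                ∃ E : ℝ → Vec n, ∀ t ∈ Icc 0 (Chat / ε),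
                  x t = act (flow A t) (Ω t + forcing A f t + E t) ∧
                  ‖E t‖ ≤ C * ε * Real.exp (ε ^ 2 * C * t) *
                    (maxNorm Ω t + maxNorm (forcing A f) t)) ∧
        IsGrowthComponent ω (conj A P) (fun _ => B) ∧
        Tendsto (timeAverage (conj A P)) atTop (𝓝 B)) ∧
    ((∃ L : Mat n, Tendsto (timeAverage (conj A P)) atTop (𝓝 L)) ↔
      L2UniformlyBounded (2 * Real.pi / ω) (conj A P)) ∧
    ((∃ K : ℝ, ∀ᵐ t : ℝ, ∀ i j, |P t i j| ≤ K) →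
      ((∃ L : Mat n, Tendsto (timeAverage (conj A P)) atTop (𝓝 L)) ↔
        UniformlyBounded (conj A P))) := by
  have hT : 0 < 2 * Real.pi / ω := by positivity
  have hMi := intervalIntegrable_conj (A := A) hT hper hP
  refine ⟨fun hUB => ?_,
    ⟨fun ⟨L, hL⟩ => l2UniformlyBounded_of_tendsto hT hper hP hL, fun h => ?_⟩,
    fun hPb => ⟨fun ⟨L, hL⟩ => uniformlyBounded_of_tendsto hT hper hP hPb hL, fun h => ?_⟩⟩
  · obtain ⟨B, K, hΨ⟩ := exists_mean_bounded_primitive hT hper hP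
      (l2UniformlyBounded_of_uniformlyBounded hT hper hP hUB)
    exact ⟨B, fun Chat hChat => cell_problem_approximation hUB hMi hΨ hChat,
      ⟨exists_isExpansion (hasModeExpansion_conj hω A hper hP),
        fun S C D h => h.hasL2Sum_growthIndices hω hMi hUB hΨ⟩, tendsto_timeAverage hΨ⟩
  · obtain ⟨B, K, hΨ⟩ := exists_mean_bounded_primitive hT hper hP h
    exact ⟨B, tendsto_timeAverage hΨ⟩
  · obtain ⟨B, K, hΨ⟩ := exists_mean_bounded_primitive hT hper hP
      (l2UniformlyBounded_of_uniformlyBounded hT hper hP h)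
    exact ⟨B, tendsto_timeAverage hΨ⟩
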